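/- Let $(M^{2n},J)$, $n>1$, be a connected smooth almost complex manifold, $J^2=-\mathbf 1$, with Nijenhuis tensor $N_J(\xi,\eta)=[J\xi,J\eta]-J[\xi,J\eta]-J[J\xi,\eta]-[\xi,\eta]$, and let $G=\mathrm{Sym}_{\mathrm{loc}}(M,J)$ be the pseudogroup of its local symmetries, i.e. of the diffeomorphisms between open subsets of $M$ whose differentials commute with $J$. (i) Suppose $n>2$ and $N_J:\Lambda^2_{\mathbb C}T_xM\to T_xM$ is onto for every $x\in M$. Then $G$ is finite-dimensional and is a (local) Lie group, with $\dim G<2(n^2+n)$. That is: for every connected open $U\subset M$ the real vector space of infinitesimal symmetries on $U$ (smooth vector fields $X$ on $U$ with $L_XJ=0$) has finite dimension, less than $2(n^2+n)$; and for every $x\in M$ there are $d<2(n^2+n)$, a neighbourhood $U$ of $x$, and a smooth family of elements $\Phi_t:U\to M$ of $G$, with $t$ in a neighbourhood $B$ of $0\in\mathbb R^d$, such that $\Phi_0=\mathrm{id}$; different $\Phi_t$ have different germs at $x$; for small $s,t$ one has $\Phi_s\circ\Phi_t=\Phi_{m(s,t)}$ near $x$ with a smooth multiplication $m$; and whenever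 a sequence of elements of $G$, all defined on one neighbourhood $V$ of $x$, converges to the identity in the $C^1$ topology on compact subsets of $V$, all but finitely many of its members coincide near $x$ with some $\Phi_t$, $t\in B$. (ii) At every point $x$ with $N_J|_x\neq0$, $G$ depends formally on at most $n-1$ complex functions of $n-1$ complex variables (and possibly some functions of fewer variables). That is: call a smooth vector field $X$ a formal infinitesimal symmetry at $x$ if $L_XJ$ vanishes to infinite order at $x$, and let $h_x(k)$ be the real dimension of the space of $k$-jets at $x$ of formal infinitesimal symmetries. Then there is a real polynomial $Q$ of degree less than $n-1$ (depending on $x$) with $$h_x(k)\le 2(n-1)\binom{k+n-1}{n-1}+Q(k)\qquad\text{for all }k\ge0 ,$$ where $2(n-1)\binom{k+n-1}{n-1}$ is the real dimension of the space of $k$-jets of $n-1$ holomorphic functions of $n-1$ variables. -/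

import Mathlib

open Set Filter Topology Bundle VectorField
open scoped Manifold ContDiff

noncomputable section

namespace AlmostComplex

section Basic

variable (n : ℕ) (M : Type*) [TopologicalSpace M]
  [ChartedSpace (EuclideanSpace ℝ (Fin (2 * n))) M] [IsManifold (𝓡 (2 * n)) ∞ M]

/-- A (not necessarily continuous) vector field on `M`. -/
abbrev VField : Type _ := (x : M) → TangentSpace (𝓡 (2 * n)) x

/-- A smooth almost complex structure on the `2n`-dimensional manifold `M`: a smooth field of
endomorphisms `J` of the tangent bundle with `J² = -1`. -/
structure AlmostComplexStructure where
  /-- the endomorphism of each tangent space -/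
  toFun : (x : M) → TangentSpace (𝓡 (2 * n)) x →L[ℝ] TangentSpace (𝓡 (2 * n)) x
  sq_eq_neg : ∀ (x : M) (v : TangentSpace (𝓡 (2 * n)) x), toFun x (toFun x v) = -v
  smooth : ContMDiff (𝓡 (2 * n))
    ((𝓡 (2 * n)).prod
      𝓘(ℝ, EuclideanSpace ℝ (Fin (2 * n)) →L[ℝ] EuclideanSpace ℝ (Fin (2 * n)))) ∞
    (fun x => TotalSpace.mk' (EuclideanSpace ℝ (Fin (2 * n)) →L[ℝ] EuclideanSpace ℝ (Fin (2 * n)))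
      (E := fun x : M => TangentSpace (𝓡 (2 * n)) x →L[ℝ] TangentSpace (𝓡 (2 * n)) x) x (toFun x))

variable {n M}

/-- The vector field `X` is smooth on the set `U`. -/
def VField.SmoothOn (X : VField n M) (U : Set M) : Prop :=
  ContMDiffOn (𝓡 (2 * n)) (𝓡 (2 * n)).tangent ∞
    (fun x => (⟨x, X x⟩ : TangentBundle (𝓡 (2 * n)) M)) U

/-- The vector field `X` is smooth on all of `M`. -/
abbrev VField.Smooth (X : VField n M) : Prop := X.SmoothOn univ

/-- The components of the vector field `X` in the preferred chart around `x`, a map between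
(open parts of) `ℝ²ⁿ`. -/
def VField.inChart (X : VField n M) (x : M) :
    EuclideanSpace ℝ (Fin (2 * n)) → EuclideanSpace ℝ (Fin (2 * n)) :=
  mpullback 𝓘(ℝ, EuclideanSpace ℝ (Fin (2 * n))) (𝓡 (2 * n)) (extChartAt (𝓡 (2 * n)) x).symm X

/-- The `k`-jet of the vector field `X` at `x`, as the tuple of its derivatives of order
`0, …, k` at `x` in the preferred chart around `x`. -/
def VField.jet (X : VField n M) (x : M) (k : ℕ) :
    (i : Fin (k + 1)) → ContinuousMultilinearMap ℝ
      (fun _ : Fin (i : ℕ) => EuclideanSpace ℝ (Fin (2 * n))) (EuclideanSpace ℝ (Fin (2 * n))) :=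
  fun i => iteratedFDeriv ℝ i (X.inChart x) (extChartAt (𝓡 (2 * n)) x x)

namespace AlmostComplexStructure

variable (J : AlmostComplexStructure n M)

/-- The vector field `J X`. -/
def app (X : VField n M) : VField n M := fun x => J.toFun x (X x)

/-- The Nijenhuis tensor
`N_J(X, Y) = [JX, JY] - J[X, JY] - J[JX, Y] - [X, Y]` on vector fields. -/
def nijenhuis (X Y : VField n M) : VField n M :=
  mlieBracket (𝓡 (2 * n)) (J.app X) (J.app Y)
    - J.app (mlieBracket (𝓡 (2 * n)) X (J.app Y))
    - J.app (mlieBracket (𝓡 (2 * n)) (J.app X) Y)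
    - mlieBracket (𝓡 (2 * n)) X Y

/-- The image at `x` of the Nijenhuis tensor, viewed as a map from the second exterior power of
`T_x M` to `T_x M`: the span of its values. (As `N_J` is antilinear in each argument, the real and
the complex span agree, and so do the images of the real and the complex exterior powers.) -/
def nijenhuisImage (x : M) : Submodule ℝ (TangentSpace (𝓡 (2 * n)) x) :=
  Submodule.span ℝ {w | ∃ X Y : VField n M, X.Smooth ∧ Y.Smooth ∧ J.nijenhuis X Y x = w}

/-- `N_J` is surjective as a map `Λ²T_x M → T_x M` at every point `x`. -/
def NijenhuisOnto : Prop := ∀ x : M, J.nijenhuisImage x = ⊤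

/-- `N_J` is not zero at the point `x`. -/
def NijenhuisNeZeroAt (x : M) : Prop :=
  ∃ X Y : VField n M, X.Smooth ∧ Y.Smooth ∧ J.nijenhuis X Y x ≠ 0

/-- The Lie derivative `(L_X J)(Y) = [X, JY] - J[X, Y]`. -/
def lieDeriv (X Y : VField n M) : VField n M :=
  mlieBracket (𝓡 (2 * n)) X (J.app Y) - J.app (mlieBracket (𝓡 (2 * n)) X Y)

/-! ### The pseudogroup of local symmetries -/

/-- Smooth maps defined on open sets that commute with `J`. -/
def symPregroupoid : Pregroupoid M where
  property f U := ContMDiffOn (𝓡 (2 * n)) (𝓡 (2 * n)) ∞ f U ∧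
    ∀ x ∈ U, ∀ v : TangentSpace (𝓡 (2 * n)) x,
      mfderiv (𝓡 (2 * n)) (𝓡 (2 * n)) f x (J.toFun x v)
        = J.toFun (f x) (mfderiv (𝓡 (2 * n)) (𝓡 (2 * n)) f x v)
  comp := by
    rintro f g u v ⟨hf, hf'⟩ ⟨hg, hg'⟩ hu hv huv
    refine ⟨hg.comp' hf, ?_⟩
    rintro x ⟨hx, hxv⟩ w
    have h1 : MDifferentiableAt (𝓡 (2 * n)) (𝓡 (2 * n)) f x :=
      (hf.contMDiffAt (hu.mem_nhds hx)).mdifferentiableAt (by simp)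
    have h2 : MDifferentiableAt (𝓡 (2 * n)) (𝓡 (2 * n)) g (f x) :=
      (hg.contMDiffAt (hv.mem_nhds hxv)).mdifferentiableAt (by simp)
    rw [mfderiv_comp x h2 h1]
    change mfderiv (𝓡 (2 * n)) (𝓡 (2 * n)) g (f x)
        (mfderiv (𝓡 (2 * n)) (𝓡 (2 * n)) f x (J.toFun x w))
      = J.toFun (g (f x)) (mfderiv (𝓡 (2 * n)) (𝓡 (2 * n)) g (f x)
        (mfderiv (𝓡 (2 * n)) (𝓡 (2 * n)) f x w))
    rw [hf' x hx, hg' _ hxv]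
  id_mem := by
    refine ⟨contMDiffOn_id, ?_⟩
    intro x _ v
    rw [mfderiv_id]
    rfl
  locality := by
    intro f u hu h
    refine ⟨?_, ?_⟩
    · intro x hx
      obtain ⟨v, hv, hxv, h1, -⟩ := h x hx
      exact (h1.contMDiffAt ((hu.inter hv).mem_nhds ⟨hx, hxv⟩)).contMDiffWithinAt
    · intro x hx
      obtain ⟨v, hv, hxv, -, h2⟩ := h x hx
      exact h2 x ⟨hx, hxv⟩
  congr := by
    rintro f g u hu hfg ⟨h1, h2⟩
    refine ⟨h1.congr hfg, ?_⟩
    intro x hx v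
    have he : g =ᶠ[𝓝 x] f := Filter.eventually_of_mem (hu.mem_nhds hx) hfg
    have h3 := h2 x hx v
    rw [← hfg x hx] at h3
    rw [he.mfderiv_eq]
    exact h3

/-- The pseudogroup `G = Sym_loc(M, J)` of local symmetries of `J`: the diffeomorphisms between
open subsets of `M` whose differentials commute with `J`. -/
def symPseudogroup : StructureGroupoid M := J.symPregroupoid.groupoid

/-! ### Infinitesimal symmetries -/

/-- The space of infinitesimal symmetries of `J` on the open set `U`: the smooth vector fields `X`
on `U` with `L_X J = 0` on `U` (extended by zero outside `U`). -/
def infSym (U : Set M) (hU : IsOpen U) : Submodule ℝ (VField n M) where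
  carrier := {X | X.SmoothOn U ∧ (∀ x ∉ U, X x = 0) ∧
    ∀ Y : VField n M, Y.Smooth → ∀ x ∈ U, J.lieDeriv X Y x = 0}
  zero_mem' := by
    refine ⟨?_, fun _ _ => rfl, ?_⟩
    · exact (contMDiff_zeroSection ℝ (TangentSpace (𝓡 (2 * n)) : M → Type _)).contMDiffOn
    · intro Y _ x _
      simp [lieDeriv, app]
  add_mem' := by
    rintro X X' ⟨h1, h2, h3⟩ ⟨h1', h2', h3'⟩
    refine ⟨ContMDiffOn.add_section h1 h1', fun x hx => by simp [h2 x hx, h2' x hx], ?_⟩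
    intro Y hY x hx
    have hd := (h1.contMDiffAt (hU.mem_nhds hx)).mdifferentiableAt (by simp)
    have hd' := (h1'.contMDiffAt (hU.mem_nhds hx)).mdifferentiableAt (by simp)
    have e := h3 Y hY x hx
    have e' := h3' Y hY x hx
    simp only [lieDeriv, app, Pi.sub_apply] at e e' ⊢
    rw [mlieBracket_add_left hd hd', mlieBracket_add_left hd hd', map_add, add_sub_add_comm, e, e',
      add_zero]
  smul_mem' := by
    rintro c X ⟨h1, h2, h3⟩
    refine ⟨ContMDiffOn.const_smul_section h1, fun x hx => by simp [h2 x hx], ?_⟩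
    intro Y hY x hx
    have hd := (h1.contMDiffAt (hU.mem_nhds hx)).mdifferentiableAt (by simp)
    have e := h3 Y hY x hx
    simp only [lieDeriv, app, Pi.sub_apply] at e ⊢
    rw [mlieBracket_const_smul_left hd, mlieBracket_const_smul_left hd, map_smul, ← smul_sub, e,
      smul_zero]

/-- The vector field `X` is a formal infinitesimal symmetry of `J` at `x`: `L_X J` vanishes to
infinite order at `x`. Only the infinite jet of `X` at `x` matters. -/
def IsFormalSymmetryAt (X : VField n M) (x : M) : Prop :=
  X.Smooth ∧ ∀ Y : VField n M, Y.Smooth → ∀ k : ℕ, (J.lieDeriv X Y).jet x k = 0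

/-- The space of `k`-jets at `x` of formal infinitesimal symmetries of `J` at `x`. -/
def formalSymJets (x : M) (k : ℕ) : Submodule ℝ
    ((i : Fin (k + 1)) → ContinuousMultilinearMap ℝ
      (fun _ : Fin (i : ℕ) => EuclideanSpace ℝ (Fin (2 * n))) (EuclideanSpace ℝ (Fin (2 * n)))) :=
  Submodule.span ℝ {j | ∃ X : VField n M, J.IsFormalSymmetryAt X x ∧ X.jet x k = j}

/-- The formal counting function of `G` at `x`: the real dimension of the space of `k`-jets at `x`
of formal infinitesimal symmetries, as a function of `k`. -/
def formalDim (x : M) (k : ℕ) : ℕ := Module.finrank ℝ (J.formalSymJets x k)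

end AlmostComplexStructure

/-- The pseudogroup `G` of local diffeomorphisms is, near `x`, a local Lie group of dimension `d`:
there are a neighbourhood `U` of `x` and a smooth family `Φ t : U → M`, `t` in a neighbourhood `B`
of `0` in `ℝᵈ`, such that
* `Φ 0` is the identity, every `Φ t` belongs to `G`, and different `t` give different germs at `x`;
* for parameters close to `0` the composition is given by a smooth multiplication `m` of parameters;
* the family exhausts `G` near the identity: if elements `e k` of `G`, all defined on the same
  neighbourhood `V` of `x`, converge to the identity uniformly with first derivatives on compact
  subsets of `V` (expressed as continuous convergence of the tangent maps), then for large `k` the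
  germ of `e k` at `x` is that of some `Φ t`. -/
def IsLocalLieGroupAt (G : StructureGroupoid M) (d : ℕ) (x : M) : Prop :=
  ∃ (U : Set M) (B B₀ : Set (EuclideanSpace ℝ (Fin d))) (Φ : EuclideanSpace ℝ (Fin d) → M → M)
    (m : EuclideanSpace ℝ (Fin d) × EuclideanSpace ℝ (Fin d) → EuclideanSpace ℝ (Fin d)),
    IsOpen U ∧ x ∈ U ∧ IsOpen B ∧ IsOpen B₀ ∧ 0 ∈ B₀ ∧ B₀ ⊆ B ∧
    ContMDiffOn ((𝓡 d).prod (𝓡 (2 * n))) (𝓡 (2 * n)) ∞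
      (fun p : EuclideanSpace ℝ (Fin d) × M => Φ p.1 p.2) (B ×ˢ U) ∧
    (∀ y ∈ U, Φ 0 y = y) ∧
    (∀ t ∈ B, ∃ e ∈ G, e.source = U ∧ EqOn e (Φ t) U) ∧
    (∀ s ∈ B, ∀ t ∈ B, Φ s =ᶠ[𝓝 x] Φ t → s = t) ∧
    ContDiffOn ℝ ∞ m (B₀ ×ˢ B₀) ∧
    (∀ s ∈ B₀, ∀ t ∈ B₀, m (s, t) ∈ B ∧ Φ t x ∈ U ∧
      (fun y => Φ s (Φ t y)) =ᶠ[𝓝 x] Φ (m (s, t))) ∧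
    (∀ V : Set M, IsOpen V → x ∈ V → ∀ e : ℕ → OpenPartialHomeomorph M M,
      (∀ k, e k ∈ G ∧ V ⊆ (e k).source) →
      (∀ v : TangentBundle (𝓡 (2 * n)) M, v.proj ∈ V →
        Tendsto (fun p : ℕ × TangentBundle (𝓡 (2 * n)) M =>
          tangentMap (𝓡 (2 * n)) (𝓡 (2 * n)) (e p.1) p.2) (atTop ×ˢ 𝓝 v) (𝓝 v)) →
      ∀ᶠ k in atTop, ∃ t ∈ B, e k =ᶠ[𝓝 x] Φ t)

end Basic

/-- The counting function `h` of real dimensions of `k`-jets is that of objects depending on at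
most `s` complex functions of `p` complex variables, up to functions of fewer variables: `h k` is at
most the real dimension of the space of `k`-jets of `s` holomorphic functions of `p` variables,
plus a polynomial in `k` of degree less than `p`. Equivalently, the growth of `h` is bounded by a
polynomial of degree at most `p`, with coefficient of `k ^ p` at most `2 s / p!`. -/
def DependsOnAtMost (h : ℕ → ℕ) (s p : ℕ) : Prop :=
  ∃ Q : Polynomial ℝ, Q.degree < (p : WithBot ℕ) ∧
    ∀ k : ℕ, (h k : ℝ) ≤ 2 * s * ((k + p).choose p : ℝ) + Q.eval (k : ℝ)

end AlmostComplex

end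

noncomputable section

namespace AlmostComplex

set_option maxSynthPendingDepth 3

/-! A map commuting with `J` also preserves the Nijenhuis tensor N. Adjoining this consequence to
the equation gives a first order system on 1-jets (`symEq`), whose symbol at the identity consists
of the complex endomorphisms A with A N(ξ,η) = N(Aξ,η) + N(ξ,Aη). The key remark concerns its
prolongation. If S is symmetric and each S_ζ is such an endomorphism, then S is complex linear in ζ
as well. So in S_ζ N(ξ,η) = N(S_ζ ξ,η) + N(ξ,S_ζ η) the left side is linear in ζ and the right side
antilinear. Both vanish, and S kills the image of N.

(i) If N is onto, then S = 0 (`eq_zero_of_prolongation`), so the system is of finite type: 1-jets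
determine second derivatives. A Gronwall estimate along rays and connectedness show that an
infinitesimal symmetry is determined by its 1-jet at one point. The 1-jets with zero value form a
space of complex endomorphisms that does not contain the identity, which would give N = 2N. Its
dimension is therefore below 2n², and adding 2n for the values gives the bound (`finrank_jets_lt`).

For the local group, take a linear family of fields realizing the 1-jets at x of all germs of
infinitesimal symmetries. Its time-one maps are symmetries (`exists_flow`). They exhaust the
symmetries near the identity because of `exists_rigidity`. Solving an ODE along rays extends every
1-jet j near that of the identity to a map φ(j,·), and every symmetry near the identity is of this
form. The failure of φ(j,·) to commute with `J` at a point y is a function of j, and the common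
kernel of the linearizations of these functions at the identity jet contains only jets of
infinitesimal symmetries. By finite dimensionality finitely many y suffice. Together with a
projection P onto the jets of infinitesimal symmetries these functions are injective near the
identity jet, so a symmetry near the identity is determined by P of its jet. The time-one maps
attain every value of P near that of the identity. No constant rank assumption enters, and the
multiplication is smooth because it is read off from P of the jet of a composite. Smooth dependence
for the ODEs comes from the inverse function theorem in the Banach space of curves
(`exists_contDiffOn_solution`).

(ii) The leading term A, of degree at least 2, of a formal symmetry satisfies the same equations, so
A vanishes as soon as one argument is a value of N, and N(A(v,ξ),η) + N(ξ,A(v,η)) = 0. Choose ξ, η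
with l = N(ξ,η) ≠ 0 and ξ outside ℂl, and complete l, ξ by n−2 vectors e to generators. Then A is a
polynomial in the n−1 variables ξ, e. If its values lie in ℂξ, the last identity forces A(v,ξ) = 0,
and A involves only the n−2 variables e. So n−1 complex components count polynomials in n−1
variables, and the rest is of lower order (`IsSymbol.eq_zero`, `finrank_formal_jets_le`). -/

/-! ### Composition operators on spaces of continuous maps -/

section Nemytskii

universe u

variable {K : Type u} [TopologicalSpace K] [CompactSpace K]
  {X Y : Type u} [NormedAddCommGroup X] [NormedSpace ℝ X] [NormedAddCommGroup Y] [NormedSpace ℝ Y]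

/-- The pointwise application of a continuous family of operators to a continuous map. -/
def pointwiseApply (K X Y : Type u) [TopologicalSpace K] [CompactSpace K]
    [NormedAddCommGroup X] [NormedSpace ℝ X] [NormedAddCommGroup Y] [NormedSpace ℝ Y] :
    C(K, X →L[ℝ] Y) →L[ℝ] C(K, X) →L[ℝ] C(K, Y) :=
  LinearMap.mkContinuous₂
    (LinearMap.mk₂ ℝ (fun (A : C(K, X →L[ℝ] Y)) (c : C(K, X)) =>
      (⟨fun s => A s (c s), A.continuous.clm_apply c.continuous⟩ : C(K, Y)))
      (fun _ _ _ => by ext; simp) (fun _ _ _ => by ext; simp)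
      (fun _ _ _ => by ext; simp) (fun _ _ _ => by ext; simp)) 1 (by
      intro A c
      rw [ContinuousMap.norm_le _ (by positivity)]
      intro s
      simp only [LinearMap.mk₂_apply, ContinuousMap.coe_mk, one_mul]
      exact (A s).le_of_opNorm_le_of_le (A.norm_coe_le_norm s) (c.norm_coe_le_norm s))

@[simp]
theorem pointwiseApply_apply (A : C(K, X →L[ℝ] Y)) (c : C(K, X)) (s : K) :
    pointwiseApply K X Y A c s = A s (c s) := rfl

/-- The range of `c` is compact, so `fderiv ℝ f` is uniformly continuous at its points; the mean
value inequality then bounds the remainder uniformly in the parameter `s`. -/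
theorem hasFDerivAt_continuousMap_comp {f : X → Y} (hf : ContDiff ℝ 1 f) (c : C(K, X)) :
    HasFDerivAt (fun c : C(K, X) => (⟨f, hf.continuous⟩ : C(X, Y)).comp c)
      (pointwiseApply K X Y
        ((⟨fderiv ℝ f, hf.continuous_fderiv one_ne_zero⟩ : C(X, X →L[ℝ] Y)).comp c)) c := by
  have hf' := hf.continuous_fderiv one_ne_zero
  rw [hasFDerivAt_iff_isLittleO_nhds_zero, Asymptotics.isLittleO_iff]
  intro ε hε
  have hu := (isCompact_range c.continuous).uniformContinuousAt_of_continuousAt (fderiv ℝ f)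
    (fun a _ => hf'.continuousAt) (Metric.dist_mem_uniformity hε)
  obtain ⟨δ, hδ, hu⟩ := Metric.mem_uniformity_dist.1 hu
  filter_upwards [Metric.ball_mem_nhds (0 : C(K, X)) hδ] with h hh
  rw [ContinuousMap.norm_le _ (by positivity)]
  intro s
  have hs : ‖h s‖ < δ := (h.norm_coe_le_norm s).trans_lt (by simpa using hh)
  have key : ‖f (c s + h s) - f (c s) - fderiv ℝ f (c s) (c s + h s - c s)‖
      ≤ ε * ‖c s + h s - c s‖ := by
    refine (convex_ball (c s) δ).norm_image_sub_le_of_norm_fderiv_le' (𝕜 := ℝ) (fun x _ =>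
      (hf.differentiable one_ne_zero).differentiableAt) (fun x hx => ?_)
      (Metric.mem_ball_self hδ) (by simpa using hs)
    have := hu (a := c s) (b := x) (by rw [dist_comm]; exact hx) ⟨s, rfl⟩
    rw [← dist_eq_norm, dist_comm]
    exact le_of_lt this
  simp only [add_sub_cancel_left] at key
  simpa using key.trans (mul_le_mul_of_nonneg_left (h.norm_coe_le_norm s) hε.le)

/-- The derivative is again a composition operator, with `fderiv ℝ f` in place of `f`, followed by a
bounded bilinear map. This gives an induction on the order of differentiability in which the target
changes from `Y` to `X →L[ℝ] Y`; hence the common universe. -/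
theorem contDiff_continuousMap_comp {f : X → Y} (hf : ContDiff ℝ ∞ f) :
    ContDiff ℝ ∞ (fun c : C(K, X) => (⟨f, hf.continuous⟩ : C(X, Y)).comp c) := by
  rw [contDiff_infty]
  intro n
  induction n generalizing Y with
  | zero =>
    rw [Nat.cast_zero, contDiff_zero]
    exact ContinuousMap.continuous_postcomp _
  | succ n ih =>
    have h1 : ContDiff ℝ 1 f := hf.of_le (by simp)
    rw [Nat.cast_succ, contDiff_succ_iff_hasFDerivAt]
    refine ⟨_, ?_, hasFDerivAt_continuousMap_comp h1⟩
    exact (pointwiseApply K X Y).contDiff.comp (ih (hf.fderiv_right (by simp)))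

end Nemytskii

/-! ### The smooth inverse function theorem on a neighbourhood -/

/-- Invertibility of the derivative is an open condition. Restricting the local inverse to the
points where it holds makes the inverse smooth on all of its domain, not only at `f a`. -/
theorem exists_openPartialHomeomorph_contDiffOn_symm {X Y : Type*}
    [NormedAddCommGroup X] [NormedSpace ℝ X] [CompleteSpace X]
    [NormedAddCommGroup Y] [NormedSpace ℝ Y] [CompleteSpace Y] {f : X → Y} {O : Set X} {a : X}
    {f' : X ≃L[ℝ] Y} (hO : IsOpen O) (ha : a ∈ O) (hf : ContDiffOn ℝ ∞ f O)
    (hf' : HasFDerivAt f (f' : X →L[ℝ] Y) a) :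
    ∃ e : OpenPartialHomeomorph X Y, (e : X → Y) = f ∧ a ∈ e.source ∧ e.source ⊆ O ∧
      ContDiffOn ℝ ∞ e.symm e.target := by
  have hfa : ContDiffAt ℝ ∞ f a := hf.contDiffAt (hO.mem_nhds ha)
  let e₀ := hfa.toOpenPartialHomeomorph f hf' (by simp)
  have hcont : ContinuousOn (fderiv ℝ f) O := hf.continuousOn_fderiv_of_isOpen hO (by simp)
  have hopen : IsOpen (O ∩ fderiv ℝ f ⁻¹' range ((↑) : (X ≃L[ℝ] Y) → X →L[ℝ] Y)) :=
    hcont.isOpen_inter_preimage hO ContinuousLinearEquiv.isOpen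
  have h0 : (e₀ : X → Y) = f := hfa.toOpenPartialHomeomorph_coe hf' (by simp)
  refine ⟨e₀.restrOpen _ hopen, ?_, ?_, ?_, ?_⟩
  · exact h0
  · rw [OpenPartialHomeomorph.restrOpen_source]
    exact ⟨hfa.mem_toOpenPartialHomeomorph_source hf' (by simp), ha, f', hf'.fderiv.symm⟩
  · rw [OpenPartialHomeomorph.restrOpen_source]
    exact fun x hx => hx.2.1
  · intro y hy
    have hx := (e₀.restrOpen _ hopen).map_target hy
    rw [OpenPartialHomeomorph.restrOpen_source] at hx
    obtain ⟨-, hxO, f₁, hf₁⟩ := hx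
    have hd : HasFDerivAt f (f₁ : X →L[ℝ] Y) ((e₀.restrOpen _ hopen).symm y) := by
      rw [hf₁]
      exact ((hf.contDiffAt (hO.mem_nhds hxO)).differentiableAt (by simp)).hasFDerivAt
    refine (OpenPartialHomeomorph.contDiffAt_symm _ hy (f₀' := f₁) ?_ ?_).contDiffWithinAt
    · change HasFDerivAt (e₀ : X → Y) _ _
      rw [h0]
      exact hd
    · change ContDiffAt ℝ ∞ (e₀ : X → Y) _
      rw [h0]
      exact hf.contDiffAt (hO.mem_nhds hxO)

/-! ### Autonomous differential equations near a stationary point -/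

section ODE

variable {Z : Type} [NormedAddCommGroup Z] [NormedSpace ℝ Z] [CompleteSpace Z]

/-- The primitive vanishing at `0` of a continuous map on the unit interval. -/
def primitive (Z : Type) [NormedAddCommGroup Z] [NormedSpace ℝ Z] [CompleteSpace Z] :
    C(unitInterval, Z) →L[ℝ] C(unitInterval, Z) :=
  LinearMap.mkContinuous
    { toFun := fun g => ⟨fun s => ∫ u in (0 : ℝ)..s, IccExtend zero_le_one g u, by
        have : Continuous fun s : ℝ => ∫ u in (0 : ℝ)..s, IccExtend zero_le_one g u :=
          intervalIntegral.continuous_primitive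
            (fun a b => (g.continuous.Icc_extend' (h := zero_le_one)).intervalIntegrable a b) 0
        exact this.comp continuous_subtype_val⟩
      map_add' := fun g h => by
        ext s
        simp only [ContinuousMap.coe_mk, ContinuousMap.add_apply]
        rw [← intervalIntegral.integral_add
          ((g.continuous.Icc_extend' (h := zero_le_one)).intervalIntegrable _ _)
          ((h.continuous.Icc_extend' (h := zero_le_one)).intervalIntegrable _ _)]
        rfl
      map_smul' := fun r g => by
        ext s
        simp only [ContinuousMap.coe_mk, ContinuousMap.smul_apply, RingHom.id_apply]
        rw [← intervalIntegral.integral_smul]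
        rfl } 1 (by
    intro g
    rw [ContinuousMap.norm_le _ (by positivity)]
    intro s
    simp only [LinearMap.coe_mk, AddHom.coe_mk, ContinuousMap.coe_mk, one_mul]
    refine (intervalIntegral.norm_integral_le_of_norm_le_const (C := ‖g‖) ?_).trans ?_
    · intro u _
      exact g.norm_coe_le_norm _
    · have h0 := s.2.1
      have h1 := s.2.2
      rw [sub_zero, abs_of_nonneg h0]
      exact mul_le_of_le_one_right (norm_nonneg g) h1)

theorem primitive_apply (g : C(unitInterval, Z)) (s : unitInterval) :
    primitive Z g s = ∫ u in (0 : ℝ)..s, IccExtend zero_le_one g u := rfl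

@[simp]
theorem primitive_apply_zero (g : C(unitInterval, Z)) : primitive Z g 0 = 0 := by
  simp [primitive_apply]

theorem primitive_const (z : Z) (s : unitInterval) :
    primitive Z (ContinuousMap.const _ z) s = (s : ℝ) • z := by
  simp [primitive_apply, IccExtend]

theorem map_primitive {Z' : Type} [NormedAddCommGroup Z'] [NormedSpace ℝ Z'] [CompleteSpace Z']
    (A : Z →L[ℝ] Z') (g : C(unitInterval, Z)) (s : unitInterval) :
    A (primitive Z g s) = primitive Z' ((A : C(Z, Z')).comp g) s := by
  rw [primitive_apply, primitive_apply, ← ContinuousLinearMap.intervalIntegral_comp_comm _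
    ((g.continuous.Icc_extend' (h := zero_le_one)).intervalIntegrable _ _)]
  rfl

/-- The extension of a curve to the whole line by constants. -/
theorem hasDerivWithinAt_of_eq_primitive {c g : C(unitInterval, Z)} {z : Z}
    (h : c = ContinuousMap.const _ z + primitive Z g) (s : unitInterval) :
    HasDerivWithinAt (IccExtend zero_le_one c) (g s) (Icc 0 1) s := by
  have h1 : HasDerivAt (fun s : ℝ => z + ∫ u in (0 : ℝ)..s, IccExtend zero_le_one g u)
      (IccExtend zero_le_one g s) s := by
    have hc : Continuous (IccExtend zero_le_one g) := g.continuous.Icc_extend'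
    exact (intervalIntegral.integral_hasDerivAt_right (hc.intervalIntegrable _ _)
      (hc.stronglyMeasurableAtFilter _ _) hc.continuousAt).const_add z
  have h2 : IccExtend zero_le_one g (s : ℝ) = g s := IccExtend_val _ _ _
  rw [h2] at h1
  refine h1.hasDerivWithinAt.congr_of_mem (fun u hu => ?_) s.2
  rw [IccExtend_of_mem _ _ hu, h]
  rfl

theorem eq_primitive_of_hasDerivWithinAt {c g : C(unitInterval, Z)}
    (h : ∀ s : unitInterval, HasDerivWithinAt (IccExtend zero_le_one c) (g s) (Icc 0 1) s) :
    c = ContinuousMap.const _ (c 0) + primitive Z g := by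
  ext s
  have hs0 : (0 : ℝ) ≤ s := s.2.1
  have hg : Continuous (IccExtend zero_le_one g) := g.continuous.Icc_extend'
  have := intervalIntegral.integral_eq_sub_of_hasDeriv_right_of_le (f := IccExtend zero_le_one c)
    (f' := IccExtend zero_le_one g) hs0
    ((c.continuous.Icc_extend' (h := zero_le_one)).continuousOn) (fun u hu => ?_)
    (hg.intervalIntegrable _ _)
  · simp only [ContinuousMap.add_apply, ContinuousMap.const_apply, primitive_apply]
    rw [this, IccExtend_val, IccExtend_of_mem _ _ (left_mem_Icc.2 zero_le_one)]
    have : (⟨0, left_mem_Icc.2 zero_le_one⟩ : Icc (0 : ℝ) 1) = (0 : unitInterval) := rfl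
    rw [this]
    abel
  · have hu' : u ∈ Icc (0 : ℝ) 1 := ⟨hu.1.le, hu.2.le.trans s.2.2⟩
    have h3 := h ⟨u, hu'⟩
    rw [IccExtend_of_mem _ _ hu']
    exact (h3.hasDerivAt (Icc_mem_nhds hu.1 (hu.2.trans_le s.2.2))).hasDerivWithinAt

/-- Near a stationary point at which the linearization squares to zero, an autonomous smooth
differential equation has solutions on the unit interval which depend smoothly, as curves, on the
initial value, and these are the only solutions that stay close to the stationary point. -/
theorem exists_contDiffOn_solution {R : Z → Z} {z₀ : Z} (hR : ContDiff ℝ ∞ R) (h0 : R z₀ = 0)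
    (h1 : ∀ v, fderiv ℝ R z₀ (fderiv ℝ R z₀ v) = 0) :
    ∃ (σ : Z → C(unitInterval, Z)) (O : Set Z), IsOpen O ∧ z₀ ∈ O ∧ ContDiffOn ℝ ∞ σ O ∧
      σ z₀ = ContinuousMap.const _ z₀ ∧
      (∀ z ∈ O, σ z = ContinuousMap.const _ z
        + primitive Z ((⟨R, hR.continuous⟩ : C(Z, Z)).comp (σ z))) ∧
      (∀ᶠ c in 𝓝 (ContinuousMap.const unitInterval z₀), ∀ z,
        c = ContinuousMap.const _ z + primitive Z ((⟨R, hR.continuous⟩ : C(Z, Z)).comp c) →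
        z ∈ O ∧ c = σ z) := by
  let N : C(unitInterval, Z) → C(unitInterval, Z) :=
    fun c => (⟨R, hR.continuous⟩ : C(Z, Z)).comp c
  have hN : ContDiff ℝ ∞ N := contDiff_continuousMap_comp hR
  -- A curve solves the equation with initial value `z` exactly when `G` maps it to the constant
  -- curve `z`. So solutions are obtained by inverting `G` near `c₀`.
  let G : C(unitInterval, Z) → C(unitInterval, Z) := fun c => c - primitive Z (N c)
  have hG : ContDiff ℝ ∞ G := contDiff_id.sub ((primitive Z).contDiff.comp hN)
  let c₀ := ContinuousMap.const unitInterval z₀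
  let A : C(unitInterval, Z) →L[ℝ] C(unitInterval, Z) :=
    primitive Z ∘L pointwiseApply unitInterval Z Z (ContinuousMap.const _ (fderiv ℝ R z₀))
  -- The linearization of the equation commutes with integration and squares to zero. Hence `G' = 1
  -- - A` has the explicit inverse `1 + A`.
  have hA : ∀ g, A (A g) = 0 := by
    intro g
    have hx : pointwiseApply unitInterval Z Z (ContinuousMap.const _ (fderiv ℝ R z₀)) (A g)
        = 0 := by
      ext s
      simp only [pointwiseApply_apply, ContinuousMap.const_apply, A,
        ContinuousLinearMap.comp_apply, map_primitive, ContinuousMap.zero_apply]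
      have : ((fderiv ℝ R z₀ : C(Z, Z)).comp (pointwiseApply unitInterval Z Z
          (ContinuousMap.const unitInterval (fderiv ℝ R z₀)) g)) = 0 := by
        ext u
        simp [h1]
      rw [this, map_zero]
      rfl
    exact (congrArg (primitive Z) hx).trans (map_zero _)
  have hG' : HasFDerivAt G (ContinuousLinearMap.id ℝ _ - A) c₀ := by
    refine (hasFDerivAt_id c₀).sub ((primitive Z).hasFDerivAt.comp c₀ ?_)
    exact hasFDerivAt_continuousMap_comp (hR.of_le (by simp)) c₀
  let G' : C(unitInterval, Z) ≃L[ℝ] C(unitInterval, Z) :=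
    ContinuousLinearEquiv.equivOfInverse (ContinuousLinearMap.id ℝ _ - A)
      (ContinuousLinearMap.id ℝ _ + A)
      (fun g => by simp [hA]) (fun g => by simp [hA])
  obtain ⟨e, he, hc₀, -, hsymm⟩ := exists_openPartialHomeomorph_contDiffOn_symm (f' := G')
    isOpen_univ (mem_univ c₀) hG.contDiffOn hG'
  let κ : Z →L[ℝ] C(unitInterval, Z) :=
    LinearMap.mkContinuous
      { toFun := fun z => ContinuousMap.const _ z, map_add' := fun _ _ => rfl,
        map_smul' := fun _ _ => rfl } 1 (fun z => by
        rw [ContinuousMap.norm_le _ (by positivity)]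
        exact fun s => (one_mul ‖z‖).ge)
  have hNc₀ : N c₀ = 0 := by
    ext s
    exact h0
  have hGc₀ : G c₀ = c₀ := by simp [G, hNc₀]
  have hec₀ : e c₀ = κ z₀ := by rw [he, hGc₀]; rfl
  refine ⟨fun z => e.symm (κ z), κ ⁻¹' e.target, e.open_target.preimage κ.continuous, ?_,
    hsymm.comp κ.contDiff.contDiffOn (fun z hz => hz), ?_, ?_, ?_⟩
  · rw [mem_preimage, ← hec₀]
    exact e.map_source hc₀
  · change e.symm (κ z₀) = c₀
    rw [← hec₀, e.left_inv hc₀]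
  · intro z hz
    have h2 : G (e.symm (κ z)) = κ z := by
      rw [← he]
      exact e.right_inv hz
    exact sub_eq_iff_eq_add.1 h2
  -- Uniqueness is injectivity of `G` on the source of the local inverse.
  · filter_upwards [e.open_source.mem_nhds hc₀] with c hc z hz
    have h2 : e c = κ z := by
      rw [he]
      exact sub_eq_iff_eq_add.2 hz
    refine ⟨?_, ?_⟩
    · rw [mem_preimage, ← h2]
      exact e.map_source hc
    · rw [← h2, e.left_inv hc]

end ODE

/-! ### The Nijenhuis tensor in coordinates -/

section Local

variable {E : Type} [NormedAddCommGroup E] [NormedSpace ℝ E]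

/-- The Nijenhuis tensor of a field of endomorphisms of a vector space. -/
def nij (J : E → E →L[ℝ] E) (y : E) : E →L[ℝ] E →L[ℝ] E :=
  (fderiv ℝ J y ∘L J y - ContinuousLinearMap.compL ℝ E E E (J y) ∘L fderiv ℝ J y)
    - (fderiv ℝ J y ∘L J y - ContinuousLinearMap.compL ℝ E E E (J y) ∘L fderiv ℝ J y).flip

theorem nij_apply (J : E → E →L[ℝ] E) (y ξ η : E) :
    nij J y ξ η = fderiv ℝ J y (J y ξ) η - J y (fderiv ℝ J y ξ η)
      - (fderiv ℝ J y (J y η) ξ - J y (fderiv ℝ J y η ξ)) := rfl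

theorem nij_swap (J : E → E →L[ℝ] E) (y ξ η : E) : nij J y ξ η = -nij J y η ξ := by
  simp only [nij_apply]
  abel

/-- Differentiate J² = −1 in the direction `ζ`. -/
theorem fderiv_apply_anticomm {J : E → E →L[ℝ] E} {y : E} (hJ : ContDiffAt ℝ ∞ J y)
    (h : ∀ᶠ y' in 𝓝 y, ∀ v, J y' (J y' v) = -v) (ζ v : E) :
    fderiv ℝ J y ζ (J y v) = -J y (fderiv ℝ J y ζ v) := by
  have hd : DifferentiableAt ℝ J y := hJ.differentiableAt (by simp)
  have h1 : HasFDerivAt (fun y' => J y' (J y' v)) _ y :=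
    hd.hasFDerivAt.clm_apply (hd.hasFDerivAt.clm_apply (hasFDerivAt_const v y))
  have h2 : HasFDerivAt (fun y' => J y' (J y' v)) (0 : E →L[ℝ] E) y :=
    (hasFDerivAt_const (-v) y).congr_of_eventuallyEq (h.mono fun y' hy' => hy' v)
  have h3 := congrArg (fun A : E →L[ℝ] E => A ζ) (h1.unique h2)
  simp at h3
  rw [eq_neg_iff_add_eq_zero, add_comm]
  exact h3

theorem nij_antilinear_left {J : E → E →L[ℝ] E} {y : E} (hJ : ContDiffAt ℝ ∞ J y)
    (h : ∀ᶠ y' in 𝓝 y, ∀ v, J y' (J y' v) = -v) (ξ η : E) :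
    nij J y (J y ξ) η = -J y (nij J y ξ η) := by
  have h2 := h.self_of_nhds
  simp only [nij_apply, fderiv_apply_anticomm hJ h, h2, map_neg, map_sub,
    neg_apply]
  abel

theorem nij_antilinear_right {J : E → E →L[ℝ] E} {y : E} (hJ : ContDiffAt ℝ ∞ J y)
    (h : ∀ᶠ y' in 𝓝 y, ∀ v, J y' (J y' v) = -v) (ξ η : E) :
    nij J y ξ (J y η) = -J y (nij J y ξ η) := by
  rw [nij_swap, nij_antilinear_left hJ h, nij_swap J y η ξ]
  simp

theorem contDiffAt_nij {J : E → E →L[ℝ] E} {y : E} (hJ : ContDiffAt ℝ ∞ J y) :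
    ContDiffAt ℝ ∞ (nij J) y := by
  have h1 : ContDiffAt ℝ ∞ (fderiv ℝ J) y := hJ.fderiv_right (by simp)
  have h2 : ContDiffAt ℝ ∞ (fun y => fderiv ℝ J y ∘L J y
      - ContinuousLinearMap.compL ℝ E E E (J y) ∘L fderiv ℝ J y) y :=
    (h1.clm_comp hJ).sub
      (((ContinuousLinearMap.compL ℝ E E E).contDiff.contDiffAt.comp y hJ).clm_comp h1)
  exact h2.sub ((ContinuousLinearMap.flipₗᵢ ℝ E E E).toContinuousLinearEquiv.contDiff.contDiffAt.comp
    y h2)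

/-- The Lie derivative of `J` along `X`, up to sign, in coordinates. -/
def infDefect (J : E → E →L[ℝ] E) (X : E → E) (y : E) : E →L[ℝ] E :=
  fderiv ℝ X y ∘L J y - J y ∘L fderiv ℝ X y - fderiv ℝ J y (X y)

/-- The Lie derivative of the Nijenhuis tensor along `X`, up to sign, in coordinates. -/
def nijDefect (J : E → E →L[ℝ] E) (X : E → E) (y ξ η : E) : E :=
  fderiv ℝ X y (nij J y ξ η) - nij J y (fderiv ℝ X y ξ) η - nij J y ξ (fderiv ℝ X y η)
    - fderiv ℝ (nij J) y (X y) ξ η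

theorem fderiv_clm_apply_const {F G H : Type} [NormedAddCommGroup F] [NormedSpace ℝ F]
    [NormedAddCommGroup G] [NormedSpace ℝ G] [NormedAddCommGroup H] [NormedSpace ℝ H]
    {A : F → G →L[ℝ] H} {y : F} (hA : DifferentiableAt ℝ A y) (ζ : F) (v : G) :
    fderiv ℝ A y ζ v = fderiv ℝ (fun y' => A y' v) y ζ := by
  rw [(hA.hasFDerivAt.clm_apply (hasFDerivAt_const v y)).fderiv]
  simp

theorem fderiv_infDefect {J : E → E →L[ℝ] E} {X : E → E} {y : E} (hJ : ContDiffAt ℝ ∞ J y)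
    (hX : ContDiffAt ℝ ∞ X y) (ζ v : E) :
    fderiv ℝ (infDefect J X) y ζ v = fderiv ℝ (fderiv ℝ X) y ζ (J y v)
      + fderiv ℝ X y (fderiv ℝ J y ζ v) - fderiv ℝ J y ζ (fderiv ℝ X y v)
      - J y (fderiv ℝ (fderiv ℝ X) y ζ v) - fderiv ℝ (fderiv ℝ J) y ζ (X y) v
      - fderiv ℝ J y (fderiv ℝ X y ζ) v := by
  have hJ0 : HasFDerivAt J _ y := (hJ.differentiableAt (by simp)).hasFDerivAt
  have hX0 : HasFDerivAt X _ y := (hX.differentiableAt (by simp)).hasFDerivAt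
  have hJ1 : HasFDerivAt (fderiv ℝ J) _ y :=
    ((hJ.fderiv_right (m := ∞) (by simp)).differentiableAt (by simp)).hasFDerivAt
  have hX1 : HasFDerivAt (fderiv ℝ X) _ y :=
    ((hX.fderiv_right (m := ∞) (by simp)).differentiableAt (by simp)).hasFDerivAt
  have h := ((hX1.clm_comp hJ0).sub (hJ0.clm_comp hX1)).sub (hJ1.clm_apply hX0)
  have h' : HasFDerivAt (infDefect J X) _ y := h
  rw [h'.fderiv]
  simp
  abel

theorem fderiv_nij {J : E → E →L[ℝ] E} {y : E} (hJ : ContDiffAt ℝ ∞ J y) (ζ ξ η : E) :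
    fderiv ℝ (nij J) y ζ ξ η = fderiv ℝ (fderiv ℝ J) y ζ (J y ξ) η
      + fderiv ℝ J y (fderiv ℝ J y ζ ξ) η - fderiv ℝ J y ζ (fderiv ℝ J y ξ η)
      - J y (fderiv ℝ (fderiv ℝ J) y ζ ξ η)
      - (fderiv ℝ (fderiv ℝ J) y ζ (J y η) ξ
      + fderiv ℝ J y (fderiv ℝ J y ζ η) ξ - fderiv ℝ J y ζ (fderiv ℝ J y η ξ)
      - J y (fderiv ℝ (fderiv ℝ J) y ζ η ξ)) := by
  have hN := (contDiffAt_nij hJ).differentiableAt (by simp)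
  rw [fderiv_clm_apply_const hN, fderiv_clm_apply_const (hN.clm_apply (by fun_prop))]
  have hJ0 : HasFDerivAt J _ y := (hJ.differentiableAt (by simp)).hasFDerivAt
  have hJ1 : HasFDerivAt (fderiv ℝ J) _ y :=
    ((hJ.fderiv_right (m := ∞) (by simp)).differentiableAt (by simp)).hasFDerivAt
  have key : ∀ ξ η, HasFDerivAt (fun y => fderiv ℝ J y (J y ξ) η - J y (fderiv ℝ J y ξ η)) _ y :=
    fun ξ η => (((hJ1.clm_apply (hJ0.clm_apply (hasFDerivAt_const ξ y))).clm_apply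
      (hasFDerivAt_const η y)).sub
      (hJ0.clm_apply ((hJ1.clm_apply (hasFDerivAt_const ξ y)).clm_apply (hasFDerivAt_const η y))))
  have h : HasFDerivAt (fun y => nij J y ξ η) _ y := (key ξ η).sub (key η ξ)
  rw [h.fderiv]
  simp
  abel

theorem fderiv_fderiv_swap {F G : Type} [NormedAddCommGroup F] [NormedSpace ℝ F]
    [NormedAddCommGroup G] [NormedSpace ℝ G] {f : F → G} {y : F} (hf : ContDiffAt ℝ ∞ f y)
    (v w : F) : fderiv ℝ (fderiv ℝ f) y v w = fderiv ℝ (fderiv ℝ f) y w v :=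
  (hf.isSymmSndFDerivAt (by
    rw [minSmoothness_of_isRCLikeNormedField]
    exact WithTop.coe_le_coe.2 (le_top (a := (2 : ℕ∞))))).eq v w

/-- The Nijenhuis tensor is a first order expression in `J`, so its Lie derivative is linear in L_X
J and the first derivative of L_X J. The second derivatives of `X` cancel by symmetry. An identity
is needed, not just an implication: for formal symmetries L_X J is only flat at a point. -/
theorem nijDefect_eq {J : E → E →L[ℝ] E} {X : E → E} {y : E} (hJ : ContDiffAt ℝ ∞ J y)
    (hX : ContDiffAt ℝ ∞ X y) (ξ η : E) :
    nijDefect J X y ξ η =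
      fderiv ℝ (infDefect J X) y (J y ξ) η - J y (fderiv ℝ (infDefect J X) y ξ η)
      - (fderiv ℝ (infDefect J X) y (J y η) ξ - J y (fderiv ℝ (infDefect J X) y η ξ))
      - infDefect J X y (fderiv ℝ J y ξ η) + infDefect J X y (fderiv ℝ J y η ξ)
      + fderiv ℝ J y (infDefect J X y ξ) η - fderiv ℝ J y (infDefect J X y η) ξ := by
  simp only [fderiv_infDefect hJ hX, nijDefect, fderiv_nij hJ, nij_apply]
  rw [fderiv_fderiv_swap hX (J y ξ) (J y η), fderiv_fderiv_swap hX (J y ξ) η,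
    fderiv_fderiv_swap hX (J y η) ξ, fderiv_fderiv_swap hX η ξ,
    fderiv_fderiv_swap hJ (J y ξ) (X y), fderiv_fderiv_swap hJ (J y η) (X y),
    fderiv_fderiv_swap hJ ξ (X y), fderiv_fderiv_swap hJ η (X y)]
  simp only [infDefect, map_sub, map_add, sub_apply,
    ContinuousLinearMap.comp_apply]
  abel

/-- Maps commuting with `J` preserve the Nijenhuis tensor. -/
theorem fderiv_nij_of_comm {J : E → E →L[ℝ] E} {f : E → E} {y : E} (hJ : ContDiffAt ℝ ∞ J y)
    (hJ' : ContDiffAt ℝ ∞ J (f y)) (hf : ContDiffAt ℝ ∞ f y)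
    (h : ∀ᶠ y' in 𝓝 y, fderiv ℝ f y' ∘L J y' = J (f y') ∘L fderiv ℝ f y') (ξ η : E) :
    fderiv ℝ f y (nij J y ξ η) = nij J (f y) (fderiv ℝ f y ξ) (fderiv ℝ f y η) := by
  have hJ0 : HasFDerivAt J _ y := (hJ.differentiableAt (by simp)).hasFDerivAt
  have hJ1 : HasFDerivAt J _ (f y) := (hJ'.differentiableAt (by simp)).hasFDerivAt
  have hf0 : HasFDerivAt f _ y := (hf.differentiableAt (by simp)).hasFDerivAt
  have hf1 : HasFDerivAt (fderiv ℝ f) _ y :=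
    ((hf.fderiv_right (m := ∞) (by simp)).differentiableAt (by simp)).hasFDerivAt
  have h1 := (hf1.clm_comp hJ0).unique
    (((hJ1.comp y hf0).clm_comp hf1).congr_of_eventuallyEq h)
  -- The commutation relation, differentiated in the direction `ζ`. The second derivatives of `f`
  -- that it introduces cancel in the Nijenhuis tensor, since they are symmetric.
  have key : ∀ ζ v, fderiv ℝ (fderiv ℝ f) y ζ (J y v) + fderiv ℝ f y (fderiv ℝ J y ζ v)
      = J (f y) (fderiv ℝ (fderiv ℝ f) y ζ v)
        + fderiv ℝ J (f y) (fderiv ℝ f y ζ) (fderiv ℝ f y v) := by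
    intro ζ v
    have := congrArg (fun A : E →L[ℝ] E →L[ℝ] E => A ζ v) h1
    simp at this
    rw [add_comm, this]
  have h0 : ∀ v, J (f y) (fderiv ℝ f y v) = fderiv ℝ f y (J y v) := fun v =>
    (congrArg (fun A : E →L[ℝ] E => A v) h.self_of_nhds).symm
  have k : ∀ ζ v, fderiv ℝ J (f y) (fderiv ℝ f y ζ) (fderiv ℝ f y v)
      = fderiv ℝ (fderiv ℝ f) y ζ (J y v) + fderiv ℝ f y (fderiv ℝ J y ζ v)
      - J (f y) (fderiv ℝ (fderiv ℝ f) y ζ v) := fun ζ v => by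
    rw [key]; abel
  simp only [nij_apply, h0, k, map_sub, map_add]
  rw [fderiv_fderiv_swap hf (J y ξ) (J y η), fderiv_fderiv_swap hf (J y ξ) η,
    fderiv_fderiv_swap hf (J y η) ξ, fderiv_fderiv_swap hf η ξ]
  abel

end Local

/-! ### Overdetermined first order equations of finite type -/

/-- If P is a left inverse of `L a`, then P ∘ `L x` is invertible for `x` near `a`, and (P ∘ `L
x`)⁻¹ ∘ P is a left inverse of `L x` depending smoothly on `x`. -/
theorem exists_contDiffOn_leftInverse {X V V' : Type} [NormedAddCommGroup X] [NormedSpace ℝ X]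
    [NormedAddCommGroup V] [NormedSpace ℝ V] [FiniteDimensional ℝ V]
    [NormedAddCommGroup V'] [NormedSpace ℝ V'] [FiniteDimensional ℝ V']
    {L : X → V →L[ℝ] V'} {O : Set X} {a : X} (hO : IsOpen O) (ha : a ∈ O)
    (hL : ContDiffOn ℝ ∞ L O) (hinj : Function.Injective (L a)) :
    ∃ (O' : Set X) (G : X → V' →L[ℝ] V), IsOpen O' ∧ a ∈ O' ∧ O' ⊆ O ∧ ContDiffOn ℝ ∞ G O' ∧
      ∀ x ∈ O', ∀ v, G x (L x v) = v := by
  have : CompleteSpace V := FiniteDimensional.complete ℝ V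
  obtain ⟨P₀, hP₀⟩ := (L a : V →ₗ[ℝ] V').exists_leftInverse_of_injective
    (LinearMap.ker_eq_bot.2 hinj)
  let P : V' →L[ℝ] V := P₀.toContinuousLinearMap
  have hP : P ∘L L a = 1 := by
    ext v
    exact LinearMap.congr_fun hP₀ v
  have hA : ContDiffOn ℝ ∞ (fun x => P ∘L L x) O := contDiffOn_const.clm_comp hL
  have hunit : IsOpen {A : V →L[ℝ] V | IsUnit A} := Units.isOpen
  refine ⟨O ∩ (fun x => P ∘L L x) ⁻¹' {A | IsUnit A}, fun x => Ring.inverse (P ∘L L x) ∘L P,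
    hA.continuousOn.isOpen_inter_preimage hO hunit, ⟨ha, ?_⟩, inter_subset_left, ?_, ?_⟩
  · rw [mem_preimage, hP]
    exact isUnit_one
  · refine ContDiffOn.clm_comp (fun x hx => ?_) contDiffOn_const
    obtain ⟨u, hu⟩ := hx.2
    have h1 : ContDiffAt ℝ ∞ Ring.inverse (P ∘L L x) := by
      change (u : V →L[ℝ] V) = P ∘L L x at hu
      rw [← hu]
      exact contDiffAt_ringInverse ℝ u
    exact h1.comp_contDiffWithinAt x ((hA x hx.1).mono inter_subset_left)
  · intro x hx v
    have := Ring.inverse_mul_cancel _ hx.2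
    exact congrArg (fun A : V →L[ℝ] V => A v) this

section FiniteType

variable {E W : Type} [NormedAddCommGroup E] [NormedSpace ℝ E] [FiniteDimensional ℝ E]
  [NormedAddCommGroup W] [NormedSpace ℝ W] [FiniteDimensional ℝ W]

/-- If the prolonged symbol of a first order equation is injective at a jet, the symbol has a smooth
left inverse on symmetric tensors near that jet. -/
theorem exists_contDiffOn_symbol_leftInverse {Θ : E × E × (E →L[ℝ] E) → W}
    {O : Set (E × E × (E →L[ℝ] E))} {j₀ : E × E × (E →L[ℝ] E)} (hO : IsOpen O) (hj₀ : j₀ ∈ O)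
    (hΘ : ContDiffOn ℝ ∞ Θ O)
    (hinj : ∀ S : E →L[ℝ] E →L[ℝ] E, (∀ ξ η, S ξ η = S η ξ) →
      (∀ ζ, fderiv ℝ Θ j₀ (0, 0, S ζ) = 0) → S = 0) :
    ∃ (O' : Set (E × E × (E →L[ℝ] E)))
      (G : E × E × (E →L[ℝ] E) → (E →L[ℝ] W) →L[ℝ] (E →L[ℝ] E →L[ℝ] E)),
      IsOpen O' ∧ j₀ ∈ O' ∧ O' ⊆ O ∧ ContDiffOn ℝ ∞ G O' ∧
      ∀ j ∈ O', ∀ S : E →L[ℝ] E →L[ℝ] E, ∀ A : E →L[ℝ] W, (∀ ξ η, S ξ η = S η ξ) →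
        (∀ ζ, fderiv ℝ Θ j (0, 0, S ζ) = A ζ) → G j A = S := by
  let ι : (E →L[ℝ] E) →L[ℝ] E × E × (E →L[ℝ] E) :=
    ContinuousLinearMap.inr ℝ E (E × (E →L[ℝ] E)) ∘L ContinuousLinearMap.inr ℝ E (E →L[ℝ] E)
  let fl : (E →L[ℝ] E →L[ℝ] E) →L[ℝ] (E →L[ℝ] E →L[ℝ] E) :=
    ((ContinuousLinearMap.flipₗᵢ ℝ E E E).toContinuousLinearEquiv :
      (E →L[ℝ] E →L[ℝ] E) →L[ℝ] (E →L[ℝ] E →L[ℝ] E))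
  -- The skew part `S - S.flip` is added as a second component. Injectivity of the symbol on
  -- symmetric tensors then becomes injectivity of `L` on all bilinear maps.
  let L : E × E × (E →L[ℝ] E) → (E →L[ℝ] E →L[ℝ] E) →L[ℝ]
      (E →L[ℝ] W) × (E →L[ℝ] E →L[ℝ] E) := fun j =>
    ContinuousLinearMap.inl ℝ _ _ ∘L
      (ContinuousLinearMap.compL ℝ E (E →L[ℝ] E) W (fderiv ℝ Θ j ∘L ι))
    + ContinuousLinearMap.inr ℝ _ _ ∘L (ContinuousLinearMap.id ℝ _ - fl)
  have hL : ContDiffOn ℝ ∞ L O := by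
    refine ContDiffOn.add (contDiffOn_const.clm_comp ?_) contDiffOn_const
    exact (ContinuousLinearMap.compL ℝ E (E →L[ℝ] E) W).contDiff.comp_contDiffOn
      ((hΘ.fderiv_of_isOpen hO (by simp)).clm_comp contDiffOn_const)
  have hLapp : ∀ j S, L j S = ((fderiv ℝ Θ j ∘L ι) ∘L S, S - S.flip) := fun j S => by
    simp [L, fl]
  have hinj' : Function.Injective (L j₀) := by
    rw [injective_iff_map_eq_zero]
    intro S hS
    rw [hLapp, Prod.mk_eq_zero] at hS
    refine hinj S (fun ξ η => ?_) (fun ζ => ?_)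
    · exact congrArg (fun A : E →L[ℝ] E →L[ℝ] E => A ξ η) (sub_eq_zero.1 hS.2)
    · exact congrArg (fun A : E →L[ℝ] W => A ζ) hS.1
  obtain ⟨O', G, h1, h2, h3, h4, h5⟩ := exists_contDiffOn_leftInverse hO hj₀ hL hinj'
  refine ⟨O', fun j => G j ∘L ContinuousLinearMap.inl ℝ _ _, h1, h2, h3,
    h4.clm_comp contDiffOn_const, fun j hj S A hS hA => ?_⟩
  have h6 := h5 j hj S
  rw [hLapp] at h6
  have h7 : (fderiv ℝ Θ j ∘L ι) ∘L S = A := by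
    ext ζ
    exact hA ζ
  have h8 : S - S.flip = 0 := by
    ext ξ η
    simp [hS ξ η]
  rw [h7, h8] at h6
  exact h6

/-- An equation of finite type determines the second derivatives of its solutions. -/
theorem exists_contDiffOn_second_deriv {Θ : E × E × (E →L[ℝ] E) → W}
    {O : Set (E × E × (E →L[ℝ] E))} {j₀ : E × E × (E →L[ℝ] E)} (hO : IsOpen O) (hj₀ : j₀ ∈ O)
    (hΘ : ContDiffOn ℝ ∞ Θ O)
    (hinj : ∀ S : E →L[ℝ] E →L[ℝ] E, (∀ ξ η, S ξ η = S η ξ) →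
      (∀ ζ, fderiv ℝ Θ j₀ (0, 0, S ζ) = 0) → S = 0) :
    ∃ (O' : Set (E × E × (E →L[ℝ] E))) (F : E × E × (E →L[ℝ] E) → E →L[ℝ] E →L[ℝ] E),
      IsOpen O' ∧ j₀ ∈ O' ∧ O' ⊆ O ∧ ContDiffOn ℝ ∞ F O' ∧
      ∀ (f : E → E) (y : E), ContDiffAt ℝ ∞ f y → (y, f y, fderiv ℝ f y) ∈ O' →
        (∀ᶠ y' in 𝓝 y, Θ (y', f y', fderiv ℝ f y') = 0) →
        fderiv ℝ (fderiv ℝ f) y = F (y, f y, fderiv ℝ f y) := by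
  obtain ⟨O', G, h1, h2, h3, h4, h5⟩ := exists_contDiffOn_symbol_leftInverse hO hj₀ hΘ hinj
  -- Differentiating Θ(y, f, Df) = 0 along ζ shows that the symbol applied to D²f(ζ) is −Θ′(ζ, Df ζ,
  -- 0); applying the left inverse of the symbol solves for D²f.
  refine ⟨O', fun j => -G j (fderiv ℝ Θ j ∘L
    ((ContinuousLinearMap.id ℝ E).prod (j.2.2.prod 0))), h1, h2, h3, ?_, ?_⟩
  · refine (h4.clm_apply (((hΘ.fderiv_of_isOpen hO (by simp)).mono h3).clm_comp ?_)).neg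
    have : ContDiff ℝ ∞ fun j : E × E × (E →L[ℝ] E) =>
        ContinuousLinearMap.inl ℝ E (E × (E →L[ℝ] E)) + (ContinuousLinearMap.inr ℝ E _ ∘L
          (ContinuousLinearMap.inl ℝ E (E →L[ℝ] E) ∘L j.2.2)) :=
      contDiff_const.add (contDiff_const.clm_comp
        (contDiff_const.clm_comp (contDiff_snd.comp contDiff_snd)))
    refine this.contDiffOn.congr fun j _ => ?_
    ext v <;> simp
  · intro f y hf hy hz
    have hf1 : HasFDerivAt (fderiv ℝ f) _ y :=
      ((hf.fderiv_right (m := ∞) (by simp)).differentiableAt (by simp)).hasFDerivAt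
    have hf0 : HasFDerivAt f _ y := (hf.differentiableAt (by simp)).hasFDerivAt
    have hΘ0 : HasFDerivAt Θ _ (y, f y, fderiv ℝ f y) :=
      ((hΘ.contDiffAt (hO.mem_nhds (h3 hy))).differentiableAt (by simp)).hasFDerivAt
    have hc := (hΘ0.comp y ((hasFDerivAt_id y).prodMk (hf0.prodMk hf1))).unique
      ((hasFDerivAt_const (0 : W) y).congr_of_eventuallyEq hz)
    refine Eq.trans ?_ (map_neg (G _) _)
    refine (h5 _ hy _ _ (fderiv_fderiv_swap hf) (fun ζ => ?_)).symm
    have h6 := congrArg (fun A : E →L[ℝ] W => A ζ) hc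
    have h7 : ((ζ, fderiv ℝ f y ζ, fderiv ℝ (fderiv ℝ f) y ζ) : E × E × (E →L[ℝ] E))
        = (0, 0, fderiv ℝ (fderiv ℝ f) y ζ) + (ζ, fderiv ℝ f y ζ, 0) := by simp
    simp only [ContinuousLinearMap.comp_apply, ContinuousLinearMap.prod_apply,
      ContinuousLinearMap.id_apply, zero_apply] at h6
    rw [h7, map_add] at h6
    exact eq_neg_of_add_eq_zero_left h6

/-- Solutions of the linearization of an equation of finite type along the identity satisfy a linear
estimate for their second derivatives. -/
theorem exists_norm_second_deriv_le {Θ : E × E × (E →L[ℝ] E) → W}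
    {O : Set (E × E × (E →L[ℝ] E))} {x₀ : E} (hO : IsOpen O)
    (hj₀ : (x₀, x₀, ContinuousLinearMap.id ℝ E) ∈ O) (hΘ : ContDiffOn ℝ ∞ Θ O)
    (hinj : ∀ S : E →L[ℝ] E →L[ℝ] E, (∀ ξ η, S ξ η = S η ξ) →
      (∀ ζ, fderiv ℝ Θ (x₀, x₀, ContinuousLinearMap.id ℝ E) (0, 0, S ζ) = 0) → S = 0) :
    ∃ C, ∃ δ > 0, ∀ (X : E → E) (y : E), y ∈ Metric.ball x₀ δ → ContDiffAt ℝ ∞ X y →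
      (∀ᶠ y' in 𝓝 y, fderiv ℝ Θ (y', y', ContinuousLinearMap.id ℝ E) (0, X y', fderiv ℝ X y') = 0) →
        ‖fderiv ℝ (fderiv ℝ X) y‖ ≤ C * ‖(X y, fderiv ℝ X y)‖ := by
  obtain ⟨O', G, h1, h2, h3, h4, h5⟩ := exists_contDiffOn_symbol_leftInverse hO hj₀ hΘ hinj
  let i : E → E × E × (E →L[ℝ] E) := fun y => (y, y, ContinuousLinearMap.id ℝ E)
  have hi : ContDiff ℝ ∞ i := contDiff_id.prodMk (contDiff_id.prodMk contDiff_const)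
  have hU : IsOpen (i ⁻¹' O') := h1.preimage hi.continuous
  have hG : ContDiffOn ℝ ∞ (fun y => G (i y)) (i ⁻¹' O') := h4.comp hi.contDiffOn fun y hy => hy
  let lam : E → (E × E × (E →L[ℝ] E)) →L[ℝ] W := fun y => fderiv ℝ Θ (i y)
  have hlam : ContDiffOn ℝ ∞ lam (i ⁻¹' O') :=
    ((hΘ.fderiv_of_isOpen hO (by simp)).mono h3).comp hi.contDiffOn fun y hy => hy
  have hlam' : ContinuousOn (fderiv ℝ lam) (i ⁻¹' O') :=
    hlam.continuousOn_fderiv_of_isOpen hU (by simp)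
  have hc : ContinuousAt (fun y => ‖G (i y)‖ * (‖fderiv ℝ lam y‖ + ‖lam y‖)) x₀ := by
    have hx : i ⁻¹' O' ∈ 𝓝 x₀ := hU.mem_nhds h2
    exact (hG.continuousOn.continuousAt hx).norm.mul
      ((hlam'.continuousAt hx).norm.add (hlam.continuousOn.continuousAt hx).norm)
  -- By continuity the coefficient is bounded near `x₀` by its value there plus one, which serves as
  -- the constant `C`.
  have hev : ∀ᶠ y in 𝓝 x₀, ‖G (i y)‖ * (‖fderiv ℝ lam y‖ + ‖lam y‖)
      < ‖G (i x₀)‖ * (‖fderiv ℝ lam x₀‖ + ‖lam x₀‖) + 1 :=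
    hc.eventually (gt_mem_nhds (lt_add_one _))
  obtain ⟨δ, hδ, hball⟩ := Metric.eventually_nhds_iff_ball.1 (hev.and (hU.mem_nhds h2))
  refine ⟨‖G (i x₀)‖ * (‖fderiv ℝ lam x₀‖ + ‖lam x₀‖) + 1, δ, hδ, fun X y hy hX hz => ?_⟩
  obtain ⟨hy1, hy2⟩ := hball y hy
  refine le_trans ?_ (mul_le_mul_of_nonneg_right hy1.le (norm_nonneg _))
  have hX0 : HasFDerivAt X _ y := (hX.differentiableAt (by simp)).hasFDerivAt
  have hX1 : HasFDerivAt (fderiv ℝ X) _ y :=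
    ((hX.fderiv_right (m := ∞) (by simp)).differentiableAt (by simp)).hasFDerivAt
  have hlam0 : HasFDerivAt lam _ y :=
    ((hlam.contDiffAt (hU.mem_nhds hy2)).differentiableAt (by simp)).hasFDerivAt
  have hd := (hlam0.clm_apply ((hasFDerivAt_const (0 : E) y).prodMk (hX0.prodMk hX1))).unique
    ((hasFDerivAt_const (0 : W) y).congr_of_eventuallyEq hz)
  -- The derivative of the linearized equation: its symbol part at D²X(ζ) equals `A ζ`, which
  -- depends linearly on the 1-jet of `X`.
  let A : E →L[ℝ] W := -((fderiv ℝ lam y).flip (0, X y, fderiv ℝ X y)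
    + lam y ∘L (ContinuousLinearMap.inr ℝ E _ ∘L
      (ContinuousLinearMap.inl ℝ E (E →L[ℝ] E) ∘L fderiv ℝ X y)))
  have hA : ∀ ζ, A ζ = -(fderiv ℝ lam y ζ (0, X y, fderiv ℝ X y) + lam y (0, fderiv ℝ X y ζ, 0)) :=
    fun ζ => by simp [A]
  have hS : G (i y) A = fderiv ℝ (fderiv ℝ X) y := by
    refine h5 _ hy2 _ _ (fderiv_fderiv_swap hX) (fun ζ => ?_)
    have h6 := congrArg (fun A : E →L[ℝ] W => A ζ) hd
    have h7 : ((0, fderiv ℝ X y ζ, fderiv ℝ (fderiv ℝ X) y ζ) : E × E × (E →L[ℝ] E))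
        = (0, 0, fderiv ℝ (fderiv ℝ X) y ζ) + (0, fderiv ℝ X y ζ, 0) := by simp
    simp only [add_apply, ContinuousLinearMap.comp_apply,
      ContinuousLinearMap.prod_apply, ContinuousLinearMap.flip_apply,
      zero_apply] at h6
    rw [h7, map_add] at h6
    rw [hA, eq_neg_iff_add_eq_zero, ← h6]
    change fderiv ℝ Θ (i y) _ + (_ + fderiv ℝ Θ (i y) _) = fderiv ℝ Θ (i y) _ + fderiv ℝ Θ (i y) _ + _
    abel
  rw [← hS]
  refine (ContinuousLinearMap.le_opNorm _ _).trans ?_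
  rw [mul_assoc]
  refine mul_le_mul_of_nonneg_left ?_ (norm_nonneg _)
  refine ContinuousLinearMap.opNorm_le_bound _ (by positivity) (fun ζ => ?_)
  rw [hA, norm_neg]
  have e1 : ‖((0, X y, fderiv ℝ X y) : E × E × (E →L[ℝ] E))‖ = ‖(X y, fderiv ℝ X y)‖ := by
    simp [Prod.norm_mk]
  have e2 : ‖((0, fderiv ℝ X y ζ, 0) : E × E × (E →L[ℝ] E))‖ ≤ ‖(X y, fderiv ℝ X y)‖ * ‖ζ‖ := by
    have : ‖((0, fderiv ℝ X y ζ, 0) : E × E × (E →L[ℝ] E))‖ = ‖fderiv ℝ X y ζ‖ := by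
      simp [Prod.norm_mk]
    rw [this]
    exact (ContinuousLinearMap.le_opNorm _ _).trans
      (mul_le_mul_of_nonneg_right (norm_snd_le (X y, fderiv ℝ X y)) (norm_nonneg _))
  calc _ ≤ ‖fderiv ℝ lam y ζ (0, X y, fderiv ℝ X y)‖ + ‖lam y (0, fderiv ℝ X y ζ, 0)‖ :=
        norm_add_le _ _
    _ ≤ ‖fderiv ℝ lam y‖ * ‖ζ‖ * ‖(X y, fderiv ℝ X y)‖
        + ‖lam y‖ * (‖(X y, fderiv ℝ X y)‖ * ‖ζ‖) := by
        refine add_le_add ?_ ?_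
        · rw [← e1]
          exact ContinuousLinearMap.le_opNorm₂ _ _ _
        · exact (ContinuousLinearMap.le_opNorm _ _).trans
            (mul_le_mul_of_nonneg_left e2 (norm_nonneg _))
    _ = _ := by ring

omit [FiniteDimensional ℝ E] in
/-- A field whose second derivatives are bounded by its first jet vanishes on a ball if its first jet
vanishes at the centre. -/
theorem eq_zero_of_norm_second_deriv_le {X : E → E} {x₀ : E} {r C : ℝ}
    (hX : ContDiffOn ℝ ∞ X (Metric.ball x₀ r))
    (hb : ∀ y ∈ Metric.ball x₀ r, ‖fderiv ℝ (fderiv ℝ X) y‖ ≤ C * ‖(X y, fderiv ℝ X y)‖)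
    (h0 : X x₀ = 0) (h1 : fderiv ℝ X x₀ = 0) : ∀ y ∈ Metric.ball x₀ r, X y = 0 := by
  intro y hy
  have hray : ∀ s ∈ Icc (0 : ℝ) 1, x₀ + s • (y - x₀) ∈ Metric.ball x₀ r := fun s hs => by
    have := (convex_ball x₀ r).add_smul_sub_mem (Metric.mem_ball_self (Metric.pos_of_mem_ball hy))
      hy hs
    exact this
  -- Gronwall's inequality for the 1-jet of `X` along the segment from `x₀` to `y`. In its
  -- derivative the first component is bounded by DX and the second by `C` times the jet, which
  -- explains the constant `max 1 C`.
  let g : ℝ → E × (E →L[ℝ] E) := fun s =>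
    (X (x₀ + s • (y - x₀)), fderiv ℝ X (x₀ + s • (y - x₀)))
  have hXat : ∀ s ∈ Icc (0 : ℝ) 1, ContDiffAt ℝ ∞ X (x₀ + s • (y - x₀)) := fun s hs =>
    hX.contDiffAt (Metric.isOpen_ball.mem_nhds (hray s hs))
  have hγ : ∀ s : ℝ, HasDerivAt (fun s : ℝ => x₀ + s • (y - x₀)) (y - x₀) s := fun s => by
    simpa using ((hasDerivAt_id s).smul_const (y - x₀)).const_add x₀
  have hg : ∀ s ∈ Icc (0 : ℝ) 1, HasDerivAt g (fderiv ℝ X (x₀ + s • (y - x₀)) (y - x₀),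
      fderiv ℝ (fderiv ℝ X) (x₀ + s • (y - x₀)) (y - x₀)) s := fun s hs =>
    ((((hXat s hs).differentiableAt (by simp)).hasFDerivAt.comp_hasDerivAt s (hγ s)).prodMk
      ((((hXat s hs).fderiv_right (m := ∞) (by simp)).differentiableAt
        (by simp)).hasFDerivAt.comp_hasDerivAt s (hγ s)))
  have hz := eq_zero_of_abs_deriv_le_mul_abs_self_of_eq_zero_right (f := g)
    (K := (max 1 C) * ‖y - x₀‖) (a := 0) (b := 1)
    (fun s hs => (hg s hs).continuousAt.continuousWithinAt)
    (fun s hs => (hg s ⟨hs.1, hs.2.le⟩).hasDerivWithinAt) (by simp [g, h0, h1]) (fun s hs => ?_)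
  · have := hz 1 (right_mem_Icc.2 zero_le_one)
    simpa [g] using congrArg Prod.fst this
  · have hs' : s ∈ Icc (0 : ℝ) 1 := ⟨hs.1, hs.2.le⟩
    have hn : ‖fderiv ℝ X (x₀ + s • (y - x₀))‖ ≤ ‖g s‖ := norm_snd_le (g s)
    refine max_le ?_ ?_
    · refine (ContinuousLinearMap.le_opNorm _ _).trans ?_
      calc ‖fderiv ℝ X (x₀ + s • (y - x₀))‖ * ‖y - x₀‖ ≤ 1 * ‖g s‖ * ‖y - x₀‖ := by
            rw [one_mul]; gcongr
        _ ≤ max 1 C * ‖g s‖ * ‖y - x₀‖ := by gcongr; exact le_max_left _ _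
        _ = _ := by ring
    · refine (ContinuousLinearMap.le_opNorm _ _).trans ?_
      calc ‖fderiv ℝ (fderiv ℝ X) (x₀ + s • (y - x₀))‖ * ‖y - x₀‖ ≤ C * ‖g s‖ * ‖y - x₀‖ := by
            gcongr; exact hb _ (hray s hs')
        _ ≤ max 1 C * ‖g s‖ * ‖y - x₀‖ := by gcongr; exact le_max_right _ _
        _ = _ := by ring

end FiniteType

/-! ### The symmetry equation of an almost complex structure -/

section SymEq

variable {E : Type} [NormedAddCommGroup E] [NormedSpace ℝ E]

/-- The symmetry equation on `1`-jets `(y, z, p)` of maps: `p` intertwines the values at `y` and `z`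
of `J` and of its Nijenhuis tensor. -/
def symEq (J : E → E →L[ℝ] E) (j : E × E × (E →L[ℝ] E)) : (E →L[ℝ] E) × (E →L[ℝ] E →L[ℝ] E) :=
  (j.2.2 ∘L J j.1 - J j.2.1 ∘L j.2.2,
    ContinuousLinearMap.compL ℝ E E E j.2.2 ∘L nij J j.1
      - ((nij J j.2.1 ∘L j.2.2).flip ∘L j.2.2).flip)

theorem symEq_snd_apply (J : E → E →L[ℝ] E) (j : E × E × (E →L[ℝ] E)) (ξ η : E) :
    (symEq J j).2 ξ η = j.2.2 (nij J j.1 ξ η) - nij J j.2.1 (j.2.2 ξ) (j.2.2 η) := rfl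

variable {J : E → E →L[ℝ] E} {Ω : Set E}

theorem contDiffOn_symEq (hΩ : IsOpen Ω) (hJ : ContDiffOn ℝ ∞ J Ω) :
    ContDiffOn ℝ ∞ (symEq J) (Ω ×ˢ Ω ×ˢ univ) := by
  have hN : ContDiffOn ℝ ∞ (nij J) Ω := fun y hy =>
    (contDiffAt_nij (hJ.contDiffAt (hΩ.mem_nhds hy))).contDiffWithinAt
  have m1 : MapsTo (fun j : E × E × (E →L[ℝ] E) => j.1) (Ω ×ˢ Ω ×ˢ univ) Ω := fun j hj => hj.1
  have m2 : MapsTo (fun j : E × E × (E →L[ℝ] E) => j.2.1) (Ω ×ˢ Ω ×ˢ univ) Ω := fun j hj => hj.2.1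
  have c1 : ContDiff ℝ ∞ (fun j : E × E × (E →L[ℝ] E) => j.1) := contDiff_fst
  have c2 : ContDiff ℝ ∞ (fun j : E × E × (E →L[ℝ] E) => j.2.1) := contDiff_fst.comp contDiff_snd
  have c3 : ContDiffOn ℝ ∞ (fun j : E × E × (E →L[ℝ] E) => j.2.2) (Ω ×ˢ Ω ×ˢ univ) :=
    (contDiff_snd.comp contDiff_snd).contDiffOn
  have fl : ContDiff ℝ ∞ (fun A : E →L[ℝ] E →L[ℝ] E => A.flip) :=
    (ContinuousLinearMap.flipₗᵢ ℝ E E E).toContinuousLinearEquiv.contDiff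
  refine ContDiffOn.prodMk ?_ ?_
  · exact (c3.clm_comp (hJ.comp c1.contDiffOn m1)).sub ((hJ.comp c2.contDiffOn m2).clm_comp c3)
  · refine ContDiffOn.sub ?_ ?_
    · exact ((ContinuousLinearMap.compL ℝ E E E).contDiff.comp_contDiffOn c3).clm_comp
        (hN.comp c1.contDiffOn m1)
    · exact fl.comp_contDiffOn ((fl.comp_contDiffOn
        ((hN.comp c2.contDiffOn m2).clm_comp c3)).clm_comp c3)

/-- Preservation of the Nijenhuis tensor follows from commutation with `J`, so the second component
of `symEq` loses no symmetries. It shrinks the symbol enough to make its prolongation vanish when N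
is onto. -/
theorem symEq_eq_zero {f : E → E} {V : Set E} (hΩ : IsOpen Ω) (hJ : ContDiffOn ℝ ∞ J Ω)
    (hV : IsOpen V) (hVΩ : V ⊆ Ω) (hf : ContDiffOn ℝ ∞ f V) (hfΩ : MapsTo f V Ω)
    (h : ∀ y ∈ V, fderiv ℝ f y ∘L J y = J (f y) ∘L fderiv ℝ f y) :
    ∀ y ∈ V, symEq J (y, f y, fderiv ℝ f y) = 0 := by
  intro y hy
  refine Prod.ext (sub_eq_zero.2 (h y hy)) ?_
  ext ξ η
  rw [symEq_snd_apply]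
  exact sub_eq_zero.2 (fderiv_nij_of_comm (hJ.contDiffAt (hΩ.mem_nhds (hVΩ hy)))
    (hJ.contDiffAt (hΩ.mem_nhds (hfΩ hy))) (hf.contDiffAt (hV.mem_nhds hy))
    (eventually_of_mem (hV.mem_nhds hy) h) ξ η)

theorem fderiv_symEq_fst (hΩ : IsOpen Ω) (hJ : ContDiffOn ℝ ∞ J Ω) {y : E} (hy : y ∈ Ω)
    (v : E) (A : E →L[ℝ] E) :
    (fderiv ℝ (symEq J) (y, y, ContinuousLinearMap.id ℝ E) (0, v, A)).1
      = A ∘L J y - J y ∘L A - fderiv ℝ J y v := by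
  have hd : DifferentiableAt ℝ (symEq J) (y, y, ContinuousLinearMap.id ℝ E) :=
    ((contDiffOn_symEq hΩ hJ).contDiffAt ((hΩ.prod (hΩ.prod isOpen_univ)).mem_nhds
      ⟨hy, hy, mem_univ _⟩)).differentiableAt (by simp)
  have hJy : HasFDerivAt J _ y :=
    ((hJ.contDiffAt (hΩ.mem_nhds hy)).differentiableAt (by simp)).hasFDerivAt
  have c3 : HasFDerivAt (fun j : E × E × (E →L[ℝ] E) => j.2.2) _
    (y, y, ContinuousLinearMap.id ℝ E) := (ContinuousLinearMap.snd ℝ E (E →L[ℝ] E) ∘L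
      ContinuousLinearMap.snd ℝ E (E × (E →L[ℝ] E))).hasFDerivAt
  have c1 : HasFDerivAt (fun j : E × E × (E →L[ℝ] E) => J j.1) _
    (y, y, ContinuousLinearMap.id ℝ E) :=
    HasFDerivAt.comp (g := J) (y, y, ContinuousLinearMap.id ℝ E) hJy hasFDerivAt_fst
  have c2 : HasFDerivAt (fun j : E × E × (E →L[ℝ] E) => J j.2.1) _
    (y, y, ContinuousLinearMap.id ℝ E) :=
    HasFDerivAt.comp (g := J) (y, y, ContinuousLinearMap.id ℝ E) hJy (ContinuousLinearMap.fst ℝ E (E →L[ℝ] E) ∘L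
      ContinuousLinearMap.snd ℝ E (E × (E →L[ℝ] E))).hasFDerivAt
  have h := hd.hasFDerivAt.fst.unique ((c3.clm_comp c1).sub (c2.clm_comp c3))
  have h' := congrArg (fun B : (E × E × (E →L[ℝ] E)) →L[ℝ] (E →L[ℝ] E) => B (0, v, A)) h
  simp at h'
  rw [h']
  ext w
  simp
  abel

theorem fderiv_symEq_snd (hΩ : IsOpen Ω) (hJ : ContDiffOn ℝ ∞ J Ω) {y : E} (hy : y ∈ Ω)
    (v : E) (A : E →L[ℝ] E) (ξ η : E) :
    (fderiv ℝ (symEq J) (y, y, ContinuousLinearMap.id ℝ E) (0, v, A)).2 ξ η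
      = A (nij J y ξ η) - nij J y (A ξ) η - nij J y ξ (A η) - fderiv ℝ (nij J) y v ξ η := by
  have hd : DifferentiableAt ℝ (symEq J) (y, y, ContinuousLinearMap.id ℝ E) :=
    ((contDiffOn_symEq hΩ hJ).contDiffAt ((hΩ.prod (hΩ.prod isOpen_univ)).mem_nhds
      ⟨hy, hy, mem_univ _⟩)).differentiableAt (by simp)
  have hNy : HasFDerivAt (nij J) _ y :=
    ((contDiffAt_nij (hJ.contDiffAt (hΩ.mem_nhds hy))).differentiableAt (by simp)).hasFDerivAt
  have c3 : HasFDerivAt (fun j : E × E × (E →L[ℝ] E) => j.2.2) _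
    (y, y, ContinuousLinearMap.id ℝ E) := (ContinuousLinearMap.snd ℝ E (E →L[ℝ] E) ∘L
      ContinuousLinearMap.snd ℝ E (E × (E →L[ℝ] E))).hasFDerivAt
  have c1 : HasFDerivAt (fun j : E × E × (E →L[ℝ] E) => nij J j.1) _
    (y, y, ContinuousLinearMap.id ℝ E) :=
    HasFDerivAt.comp (g := nij J) (y, y, ContinuousLinearMap.id ℝ E) hNy hasFDerivAt_fst
  have c2 : HasFDerivAt (fun j : E × E × (E →L[ℝ] E) => nij J j.2.1) _
    (y, y, ContinuousLinearMap.id ℝ E) :=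
    HasFDerivAt.comp (g := nij J) (y, y, ContinuousLinearMap.id ℝ E) hNy (ContinuousLinearMap.fst ℝ E (E →L[ℝ] E) ∘L
      ContinuousLinearMap.snd ℝ E (E × (E →L[ℝ] E))).hasFDerivAt
  have k := fun w : E => hasFDerivAt_const (𝕜 := ℝ) w (y, y, ContinuousLinearMap.id ℝ E)
  have h1 : HasFDerivAt (fun j : E × E × (E →L[ℝ] E) =>
      j.2.2 (nij J j.1 ξ η) - nij J j.2.1 (j.2.2 ξ) (j.2.2 η)) _
      (y, y, ContinuousLinearMap.id ℝ E) :=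
    (c3.clm_apply ((c1.clm_apply (k ξ)).clm_apply (k η))).sub
      ((c2.clm_apply (c3.clm_apply (k ξ))).clm_apply (c3.clm_apply (k η)))
  have h2 := ((hd.hasFDerivAt.snd.clm_apply (k ξ)).clm_apply (k η)).unique h1
  have h' := congrArg (fun B : (E × E × (E →L[ℝ] E)) →L[ℝ] E => B (0, v, A)) h2
  simp at h'
  rw [h']
  abel

/-- Infinitesimal symmetries satisfy the linearized symmetry equation. -/
theorem fderiv_symEq_eq_zero (hΩ : IsOpen Ω) (hJ : ContDiffOn ℝ ∞ J Ω) {X : E → E} {V : Set E}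
    (hV : IsOpen V) (hVΩ : V ⊆ Ω) (hX : ContDiffOn ℝ ∞ X V) (h : ∀ y ∈ V, infDefect J X y = 0) :
    ∀ y ∈ V, fderiv ℝ (symEq J) (y, y, ContinuousLinearMap.id ℝ E) (0, X y, fderiv ℝ X y) = 0 := by
  intro y hy
  have hd : fderiv ℝ (infDefect J X) y = 0 := by
    have : infDefect J X =ᶠ[𝓝 y] fun _ => 0 := eventually_of_mem (hV.mem_nhds hy) h
    rw [this.fderiv_eq]
    exact fderiv_const_apply 0
  refine Prod.ext ?_ ?_
  · rw [fderiv_symEq_fst hΩ hJ (hVΩ hy)]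
    exact h y hy
  · ext ξ η
    rw [fderiv_symEq_snd hΩ hJ (hVΩ hy)]
    have := nijDefect_eq (hJ.contDiffAt (hΩ.mem_nhds (hVΩ hy)))
      (hX.contDiffAt (hV.mem_nhds hy)) ξ η
    rw [hd, h y hy] at this
    simpa [nijDefect] using this

/-- An endomorphism-valued form compatible with `J` and with a Nijenhuis tensor which is onto is
zero. -/
theorem eq_zero_of_prolongation {J₀ : E →L[ℝ] E} {N : E →L[ℝ] E →L[ℝ] E}
    (hJ₀ : ∀ v, J₀ (J₀ v) = -v) (hl : ∀ ξ η, N (J₀ ξ) η = -J₀ (N ξ η))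
    (hr : ∀ ξ η, N ξ (J₀ η) = -J₀ (N ξ η))
    (hspan : Submodule.span ℝ {w | ∃ ξ η, N ξ η = w} = ⊤) {S : E →L[ℝ] E →L[ℝ] E}
    (hsymm : ∀ ξ η, S ξ η = S η ξ) (hJS : ∀ ζ v, S ζ (J₀ v) = J₀ (S ζ v))
    (hNS : ∀ ζ ξ η, S ζ (N ξ η) = N (S ζ ξ) η + N ξ (S ζ η)) : S = 0 := by
  have h1 : ∀ ζ v, S (J₀ ζ) v = J₀ (S ζ v) := fun ζ v => by rw [hsymm, hJS, hsymm]
  -- Replacing `ζ` by `J₀ ζ` multiplies the left side of `hNS` by `J₀` and the right side by `-J₀`;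
  -- two equal quantities with this property are zero.
  have h2 : ∀ ζ ξ η, S ζ (N ξ η) = 0 := by
    intro ζ ξ η
    have h3 := hNS (J₀ ζ) ξ η
    rw [h1, h1, h1, hl, hr, hNS, map_add] at h3
    have h4 : J₀ (N (S ζ ξ) η + N ξ (S ζ η)) = 0 := by
      rw [map_add]
      have : (2 : ℝ) • (J₀ (N (S ζ ξ) η) + J₀ (N ξ (S ζ η))) = 0 := by
        rw [two_smul]
        nth_rewrite 1 [h3]
        abel
      exact (smul_eq_zero.1 this).resolve_left two_ne_zero
    have h5 := hJ₀ (S ζ (N ξ η))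
    rw [hNS, h4, map_zero] at h5
    rw [hNS]
    exact neg_eq_zero.1 h5.symm
  ext ζ v
  have hv : v ∈ Submodule.span ℝ {w | ∃ ξ η, N ξ η = w} := by rw [hspan]; trivial
  induction hv using Submodule.span_induction with
  | mem w hw => obtain ⟨ξ, η, rfl⟩ := hw; exact h2 ζ ξ η
  | zero => simp
  | add a b _ _ ha hb => rw [map_add, ha, hb]; simp
  | smul c a _ ha => rw [map_smul, ha]; simp

theorem symEq_prolongation_injective (hΩ : IsOpen Ω) (hJ : ContDiffOn ℝ ∞ J Ω)
    (hsq : ∀ y ∈ Ω, ∀ v, J y (J y v) = -v) {x₀ : E} (hx₀ : x₀ ∈ Ω)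
    (hspan : Submodule.span ℝ {w | ∃ ξ η, nij J x₀ ξ η = w} = ⊤) (S : E →L[ℝ] E →L[ℝ] E)
    (hsymm : ∀ ξ η, S ξ η = S η ξ)
    (hS : ∀ ζ, fderiv ℝ (symEq J) (x₀, x₀, ContinuousLinearMap.id ℝ E) (0, 0, S ζ) = 0) :
    S = 0 := by
  have hJx := hJ.contDiffAt (hΩ.mem_nhds hx₀)
  have hsq' : ∀ᶠ y' in 𝓝 x₀, ∀ v, J y' (J y' v) = -v := eventually_of_mem (hΩ.mem_nhds hx₀) hsq
  refine eq_zero_of_prolongation (hsq x₀ hx₀) (nij_antilinear_left hJx hsq')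
    (nij_antilinear_right hJx hsq') hspan hsymm (fun ζ v => ?_) (fun ζ ξ η => ?_)
  · have h1 := congrArg Prod.fst (hS ζ)
    rw [fderiv_symEq_fst hΩ hJ hx₀] at h1
    have h2 := congrArg (fun A : E →L[ℝ] E => A v) h1
    simp at h2
    exact sub_eq_zero.1 h2
  · have h1 := congrArg (fun A : (E →L[ℝ] E) × (E →L[ℝ] E →L[ℝ] E) => A.2 ξ η) (hS ζ)
    simp only [fderiv_symEq_snd hΩ hJ hx₀] at h1
    simp at h1
    rw [sub_sub] at h1
    exact sub_eq_zero.1 h1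

/-- An infinitesimal symmetry whose first jet vanishes at a point where the Nijenhuis tensor is onto
vanishes near this point. -/
theorem exists_infinitesimal_uniqueness [FiniteDimensional ℝ E] (hΩ : IsOpen Ω)
    (hJ : ContDiffOn ℝ ∞ J Ω)
    (hsq : ∀ y ∈ Ω, ∀ v, J y (J y v) = -v) {x₀ : E} (hx₀ : x₀ ∈ Ω)
    (hspan : Submodule.span ℝ {w | ∃ ξ η, nij J x₀ ξ η = w} = ⊤) {X : E → E} {V : Set E}
    (hV : IsOpen V) (hx₀V : x₀ ∈ V) (hX : ContDiffOn ℝ ∞ X V)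
    (h : ∀ y ∈ V, infDefect J X y = 0) (h0 : X x₀ = 0) (h1 : fderiv ℝ X x₀ = 0) :
    ∀ᶠ y in 𝓝 x₀, X y = 0 := by
  obtain ⟨C, δ, hδ, hC⟩ := exists_norm_second_deriv_le (x₀ := x₀)
    (hΩ.prod (hΩ.prod isOpen_univ)) ⟨hx₀, hx₀, mem_univ _⟩ (contDiffOn_symEq hΩ hJ)
    (symEq_prolongation_injective hΩ hJ hsq hx₀ hspan)
  obtain ⟨r, hr, hrV⟩ := Metric.mem_nhds_iff.1
    (inter_mem (inter_mem (hV.mem_nhds hx₀V) (hΩ.mem_nhds hx₀)) (Metric.ball_mem_nhds x₀ hδ))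
  have hVΩ : IsOpen (V ∩ Ω) := hV.inter hΩ
  have heq := fderiv_symEq_eq_zero hΩ hJ hVΩ inter_subset_right (hX.mono inter_subset_left)
    (fun y hy => h y hy.1)
  refine eventually_of_mem (Metric.ball_mem_nhds x₀ hr) (eq_zero_of_norm_second_deriv_le (C := C)
    (hX.mono fun y hy => (hrV hy).1.1) (fun y hy => ?_) h0 h1)
  exact hC X y (hrV hy).2 (hX.contDiffAt (hV.mem_nhds (hrV hy).1.1))
    (eventually_of_mem (hVΩ.mem_nhds (hrV hy).1) heq)

end SymEq

/-! ### Iterated derivatives -/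

section Iterated

variable {E F G : Type} [NormedAddCommGroup E] [NormedSpace ℝ E] [NormedAddCommGroup F]
  [NormedSpace ℝ F] [NormedAddCommGroup G] [NormedSpace ℝ G]

theorem iteratedFDeriv_apply_const {A : E → F →L[ℝ] G} {x : E} (hA : ContDiffAt ℝ ∞ A x) (w : F)
    (m : ℕ) (v : Fin m → E) :
    iteratedFDeriv ℝ m (fun y => A y w) x v = iteratedFDeriv ℝ m A x v w := by
  have h := (ContinuousLinearMap.apply ℝ G w).iteratedFDeriv_comp_left (x := x)
    (f := A) (n := m) (i := m) (hA.of_le (mod_cast le_top)) le_rfl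
  exact congrArg (fun M : ContinuousMultilinearMap ℝ (fun _ : Fin m => E) G => M v) h

/-- The lowest order term of a product. -/
theorem iteratedFDeriv_clm_apply_of_eq_zero {B : E → F →L[ℝ] G} {f : E → F} {x : E} (m : ℕ)
    (hB : ContDiffAt ℝ ∞ B x) (hf : ContDiffAt ℝ ∞ f x)
    (h0 : ∀ j < m, iteratedFDeriv ℝ j f x = 0) (v : Fin m → E) :
    iteratedFDeriv ℝ m (fun y => B y (f y)) x v = B x (iteratedFDeriv ℝ m f x v) := by
  induction m generalizing F G with
  | zero => simp
  | succ m ih =>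
    have hB' : ContDiffAt ℝ ∞ (fderiv ℝ B) x := hB.fderiv_right (by simp)
    have hf' : ContDiffAt ℝ ∞ (fderiv ℝ f) x := hf.fderiv_right (by simp)
    -- The Leibniz rule gives two terms of the same shape, so the induction hypothesis applies to
    -- both. In the second term `f` itself is differentiated only `m` times, and this derivative
    -- vanishes.
    have hev : fderiv ℝ (fun y => B y (f y)) =ᶠ[𝓝 x] (fun y =>
        ContinuousLinearMap.compL ℝ E F G (B y) (fderiv ℝ f y) + (fderiv ℝ B y).flip (f y)) := by
      have e1 : ∀ᶠ y in 𝓝 x, DifferentiableAt ℝ B y :=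
        ((hB.of_le (m := 1) (by simp)).eventually (by simp)).mono fun y hy =>
          hy.differentiableAt one_ne_zero
      have e2 : ∀ᶠ y in 𝓝 x, DifferentiableAt ℝ f y :=
        ((hf.of_le (m := 1) (by simp)).eventually (by simp)).mono fun y hy =>
          hy.differentiableAt one_ne_zero
      filter_upwards [e1, e2] with y h1 h2
      exact (h1.hasFDerivAt.clm_apply h2.hasFDerivAt).fderiv
    have c1 : ContDiffAt ℝ ∞ (fun y => ContinuousLinearMap.compL ℝ E F G (B y)) x :=
      (ContinuousLinearMap.compL ℝ E F G).contDiff.contDiffAt.comp x hB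
    have c2 : ContDiffAt ℝ ∞ (fun y => (fderiv ℝ B y).flip) x :=
      (ContinuousLinearMap.flipₗᵢ ℝ E F G).toContinuousLinearEquiv.contDiff.contDiffAt.comp x hB'
    have z1 : ∀ j < m, iteratedFDeriv ℝ j (fderiv ℝ f) x = 0 := by
      intro j hj
      ext w a
      have := congrArg (fun M : ContinuousMultilinearMap ℝ (fun _ : Fin (j + 1) => E) F =>
        M (Fin.snoc w a : Fin (j + 1) → E)) (h0 (j + 1) (by omega))
      simp only [iteratedFDeriv_succ_apply_right, Fin.init_snoc, Fin.snoc_last] at this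
      exact this
    have z2 : ∀ j < m, iteratedFDeriv ℝ j f x = 0 := fun j hj => h0 j (by omega)
    rw [iteratedFDeriv_succ_apply_right, (hev.iteratedFDeriv ℝ m).self_of_nhds]
    rw [iteratedFDeriv_succ_apply_right]
    have hadd := iteratedFDeriv_add_apply (𝕜 := ℝ) (i := m) (x := x)
      (f := fun y => ContinuousLinearMap.compL ℝ E F G (B y) (fderiv ℝ f y))
      (g := fun y => (fderiv ℝ B y).flip (f y))
      ((c1.clm_apply hf').of_le (mod_cast le_top)) ((c2.clm_apply hf).of_le (mod_cast le_top))
    have e3 := ih c1 hf' z1 (Fin.init v)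
    have e4 := ih c2 hf z2 (Fin.init v)
    have h5 := congrArg (fun M : ContinuousMultilinearMap ℝ (fun _ : Fin m => E) (E →L[ℝ] G) =>
      M (Fin.init v) (v (Fin.last m))) hadd
    refine h5.trans ?_
    rw [add_apply, add_apply, e3, e4, h0 m (by omega)]
    simp

theorem iteratedFDeriv_clm_apply_eq_zero {B : E → F →L[ℝ] G} {f : E → F} {x : E} {m : ℕ}
    (hB : ContDiffAt ℝ ∞ B x) (hf : ContDiffAt ℝ ∞ f x)
    (h0 : ∀ j ≤ m, iteratedFDeriv ℝ j f x = 0) :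
    iteratedFDeriv ℝ m (fun y => B y (f y)) x = 0 := by
  ext v
  rw [iteratedFDeriv_clm_apply_of_eq_zero m hB hf (fun j hj => h0 j hj.le), h0 m le_rfl]
  simp

/-- The transposition of the last two arguments is the symmetry of the second derivative,
differentiated further. Every other adjacent transposition is treated by induction, applied to
`fderiv ℝ f`. Adjacent transpositions generate all permutations. -/
theorem iteratedFDeriv_comp_swap {f : E → F} {x : E} (hf : ContDiffAt ℝ ∞ f x) (n : ℕ) (i : Fin n)
    (v : Fin (n + 1) → E) :
    iteratedFDeriv ℝ (n + 1) f x (v ∘ Equiv.swap i.castSucc i.succ)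
      = iteratedFDeriv ℝ (n + 1) f x v := by
  induction n generalizing F with
  | zero => exact i.elim0
  | succ n ih =>
    have hf' : ContDiffAt ℝ ∞ (fderiv ℝ f) x := hf.fderiv_right (by simp)
    refine Fin.lastCases ?_ (fun i => ?_) i
    · have hf'' : ContDiffAt ℝ ∞ (fderiv ℝ (fderiv ℝ f)) x := hf'.fderiv_right (by simp)
      have key : ∀ (w : Fin n → E) (a b : E),
          iteratedFDeriv ℝ n (fderiv ℝ (fderiv ℝ f)) x w a b
            = iteratedFDeriv ℝ n (fderiv ℝ (fderiv ℝ f)) x w b a := by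
        intro w a b
        rw [← iteratedFDeriv_apply_const hf'', ← iteratedFDeriv_apply_const hf'',
          ← iteratedFDeriv_apply_const (hf''.clm_apply contDiffAt_const),
          ← iteratedFDeriv_apply_const (hf''.clm_apply contDiffAt_const)]
        have hev : (fun y => fderiv ℝ (fderiv ℝ f) y a b) =ᶠ[𝓝 x]
            (fun y => fderiv ℝ (fderiv ℝ f) y b a) := by
          filter_upwards [(hf.of_le (m := 2) (by exact WithTop.coe_le_coe.2 le_top)).eventually
            (by simp)] with y hy
          exact (hy.isSymmSndFDerivAt (by rw [minSmoothness_of_isRCLikeNormedField])).eq a b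
        rw [(hev.iteratedFDeriv ℝ n).self_of_nhds]
      simp only [iteratedFDeriv_succ_apply_right]
      rw [key]
      have h1 : Fin.init (Fin.init (v ∘ Equiv.swap (Fin.last n).castSucc (Fin.last n).succ))
          = Fin.init (Fin.init v) := by
        funext j
        simp only [Fin.init, Function.comp_apply]
        rw [Equiv.swap_apply_of_ne_of_ne]
        · simp [Fin.ext_iff]; omega
        · simp [Fin.ext_iff]; omega
      rw [h1]
      simp [Fin.init]
    · rw [iteratedFDeriv_succ_apply_right (n := n + 1) (f := f),
        iteratedFDeriv_succ_apply_right (n := n + 1) (f := f)]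
      have h1 : Fin.init (v ∘ Equiv.swap i.castSucc.castSucc i.castSucc.succ)
          = Fin.init v ∘ Equiv.swap i.castSucc i.succ := by
        funext j
        simp only [Fin.init, Function.comp_apply, Equiv.swap_apply_def, Fin.ext_iff]
        split_ifs <;> simp_all
      have h2 : (v ∘ Equiv.swap i.castSucc.castSucc i.castSucc.succ) (Fin.last (n + 1))
          = v (Fin.last (n + 1)) := by
        simp only [Function.comp_apply]
        rw [Equiv.swap_apply_of_ne_of_ne]
        · simp [Fin.ext_iff]; omega
        · simp [Fin.ext_iff]; omega
      rw [h1, h2, ih hf']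

/-- The iterated derivatives of a smooth function are symmetric. -/
theorem iteratedFDeriv_comp_perm {f : E → F} {x : E} (hf : ContDiffAt ℝ ∞ f x) {n : ℕ}
    (v : Fin n → E) (σ : Equiv.Perm (Fin n)) :
    iteratedFDeriv ℝ n f x (v ∘ σ) = iteratedFDeriv ℝ n f x v := by
  cases n with
  | zero => rw [Subsingleton.elim (v ∘ σ) v]
  | succ n =>
    have hσ : σ ∈ Submonoid.closure (range fun i : Fin n => Equiv.swap i.castSucc i.succ) := by
      rw [Equiv.Perm.mclosure_swap_castSucc_succ]
      trivial
    induction hσ using Submonoid.closure_induction generalizing v with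
    | mem σ hσ =>
      obtain ⟨i, rfl⟩ := hσ
      exact iteratedFDeriv_comp_swap hf n i v
    | one => rfl
    | mul σ τ _ _ h1 h2 =>
      have : v ∘ (σ * τ : Equiv.Perm (Fin (n + 1))) = (v ∘ σ) ∘ τ := rfl
      rw [this, h2, h1]

end Iterated

/-! ### Linear algebra of complex structures -/

section ComplexLinear

variable {E : Type} [AddCommGroup E] [Module ℝ E]

/-- The complex vector space structure given by an endomorphism of square `-1`. -/
abbrev complexModule (J : E →ₗ[ℝ] E) (hJ : ∀ v, J (J v) = -v) : Module ℂ E :=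
  Module.compHom E (Complex.lift ⟨(J : Module.End ℝ E), LinearMap.ext hJ⟩ :
    ℂ →ₐ[ℝ] Module.End ℝ E).toRingHom

theorem exists_sup_span_range_eq_top {K V : Type*} [Field K] [AddCommGroup V] [Module K V]
    [FiniteDimensional K V] (P : Submodule K V) {k : ℕ}
    (hk : Module.finrank K V ≤ Module.finrank K P + k) :
    ∃ e : Fin k → V, P ⊔ Submodule.span K (range e) = ⊤ := by
  obtain ⟨Q, hQ⟩ := P.exists_isCompl
  have hd := Submodule.finrank_add_eq_of_isCompl hQ
  have hk' : Module.finrank K Q ≤ k := by omega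
  let b := Module.finBasis K Q
  -- `k` may exceed the codimension of `P`; the surplus vectors are zero.
  refine ⟨fun j => if h : (j : ℕ) < Module.finrank K Q then b ⟨j, h⟩ else 0, ?_⟩
  rw [eq_top_iff, ← hQ.sup_eq_top]
  refine sup_le_sup_left ?_ P
  have h1 : Submodule.map Q.subtype (Submodule.span K (range b)) = Q := by
    rw [b.span_eq, Submodule.map_top, Submodule.range_subtype]
  refine h1.ge.trans ?_
  rw [Submodule.map_span, Submodule.span_le]
  rintro _ ⟨_, ⟨j, rfl⟩, rfl⟩
  exact Submodule.subset_span ⟨⟨j, j.2.trans_le hk'⟩, by simp⟩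

/-- A complex vector space of dimension `n` has `n` generators. -/
theorem exists_generators (J : E →ₗ[ℝ] E) (hJ : ∀ v, J (J v) = -v) [FiniteDimensional ℝ E] {n : ℕ}
    (hn : Module.finrank ℝ E = 2 * n) :
    ∃ e : Fin n → E, ∀ P : Submodule ℝ E, (∀ v ∈ P, J v ∈ P) → (∀ j, e j ∈ P) → P = ⊤ := by
  let _ := complexModule J hJ
  have hsmul : ∀ (z : ℂ) (v : E), z • v = z.re • v + z.im • J v := fun z v => rfl
  have : IsScalarTower ℝ ℂ E := ⟨fun r z v => by simp [hsmul, mul_smul, smul_add]⟩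
  have : FiniteDimensional ℂ E := FiniteDimensional.right ℝ ℂ E
  have hd := Module.finrank_mul_finrank ℝ ℂ E
  rw [Complex.finrank_real_complex, hn] at hd
  obtain ⟨e, he⟩ := exists_sup_span_range_eq_top (⊥ : Submodule ℂ E) (k := n) (by simp; omega)
  refine ⟨e, fun P hP heP => ?_⟩
  let P' : Submodule ℂ E :=
    { P with smul_mem' := fun z v hv => P.add_mem (P.smul_mem _ hv) (P.smul_mem _ (hP v hv)) }
  have hP' : P' = ⊤ := by
    rw [eq_top_iff, ← he, bot_sup_eq, Submodule.span_le]
    rintro _ ⟨j, rfl⟩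
    exact heP j
  rw [eq_top_iff]
  intro v _
  have : v ∈ P' := by rw [hP']; trivial
  exact this

/-- ξ and l are independent over ℂ, so m further vectors generate a space of complex dimension m +
2. Generation is phrased through real subspaces stable under `J`, so that the complex structure
stays inside the proof. Later l is a value of N, on which symbols vanish. -/
theorem exists_generators_cons (J : E →ₗ[ℝ] E) (hJ : ∀ v, J (J v) = -v) [FiniteDimensional ℝ E]
    {m : ℕ} (hn : Module.finrank ℝ E = 2 * (m + 2)) {ξ l : E} (hl : l ≠ 0)
    (hξ : ∀ a b : ℝ, ξ ≠ a • l + b • J l) :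
    ∃ e : Fin m → E, ∀ P : Submodule ℝ E, (∀ v ∈ P, J v ∈ P) → l ∈ P → ξ ∈ P →
      (∀ j, e j ∈ P) → P = ⊤ := by
  let _ := complexModule J hJ
  have hsmul : ∀ (z : ℂ) (v : E), z • v = z.re • v + z.im • J v := fun z v => rfl
  have : IsScalarTower ℝ ℂ E := ⟨fun r z v => by simp [hsmul, mul_smul, smul_add]⟩
  have : FiniteDimensional ℂ E := FiniteDimensional.right ℝ ℂ E
  have hd := Module.finrank_mul_finrank ℝ ℂ E
  rw [Complex.finrank_real_complex, hn] at hd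
  have hli : LinearIndependent ℂ ![ξ, l] := by
    rw [LinearIndependent.pair_iff' ?_]
    · intro z hz
      have hz0 : z ≠ 0 := by
        rintro rfl
        rw [zero_smul] at hz
        exact hl hz.symm
      have : ξ = z⁻¹ • l := by rw [← hz, smul_smul, inv_mul_cancel₀ hz0, one_smul]
      exact hξ _ _ (this.trans (hsmul _ _))
    · rintro rfl
      exact hξ 0 0 (by simp)
  have hrank := finrank_span_eq_card hli
  obtain ⟨e, he⟩ := exists_sup_span_range_eq_top (Submodule.span ℂ (range ![ξ, l])) (k := m)
    (by rw [hrank]; simp; omega)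
  refine ⟨e, fun P hP hlP hξP heP => ?_⟩
  let P' : Submodule ℂ E :=
    { P with smul_mem' := fun z v hv => P.add_mem (P.smul_mem _ hv) (P.smul_mem _ (hP v hv)) }
  have hP' : P' = ⊤ := by
    rw [eq_top_iff, ← he, sup_le_iff, Submodule.span_le, Submodule.span_le]
    refine ⟨?_, ?_⟩
    · rintro _ ⟨j, rfl⟩
      fin_cases j
      · exact hξP
      · exact hlP
    · rintro _ ⟨j, rfl⟩
      exact heP j
  rw [eq_top_iff]
  intro v _
  have : v ∈ P' := by rw [hP']; trivial
  exact this

end ComplexLinear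

/-! ### The strict dimension bound for 1-jets. -/

section Bounds

variable {E : Type} [NormedAddCommGroup E] [NormedSpace ℝ E] [FiniteDimensional ℝ E]

/-- The space of `1`-jets of infinitesimal symmetries of an almost complex structure with non-zero
Nijenhuis tensor is smaller than the space of complex affine jets. -/
theorem finrank_jets_lt {J₀ : E →L[ℝ] E} (hJ₀ : ∀ v, J₀ (J₀ v) = -v) {n : ℕ}
    (hn : Module.finrank ℝ E = 2 * n) {N : E →L[ℝ] E →L[ℝ] E} (hN : N ≠ 0)
    (H : Submodule ℝ (E × (E →L[ℝ] E)))
    (h1 : ∀ A, (0, A) ∈ H → ∀ v, A (J₀ v) = J₀ (A v))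
    (h2 : ∀ A, (0, A) ∈ H → ∀ ξ η, A (N ξ η) = N (A ξ) η + N ξ (A η)) :
    Module.finrank ℝ H < 2 * (n ^ 2 + n) := by
  obtain ⟨e, he⟩ := exists_generators (J₀ : E →ₗ[ℝ] E) hJ₀ hn
  have hext : ∀ A B : E →L[ℝ] E, (∀ v, A (J₀ v) = J₀ (A v)) → (∀ v, B (J₀ v) = J₀ (B v)) →
      (∀ j, A (e j) = B (e j)) → A = B := by
    intro A B hA hB hAB
    have := he (LinearMap.eqLocus (A : E →ₗ[ℝ] E) (B : E →ₗ[ℝ] E)) (fun v hv => ?_) hAB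
    · ext v
      have hv : v ∈ LinearMap.eqLocus (A : E →ₗ[ℝ] E) (B : E →ₗ[ℝ] E) := by rw [this]; trivial
      exact hv
    · change A v = B v at hv
      change A (J₀ v) = B (J₀ v)
      rw [hA, hB, hv]
  let H₀ : Submodule ℝ (E →L[ℝ] E) := H.comap (LinearMap.inr ℝ E (E →L[ℝ] E))
  let ev : (E →L[ℝ] E) →ₗ[ℝ] (Fin n → E) :=
    LinearMap.pi fun j => ((ContinuousLinearMap.apply ℝ E (e j)) : (E →L[ℝ] E) →ₗ[ℝ] E)
  have hinj : Function.Injective (ev.domRestrict H₀) := by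
    rintro ⟨A, hA⟩ ⟨B, hB⟩ hAB
    exact Subtype.ext (hext A B (h1 A hA) (h1 B hB) fun j => congrFun hAB j)
  -- The identity is not a derivation of `N`, since it would give N = N + N. So the complex
  -- endomorphisms in `H` embed into a proper subspace of Eⁿ, of dimension below 2n².
  have hid : (fun j => e j) ∉ LinearMap.range (ev.domRestrict H₀) := by
    rintro ⟨⟨A, hA⟩, hAe⟩
    have hAid : A = ContinuousLinearMap.id ℝ E :=
      hext A _ (h1 A hA) (fun v => rfl) fun j => congrFun hAe j
    apply hN
    ext ξ η
    have := h2 A hA ξ η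
    rw [hAid] at this
    simpa using this
  have hlt : Module.finrank ℝ H₀ < 2 * n * n := by
    rw [← LinearMap.finrank_range_of_inj hinj]
    have hne : LinearMap.range (ev.domRestrict H₀) ≠ ⊤ := fun h => hid (by rw [h]; trivial)
    have := Submodule.finrank_lt hne
    rw [Module.finrank_pi_fintype] at this
    simpa [hn, mul_comm] using this
  let p : H →ₗ[ℝ] E := (LinearMap.fst ℝ E (E →L[ℝ] E)).domRestrict H
  have hsum := p.finrank_range_add_finrank_ker
  have hr : Module.finrank ℝ (LinearMap.range p) ≤ 2 * n := hn ▸ Submodule.finrank_le _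
  have hk : Module.finrank ℝ (LinearMap.ker p) ≤ Module.finrank ℝ H₀ := by
    let q : LinearMap.ker p →ₗ[ℝ] H₀ :=
      { toFun := fun w => ⟨w.1.1.2, by
          have h0 : w.1.1.1 = 0 := w.2
          have h3 := w.1.2
          change ((0 : E), w.1.1.2) ∈ H
          rw [← h0]
          exact h3⟩
        map_add' := fun _ _ => rfl
        map_smul' := fun _ _ => rfl }
    refine LinearMap.finrank_le_finrank_of_injective (f := q) ?_
    rintro ⟨⟨⟨a, A⟩, hA⟩, ha⟩ ⟨⟨⟨b, B⟩, hB⟩, hb⟩ hq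
    have ha' : a = 0 := ha
    have hb' : b = 0 := hb
    have hAB : A = B := congrArg Subtype.val hq
    subst ha' hb' hAB
    rfl
  nlinarith

end Bounds

/-! ### Symbols of formal symmetries -/

section Symbols

variable {E : Type} [NormedAddCommGroup E] [NormedSpace ℝ E]

/-- A complex multilinear map takes values in a complex subspace if it does so on generators. -/
theorem mem_of_mem_generators {i : ℕ} (A : MultilinearMap ℝ (fun _ : Fin i => E) E) {J₀ : E →L[ℝ] E}
    (hA : ∀ (v : Fin i → E) (a : Fin i) (x : E),
      A (Function.update v a (J₀ x)) = J₀ (A (Function.update v a x)))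
    {T : Submodule ℝ E} (hT : ∀ v ∈ T, J₀ v ∈ T) {g : Set E}
    (hg : ∀ P : Submodule ℝ E, (∀ v ∈ P, J₀ v ∈ P) → g ⊆ P → P = ⊤)
    (h : ∀ v : Fin i → E, (∀ a, v a ∈ g) → A v ∈ T) (v : Fin i → E) : A v ∈ T := by
  -- The arguments are freed one at a time: `s` is the set of slots not required to hold generators.
  -- In one slot, the vectors with values in `T` form a subspace stable under `J₀`.
  have key : ∀ (s : Finset (Fin i)) (v : Fin i → E), (∀ a ∉ s, v a ∈ g) → A v ∈ T := by
    intro s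
    induction s using Finset.induction_on with
    | empty => exact fun v hv => h v fun a => hv a (Finset.notMem_empty a)
    | insert a s ha ih =>
      intro v hv
      have hP := hg (T.comap (A.toLinearMap v a)) (fun x hx => ?_) (fun x hx => ?_)
      · have hva : v a ∈ T.comap (A.toLinearMap v a) := by rw [hP]; trivial
        rw [Submodule.mem_comap, MultilinearMap.toLinearMap_apply, Function.update_eq_self] at hva
        exact hva
      · rw [Submodule.mem_comap, MultilinearMap.toLinearMap_apply] at hx ⊢
        rw [hA]
        exact hT _ hx
      · refine ih _ fun b hb => ?_
        by_cases hab : b = a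
        · subst hab
          simpa using hx
        · rw [Function.update_of_ne hab]
          exact hv b (by simp [hab, hb])
  exact key Finset.univ v fun a ha => absurd (Finset.mem_univ a) ha

/-- The equations satisfied by the leading term, of degree `i + 1`, of a formal symmetry. -/
structure IsSymbol (J₀ : E →L[ℝ] E) (N : E →L[ℝ] E →L[ℝ] E) {i : ℕ}
    (A : MultilinearMap ℝ (fun _ : Fin (i + 1) => E) E) : Prop where
  symm : ∀ (v : Fin (i + 1) → E) (σ : Equiv.Perm (Fin (i + 1))), A (v ∘ σ) = A v
  complex : ∀ (v : Fin i → E) (x : E), A (Fin.snoc v (J₀ x)) = J₀ (A (Fin.snoc v x))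
  stab : ∀ (v : Fin i → E) (ξ η : E), A (Fin.snoc v (N ξ η))
    = N (A (Fin.snoc v ξ)) η + N ξ (A (Fin.snoc v η))

variable {J₀ : E →L[ℝ] E} {N : E →L[ℝ] E →L[ℝ] E}

omit [NormedAddCommGroup E] [NormedSpace ℝ E] in
theorem update_eq_snoc_comp {i : ℕ} (v : Fin (i + 1) → E) (a : Fin (i + 1)) (x : E) :
    Function.update v a x = (Fin.snoc (Fin.init (v ∘ Equiv.swap a (Fin.last i))) x : Fin (i + 1) → E)
      ∘ Equiv.swap a (Fin.last i) := by
  funext b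
  by_cases hb : b = a
  · subst hb
    simp
  · rw [Function.update_of_ne hb, Function.comp_apply]
    have hne : Equiv.swap a (Fin.last i) b ≠ Fin.last i := fun h => hb (by
      have := congrArg (Equiv.swap a (Fin.last i)) h
      simpa using this)
    obtain ⟨c, hc⟩ := Fin.exists_castSucc_eq.2 hne
    rw [← hc, Fin.snoc_castSucc, Fin.init, hc]
    simp

namespace IsSymbol

variable {i : ℕ} {A : MultilinearMap ℝ (fun _ : Fin (i + 1) => E) E}

theorem map_update (h : IsSymbol J₀ N A) (v : Fin (i + 1) → E) (a : Fin (i + 1)) (x : E) :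
    A (Function.update v a x) = A (Fin.snoc (Fin.init (v ∘ Equiv.swap a (Fin.last i))) x) := by
  rw [update_eq_snoc_comp, h.symm]

theorem complex_update (h : IsSymbol J₀ N A) (v : Fin (i + 1) → E) (a : Fin (i + 1)) (x : E) :
    A (Function.update v a (J₀ x)) = J₀ (A (Function.update v a x)) := by
  rw [h.map_update, h.map_update, h.complex]

end IsSymbol

/-- In degree at least two there is a spare argument `v 0`. Multiplying it by `J₀` multiplies the
left side of the stabilizer equation by `J₀` and the right side by `-J₀`, because N is antilinear;
so both sides vanish. -/
theorem IsSymbol.map_nij_eq_zero {i : ℕ} {A : MultilinearMap ℝ (fun _ : Fin (i + 1 + 1) => E) E}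
    (hA : IsSymbol J₀ N A) (hJ₀ : ∀ v, J₀ (J₀ v) = -v)
    (hl : ∀ ξ η, N (J₀ ξ) η = -J₀ (N ξ η)) (hr : ∀ ξ η, N ξ (J₀ η) = -J₀ (N ξ η))
    (v : Fin (i + 1) → E) (ξ η : E) : A (Fin.snoc v (N ξ η)) = 0 := by
  have h0 : ∀ x, A (Fin.snoc (Function.update v 0 (J₀ (v 0))) x) = J₀ (A (Fin.snoc v x)) := by
    intro x
    rw [Fin.snoc_update, hA.complex_update, ← Fin.snoc_update, Function.update_eq_self]
  have h3 := hA.stab (Function.update v 0 (J₀ (v 0))) ξ η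
  rw [h0, h0, h0, hl, hr] at h3
  have h4 := congrArg J₀ (hA.stab v ξ η)
  rw [map_add] at h4
  have h5 : (2 : ℝ) • J₀ (A (Fin.snoc v (N ξ η))) = 0 := by
    rw [two_smul]
    nth_rewrite 1 [h3]
    rw [h4]
    abel
  have h6 := (smul_eq_zero.1 h5).resolve_left two_ne_zero
  have h7 := hJ₀ (A (Fin.snoc v (N ξ η)))
  rw [h6, map_zero] at h7
  exact neg_eq_zero.1 h7.symm

/-- A symbol of degree at least two is determined by few of its values on generators. -/
theorem IsSymbol.eq_zero {i m : ℕ} {A : MultilinearMap ℝ (fun _ : Fin (i + 1 + 1) => E) E}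
    (hA : IsSymbol J₀ N A) (hJ₀ : ∀ v, J₀ (J₀ v) = -v)
    (hl : ∀ ξ η, N (J₀ ξ) η = -J₀ (N ξ η)) (hr : ∀ ξ η, N ξ (J₀ η) = -J₀ (N ξ η))
    {ξ₀ η₀ : E} (hξ : N ξ₀ ξ₀ = 0) (h0 : N ξ₀ η₀ ≠ 0) {e : Fin m → E}
    (he : ∀ P : Submodule ℝ E, (∀ v ∈ P, J₀ v ∈ P) → N ξ₀ η₀ ∈ P → ξ₀ ∈ P → (∀ j, e j ∈ P) → P = ⊤)
    (hA1 : ∀ f : Fin (i + 1 + 1) → Fin (m + 1),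
      A ((Fin.cons ξ₀ e : Fin (m + 1) → E) ∘ f) ∈ Submodule.span ℝ {ξ₀, J₀ ξ₀})
    (hA2 : ∀ f : Fin (i + 1 + 1) → Fin m, A (e ∘ f) = 0) : A = 0 := by
  let g : Set E := insert (N ξ₀ η₀) (range (Fin.cons ξ₀ e : Fin (m + 1) → E))
  have hg : ∀ P : Submodule ℝ E, (∀ v ∈ P, J₀ v ∈ P) → g ⊆ P → P = ⊤ := fun P hP hgP =>
    he P hP (hgP (mem_insert _ _)) (hgP (mem_insert_of_mem _ ⟨0, rfl⟩))
      fun j => hgP (mem_insert_of_mem _ ⟨j.succ, rfl⟩)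
  have hval : ∀ (v : Fin (i + 1 + 1) → E) (a : Fin (i + 1 + 1)), v a = N ξ₀ η₀ → A v = 0 := by
    intro v a hva
    rw [← Function.update_eq_self a v, hva, hA.map_update, hA.map_nij_eq_zero hJ₀ hl hr]
  have hspanJ : ∀ v ∈ Submodule.span ℝ {ξ₀, J₀ ξ₀}, J₀ v ∈ Submodule.span ℝ {ξ₀, J₀ ξ₀} := by
    intro v hv
    obtain ⟨a, b, rfl⟩ := Submodule.mem_span_pair.1 hv
    refine Submodule.mem_span_pair.2 ⟨-b, a, ?_⟩
    rw [map_add, map_smul, map_smul, hJ₀]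
    module
  -- On generators either some argument is a value of N, and `A` vanishes, or all are among ξ₀, e,
  -- and `hA1` applies. Hence all values lie in the complex line of ξ₀.
  have hmem : ∀ v, A v ∈ Submodule.span ℝ {ξ₀, J₀ ξ₀} := by
    refine mem_of_mem_generators A hA.complex_update hspanJ hg fun v hv => ?_
    by_cases hex : ∃ a, v a = N ξ₀ η₀
    · obtain ⟨a, ha⟩ := hex
      rw [hval v a ha]
      exact zero_mem _
    · push Not at hex
      choose f hf using fun a => (hv a).resolve_left (hex a)
      have : v = (Fin.cons ξ₀ e : Fin (m + 1) → E) ∘ f := funext fun a => (hf a).symm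
      rw [this]
      exact hA1 f
  have hβ : ∀ x ∈ Submodule.span ℝ {ξ₀, J₀ ξ₀}, N ξ₀ x = 0 := by
    intro x hx
    obtain ⟨a, b, rfl⟩ := Submodule.mem_span_pair.1 hx
    rw [map_add, map_smul, map_smul, hr, hξ]
    simp
  -- On the complex line of ξ₀ the antilinear map N(·, η₀) is injective. Combining the equation for
  -- x = aξ₀ + bJξ₀ with its image under `J₀` gives (a² + b²) N(ξ₀, η₀) = 0.
  have hα : ∀ x ∈ Submodule.span ℝ {ξ₀, J₀ ξ₀}, N x η₀ = 0 → x = 0 := by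
    intro x hx h
    obtain ⟨a, b, rfl⟩ := Submodule.mem_span_pair.1 hx
    rw [map_add, map_smul, map_smul, add_apply, smul_apply, smul_apply, hl] at h
    have hJh := congrArg J₀ h
    rw [map_add, map_smul, map_smul, map_neg, hJ₀, map_zero, neg_neg] at hJh
    have h2 : (a ^ 2 + b ^ 2) • N ξ₀ η₀ = 0 := by
      calc (a ^ 2 + b ^ 2) • N ξ₀ η₀ = a • (a • N ξ₀ η₀ + b • -J₀ (N ξ₀ η₀))
            + b • (a • J₀ (N ξ₀ η₀) + b • N ξ₀ η₀) := by module
        _ = 0 := by rw [h, hJh]; simp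
    have h3 := (smul_eq_zero.1 h2).resolve_right h0
    have ha : a = 0 := by nlinarith [sq_nonneg a, sq_nonneg b]
    have hb : b = 0 := by nlinarith [sq_nonneg a, sq_nonneg b]
    rw [ha, hb]
    simp
  -- The stabilizer equation at ξ₀, η₀ has left side zero, and its term N(ξ₀, A(v, η₀)) vanishes
  -- because A takes values in ℂξ₀. What remains is N(A(v, ξ₀), η₀) = 0.
  have hlast : ∀ v : Fin (i + 1) → E, A (Fin.snoc v ξ₀) = 0 := by
    intro v
    refine hα _ (hmem _) ?_
    have h1 := hA.stab v ξ₀ η₀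
    rw [hA.map_nij_eq_zero hJ₀ hl hr, hβ _ (hmem _), add_zero] at h1
    exact h1.symm
  ext v
  have := mem_of_mem_generators A hA.complex_update (T := ⊥) (fun v hv => by
    rw [Submodule.mem_bot] at hv ⊢; rw [hv, map_zero]) hg (fun v hv => ?_) v
  · exact (Submodule.mem_bot ℝ).1 this
  · rw [Submodule.mem_bot]
    by_cases hex : ∃ a, v a = N ξ₀ η₀
    · obtain ⟨a, ha⟩ := hex
      exact hval v a ha
    · push Not at hex
      choose f hf using fun a => (hv a).resolve_left (hex a)
      by_cases hz : ∃ a, f a = 0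
      · obtain ⟨a, ha⟩ := hz
        have hva : v a = ξ₀ := by rw [← hf, ha]; rfl
        rw [← Function.update_eq_self a v, hva, hA.map_update, hlast]
      · push Not at hz
        choose f' hf' using fun a => Fin.exists_succ_eq.2 (hz a)
        have : v = e ∘ f' := funext fun a => by
          rw [← hf, ← hf']
          rfl
        rw [this]
        exact hA2 f'

/-! ### Multi-indices -/

/-- The fibres of `f` and `g` over each value have the same cardinality; bijections between the
fibres glue to a permutation. -/
theorem exists_perm_of_map_univ_eq {α : Type} {i : ℕ} {f g : Fin i → α}
    (h : Multiset.map f Finset.univ.val = Multiset.map g Finset.univ.val) :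
    ∃ σ : Equiv.Perm (Fin i), f = g ∘ σ := by
  classical
  have hcard : ∀ a, Fintype.card {x // f x = a} = Fintype.card {x // g x = a} := by
    intro a
    have := congrArg (Multiset.count a) h
    rw [Multiset.count_map, Multiset.count_map] at this
    rw [Fintype.card_subtype, Fintype.card_subtype]
    simpa [Finset.card, Finset.filter, eq_comm] using this
  let σ : Equiv.Perm (Fin i) :=
    (Equiv.sigmaFiberEquiv f).symm.trans
      ((Equiv.sigmaCongrRight fun a => Fintype.equivOfCardEq (hcard a)).trans
        (Equiv.sigmaFiberEquiv g))
  refine ⟨σ, funext fun x => ?_⟩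
  exact (((Fintype.equivOfCardEq (hcard (f x))) ⟨x, rfl⟩).2).symm

/-- A representative of a multi-index. -/
theorem exists_symRep (α : Type) (i : ℕ) : ∃ rep : Sym α i → Fin i → α,
    ∀ f : Fin i → α, ∃ s, ∃ σ : Equiv.Perm (Fin i), f = rep s ∘ σ := by
  have hex : ∀ s : Sym α i, ∃ f : Fin i → α, Multiset.map f Finset.univ.val = s.1 := by
    rintro ⟨s, hs⟩
    induction s using Quotient.inductionOn with
    | h l =>
      have hl : l.length = i := by simpa using hs
      subst hl
      refine ⟨l.get, ?_⟩
      change _ = (l : Multiset α)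
      rw [Fin.univ_def]
      simp
  choose rep hrep using hex
  refine ⟨rep, fun f => ⟨⟨Multiset.map f Finset.univ.val, by simp⟩, ?_⟩⟩
  exact exists_perm_of_map_univ_eq (hrep ⟨Multiset.map f Finset.univ.val, by simp⟩).symm

/-- Polynomials of degree at most k in m variables correspond to homogeneous polynomials of degree k
in m + 1 variables. -/
theorem sum_multichoose (m k : ℕ) :
    ∑ i : Fin (k + 1), Nat.multichoose m i = Nat.multichoose (m + 1) k := by
  induction k with
  | zero => simp
  | succ k ih =>
    rw [Fin.sum_univ_castSucc]
    simp only [Fin.val_castSucc, Fin.val_last]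
    rw [ih, Nat.multichoose_succ_succ, add_comm]

end Symbols

/-! ### Counting formal symmetries -/

section Flat

variable {E F G : Type} [NormedAddCommGroup E] [NormedSpace ℝ E] [NormedAddCommGroup F]
  [NormedSpace ℝ F] [NormedAddCommGroup G] [NormedSpace ℝ G]

/-- The function `f` is smooth and vanishes to infinite order at `x`. -/
def IsFlatAt (f : E → F) (x : E) : Prop :=
  ContDiffAt ℝ ∞ f x ∧ ∀ m : ℕ, iteratedFDeriv ℝ m f x = 0

theorem IsFlatAt.add {f g : E → F} {x : E} (hf : IsFlatAt f x) (hg : IsFlatAt g x) :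
    IsFlatAt (fun y => f y + g y) x := by
  refine ⟨hf.1.add hg.1, fun m => ?_⟩
  rw [fun_iteratedFDeriv_add_apply (hf.1.of_le (mod_cast le_top)) (hg.1.of_le (mod_cast le_top)),
    hf.2, hg.2, add_zero]

theorem IsFlatAt.clm_apply {f : E → F} {B : E → F →L[ℝ] G} {x : E} (hf : IsFlatAt f x)
    (hB : ContDiffAt ℝ ∞ B x) : IsFlatAt (fun y => B y (f y)) x :=
  ⟨hB.clm_apply hf.1, fun _ => iteratedFDeriv_clm_apply_eq_zero hB hf.1 fun j _ => hf.2 j⟩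

theorem IsFlatAt.sub {f g : E → F} {x : E} (hf : IsFlatAt f x) (hg : IsFlatAt g x) :
    IsFlatAt (fun y => f y - g y) x := by
  have h := hf.add (hg.clm_apply (B := fun _ => -ContinuousLinearMap.id ℝ F) contDiffAt_const)
  simpa [sub_eq_add_neg] using h

theorem iteratedFDeriv_fderiv_eq_zero {f : E → F} {x : E} {m : ℕ}
    (h : iteratedFDeriv ℝ (m + 1) f x = 0) : iteratedFDeriv ℝ m (fderiv ℝ f) x = 0 := by
  ext w a
  have := congrArg (fun M : ContinuousMultilinearMap ℝ (fun _ : Fin (m + 1) => E) F =>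
    M (Fin.snoc w a : Fin (m + 1) → E)) h
  simp only [iteratedFDeriv_succ_apply_right, Fin.init_snoc, Fin.snoc_last] at this
  exact this

theorem IsFlatAt.fderiv {f : E → F} {x : E} (hf : IsFlatAt f x) : IsFlatAt (fderiv ℝ f) x :=
  ⟨hf.1.fderiv_right (by simp), fun m => iteratedFDeriv_fderiv_eq_zero (hf.2 (m + 1))⟩

theorem IsFlatAt.congr {f g : E → F} {x : E} (hf : IsFlatAt f x) (h : g =ᶠ[𝓝 x] f) :
    IsFlatAt g x :=
  ⟨hf.1.congr_of_eventuallyEq h, fun m => by rw [(h.iteratedFDeriv ℝ m).self_of_nhds, hf.2]⟩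

end Flat

section Formal

variable {E : Type} [NormedAddCommGroup E] [NormedSpace ℝ E] {J : E → E →L[ℝ] E} {X : E → E}
  {V : Set E} {x : E}

/-- By `nijDefect_eq` the defect of the Nijenhuis tensor is built from L_X J and its derivative with
smooth coefficients, and flatness survives differentiation and smooth coefficients. -/
theorem isFlatAt_nijDefect (hV : IsOpen V) (hx : x ∈ V) (hJ : ContDiffOn ℝ ∞ J V)
    (hX : ContDiffOn ℝ ∞ X V) (hE : IsFlatAt (infDefect J X) x) (ξ η : E) :
    IsFlatAt (fun y => nijDefect J X y ξ η) x := by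
  have hJx : ContDiffAt ℝ ∞ J x := hJ.contDiffAt (hV.mem_nhds hx)
  have hJ' : ContDiffAt ℝ ∞ (fderiv ℝ J) x := hJx.fderiv_right (by simp)
  have ap : ContDiff ℝ ∞ (ContinuousLinearMap.apply ℝ E : E → (E →L[ℝ] E) →L[ℝ] E) :=
    (ContinuousLinearMap.apply ℝ E).contDiff
  have ap' : ContDiff ℝ ∞ (ContinuousLinearMap.apply ℝ (E →L[ℝ] E) :
      E → (E →L[ℝ] E →L[ℝ] E) →L[ℝ] (E →L[ℝ] E)) :=
    (ContinuousLinearMap.apply ℝ (E →L[ℝ] E)).contDiff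
  have t1 : ∀ ξ η, IsFlatAt (fun y => fderiv ℝ (infDefect J X) y (J y ξ) η) x := fun ξ η =>
    hE.fderiv.clm_apply (B := fun y => ContinuousLinearMap.apply ℝ E η ∘L
      ContinuousLinearMap.apply ℝ (E →L[ℝ] E) (J y ξ)) (contDiffAt_const.clm_comp
        (ap'.contDiffAt.comp x (hJx.clm_apply contDiffAt_const)))
  have t2 : ∀ ξ η, IsFlatAt (fun y => J y (fderiv ℝ (infDefect J X) y ξ η)) x := fun ξ η =>
    hE.fderiv.clm_apply (B := fun y => J y ∘L ContinuousLinearMap.apply ℝ E η ∘L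
      ContinuousLinearMap.apply ℝ (E →L[ℝ] E) ξ) (hJx.clm_comp contDiffAt_const)
  have t3 : ∀ ξ η, IsFlatAt (fun y => infDefect J X y (fderiv ℝ J y ξ η)) x := fun ξ η =>
    hE.clm_apply (B := fun y => ContinuousLinearMap.apply ℝ E (fderiv ℝ J y ξ η))
      (ap.contDiffAt.comp x ((hJ'.clm_apply contDiffAt_const).clm_apply contDiffAt_const))
  have t4 : ∀ ξ η, IsFlatAt (fun y => fderiv ℝ J y (infDefect J X y ξ) η) x := fun ξ η =>
    hE.clm_apply (B := fun y => ContinuousLinearMap.apply ℝ E η ∘L fderiv ℝ J y ∘L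
      ContinuousLinearMap.apply ℝ E ξ) (contDiffAt_const.clm_comp (hJ'.clm_comp contDiffAt_const))
  have h := (((((t1 ξ η).sub (t2 ξ η)).sub ((t1 η ξ).sub (t2 η ξ))).sub (t3 ξ η)).add
    (t3 η ξ)).add (t4 ξ η) |>.sub (t4 η ξ)
  refine h.congr (eventually_of_mem (hV.mem_nhds hx) fun y hy => ?_)
  exact nijDefect_eq (hJ.contDiffAt (hV.mem_nhds hy)) (hX.contDiffAt (hV.mem_nhds hy)) ξ η

/-- In the i-th derivative of B·DX − C·X at `x`, every term containing a derivative of `X` of order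
at most i vanishes. Only `B x` applied to the derivative of order i + 1 survives. -/
theorem leading_term_eq_zero {F : Type} [NormedAddCommGroup F] [NormedSpace ℝ F] {i : ℕ}
    {B : E → (E →L[ℝ] E) →L[ℝ] F} {C : E → E →L[ℝ] F} (hX : ContDiffAt ℝ ∞ X x)
    (hB : ContDiffAt ℝ ∞ B x) (hC : ContDiffAt ℝ ∞ C x)
    (h0 : ∀ j < i + 1, iteratedFDeriv ℝ j X x = 0)
    (h : IsFlatAt (fun y => B y (fderiv ℝ X y) - C y (X y)) x) (v : Fin i → E) :
    B x (iteratedFDeriv ℝ i (fderiv ℝ X) x v) = 0 := by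
  have hX' : ContDiffAt ℝ ∞ (fderiv ℝ X) x := hX.fderiv_right (by simp)
  have e : (fun y => B y (fderiv ℝ X y)) =
      fun y => (B y (fderiv ℝ X y) - C y (X y)) + C y (X y) := by
    funext y
    abel
  rw [← iteratedFDeriv_clm_apply_of_eq_zero i hB hX' (fun j hj =>
    iteratedFDeriv_fderiv_eq_zero (h0 (j + 1) (by omega))), e, fun_iteratedFDeriv_add_apply
      (h.1.of_le (mod_cast le_top)) ((hC.clm_apply hX).of_le (mod_cast le_top)), h.2,
    iteratedFDeriv_clm_apply_eq_zero hC hX fun j hj => h0 j (by omega)]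
  simp

/-- The leading term of a formal symmetry is a symbol. -/
theorem isSymbol_iteratedFDeriv (hV : IsOpen V) (hx : x ∈ V) (hJ : ContDiffOn ℝ ∞ J V)
    (hX : ContDiffOn ℝ ∞ X V) (hE : IsFlatAt (infDefect J X) x) {i : ℕ}
    (h0 : ∀ j < i + 1, iteratedFDeriv ℝ j X x = 0) :
    IsSymbol (J x) (nij J x) (iteratedFDeriv ℝ (i + 1) X x).toMultilinearMap := by
  have hJx : ContDiffAt ℝ ∞ J x := hJ.contDiffAt (hV.mem_nhds hx)
  have hXx : ContDiffAt ℝ ∞ X x := hX.contDiffAt (hV.mem_nhds hx)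
  have hJ' : ContDiffAt ℝ ∞ (fderiv ℝ J) x := hJx.fderiv_right (by simp)
  have hN : ContDiffAt ℝ ∞ (nij J) x := contDiffAt_nij hJx
  have hN' : ContDiffAt ℝ ∞ (fderiv ℝ (nij J)) x := hN.fderiv_right (by simp)
  have hval : ∀ (v : Fin i → E) (a : E), (iteratedFDeriv ℝ (i + 1) X x).toMultilinearMap
      (Fin.snoc v a) = iteratedFDeriv ℝ i (fderiv ℝ X) x v a := by
    intro v a
    change iteratedFDeriv ℝ (i + 1) X x (Fin.snoc v a : Fin (i + 1) → E) = _
    rw [iteratedFDeriv_succ_apply_right, Fin.init_snoc, Fin.snoc_last]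
  refine ⟨fun v σ => iteratedFDeriv_comp_perm hXx v σ, fun v a => ?_, fun v ξ η => ?_⟩
  · have h1 := leading_term_eq_zero (B := fun y =>
      (ContinuousLinearMap.compL ℝ E E E).flip (J y) - ContinuousLinearMap.compL ℝ E E E (J y))
      (C := fderiv ℝ J) hXx
      (((ContinuousLinearMap.compL ℝ E E E).flip.contDiff.contDiffAt.comp x hJx).sub
        ((ContinuousLinearMap.compL ℝ E E E).contDiff.contDiffAt.comp x hJx)) hJ' h0 hE v
    rw [hval, hval]
    have h2 := congrArg (fun A : E →L[ℝ] E => A a) h1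
    simp at h2
    exact sub_eq_zero.1 h2
  · have ap : ContDiff ℝ ∞ (ContinuousLinearMap.apply ℝ E : E → (E →L[ℝ] E) →L[ℝ] E) :=
      (ContinuousLinearMap.apply ℝ E).contDiff
    have cst : ∀ w : E, ContDiffAt ℝ ∞ (fun _ : E => w) x := fun w => contDiffAt_const
    have hB : ContDiffAt ℝ ∞ (fun y => ContinuousLinearMap.apply ℝ E (nij J y ξ η)
        - (nij J y).flip η ∘L ContinuousLinearMap.apply ℝ E ξ
        - nij J y ξ ∘L ContinuousLinearMap.apply ℝ E η) x := by
      refine ((ap.contDiffAt.comp x ((hN.clm_apply (cst ξ)).clm_apply (cst η))).sub ?_).sub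
        ((hN.clm_apply (cst ξ)).clm_comp contDiffAt_const)
      exact (((ContinuousLinearMap.flipₗᵢ ℝ E E E).toContinuousLinearEquiv.contDiff.contDiffAt.comp
        x hN).clm_apply (cst η)).clm_comp contDiffAt_const
    have hC : ContDiffAt ℝ ∞ (fun y => ContinuousLinearMap.apply ℝ E η ∘L
        ContinuousLinearMap.apply ℝ (E →L[ℝ] E) ξ ∘L fderiv ℝ (nij J) y) x :=
      contDiffAt_const.clm_comp (contDiffAt_const.clm_comp hN')
    have h1 := leading_term_eq_zero hXx hB hC h0 (isFlatAt_nijDefect hV hx hJ hX hE ξ η) v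
    rw [hval, hval, hval]
    simp at h1
    rw [sub_sub] at h1
    exact sub_eq_zero.1 h1

theorem linearIndependent_pair_of_sq {J₀ : E →L[ℝ] E} (hJ₀ : ∀ v, J₀ (J₀ v) = -v) {ξ : E}
    (hξ : ξ ≠ 0) : LinearIndependent ℝ ![ξ, J₀ ξ] := by
  rw [LinearIndependent.pair_iff' hξ]
  intro a ha
  have h1 := hJ₀ ξ
  rw [← ha, map_smul, ← ha, smul_smul] at h1
  have h2 : (a * a + 1) • ξ = 0 := by
    rw [add_smul, h1, one_smul]
    simp
  have := (smul_eq_zero.1 h2).resolve_right hξ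
  nlinarith [mul_self_nonneg a]

/-- A non-zero skew antilinear form has a non-zero value `N ξ η` with `ξ` outside its complex
span. -/
theorem exists_nij_ne_zero {J₀ : E →L[ℝ] E} {N : E →L[ℝ] E →L[ℝ] E}
    (hr : ∀ ξ η, N ξ (J₀ η) = -J₀ (N ξ η)) (hs : ∀ ξ η, N ξ η = -N η ξ)
    (hl : ∀ ξ η, N (J₀ ξ) η = -J₀ (N ξ η)) (hN : N ≠ 0) :
    ∃ ξ η, N ξ η ≠ 0 ∧ ∀ a b : ℝ, ξ ≠ a • N ξ η + b • J₀ (N ξ η) := by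
  obtain ⟨ξ, η, h⟩ : ∃ ξ η, N ξ η ≠ 0 := by
    by_contra hc
    push Not at hc
    exact hN (by ext ξ η; simpa using hc ξ η)
  have hself : ∀ v, N v v = 0 := fun v => by
    have h1 := hs v v
    have : (2 : ℝ) • N v v = 0 := by
      rw [two_smul]
      nth_rewrite 1 [h1]
      simp
    exact (smul_eq_zero.1 this).resolve_left two_ne_zero
  -- If ξ lies on the complex line of N(ξ, η), exchange ξ and η. They cannot both lie on that line,
  -- because N vanishes on pairs from one complex line.
  by_cases h1 : ∃ a b : ℝ, ξ = a • N ξ η + b • J₀ (N ξ η)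
  · refine ⟨η, ξ, fun h0 => h (by rw [hs, h0, neg_zero]), fun c d h2 => ?_⟩
    obtain ⟨a, b, h1⟩ := h1
    rw [hs η ξ] at h2
    have key : ∀ l : E, N (a • l + b • J₀ l) (c • -l + d • J₀ (-l)) = 0 := fun l => by
      simp [hself, hr, hl]
    exact h (by rw [← key (N ξ η), ← h1, ← h2])
  · push Not at h1
    exact ⟨ξ, η, h, h1⟩

/-- The components that determine a jet, degree by degree, are recorded by a linear map. Injectivity
follows by strong induction on the degree: once the lower derivatives vanish, the next one is a
symbol, and `IsSymbol.eq_zero` applies. Summing multichoose numbers over the degrees gives the first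
two terms; jets of order 0 and 1 are recorded in full and give the constant. -/
theorem finrank_formal_jets_le [FiniteDimensional ℝ E] {m : ℕ}
    (hn : Module.finrank ℝ E = 2 * (m + 2)) (hV : IsOpen V) (hx : x ∈ V)
    (hJ : ContDiffOn ℝ ∞ J V) (hsq : ∀ y ∈ V, ∀ v, J y (J y v) = -v) (hN : nij J x ≠ 0) (k : ℕ)
    (H : Submodule ℝ ((i : Fin (k + 1)) → ContinuousMultilinearMap ℝ (fun _ : Fin (i : ℕ) => E) E))
    (hH : ∀ j ∈ H, ∃ X : E → E, ContDiffOn ℝ ∞ X V ∧ IsFlatAt (infDefect J X) x ∧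
      ∀ i : Fin (k + 1), iteratedFDeriv ℝ i X x = j i) :
    Module.finrank ℝ H ≤ 2 * (m + 1) * Nat.multichoose (m + 2) k
      + 2 * (m + 2) * Nat.multichoose (m + 1) k + (2 * (m + 2) + 2 * (m + 2) * (2 * (m + 2))) := by
  have hJx : ContDiffAt ℝ ∞ J x := hJ.contDiffAt (hV.mem_nhds hx)
  have hsq' : ∀ᶠ y in 𝓝 x, ∀ v, J y (J y v) = -v := eventually_of_mem (hV.mem_nhds hx) hsq
  have hJ₀ := hsq x hx
  have hl := nij_antilinear_left hJx hsq'
  have hr := nij_antilinear_right hJx hsq'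
  obtain ⟨ξ, η, h0, hξ⟩ := exists_nij_ne_zero hr (nij_swap J x) hl hN
  have hξ0 : ξ ≠ 0 := by
    rintro rfl
    simp at h0
  have hself : nij J x ξ ξ = 0 := by
    rw [nij_apply]
    abel
  obtain ⟨e, he⟩ := exists_generators_cons (J x : E →ₗ[ℝ] E) hJ₀ hn h0 hξ
  let Q : Submodule ℝ E := Submodule.span ℝ {ξ, J x ξ}
  have hQ : Module.finrank ℝ (E ⧸ Q) = 2 * (m + 1) := by
    have h1 := finrank_span_eq_card (linearIndependent_pair_of_sq hJ₀ hξ0)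
    have h2 := Submodule.finrank_quotient_add_finrank Q
    have h3 : range ![ξ, J x ξ] = {ξ, J x ξ} := by simp [Set.pair_comm]
    rw [h3] at h1
    have h4 : Module.finrank ℝ Q = 2 := by simpa using h1
    omega
  choose rep hrep using fun i : ℕ => exists_symRep (Fin (m + 1)) i
  choose rep' hrep' using fun i : ℕ => exists_symRep (Fin m) i
  let b := Module.finBasis ℝ E
  let ev : (i : Fin (k + 1)) → (Fin (i : ℕ) → E) →
      ((i : Fin (k + 1)) → ContinuousMultilinearMap ℝ (fun _ : Fin (i : ℕ) => E) E) →ₗ[ℝ] E :=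
    fun i v => { toFun := fun j => j i v, map_add' := fun _ _ => rfl, map_smul' := fun _ _ => rfl }
  -- In each degree: the values on monomials in ξ, e modulo the complex line of ξ, and the values on
  -- monomials in e alone; then the full components of degree 0 and 1. The index `min 1 k` makes the
  -- last one meaningful for `k = 0`, where it carries no information.
  let Λ : ((i : Fin (k + 1)) → ContinuousMultilinearMap ℝ (fun _ : Fin (i : ℕ) => E) E) →ₗ[ℝ]
      ((i : Fin (k + 1)) → (Sym (Fin (m + 1)) i → E ⧸ Q) × (Sym (Fin m) i → E)) ×
        (E × (Fin (Module.finrank ℝ E) → E)) :=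
    (LinearMap.pi fun i => (LinearMap.pi fun s => Q.mkQ ∘ₗ
        ev i ((Fin.cons ξ e : Fin (m + 1) → E) ∘ rep i s)).prod
      (LinearMap.pi fun s => ev i (e ∘ rep' i s))).prod
    ((ev 0 fun _ => 0).prod (LinearMap.pi fun a =>
      ev ⟨min 1 k, Nat.lt_succ_of_le (min_le_right 1 k)⟩ fun _ => b a))
  have hinj : Function.Injective (Λ.domRestrict H) := by
    rw [injective_iff_map_eq_zero]
    rintro ⟨j, hj⟩ hΛ
    change Λ j = 0 at hΛ
    obtain ⟨X, hX, hE, hXj⟩ := hH j hj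
    obtain ⟨hΛ1, hΛ2⟩ := Prod.mk_eq_zero.1 hΛ
    obtain ⟨hΛ2, hΛ3⟩ := Prod.mk_eq_zero.1 hΛ2
    have hXx : ContDiffAt ℝ ∞ X x := hX.contDiffAt (hV.mem_nhds hx)
    have key : ∀ i ≤ k, iteratedFDeriv ℝ i X x = 0 := by
      intro i
      induction i using Nat.strong_induction_on with
      | h i ih =>
        intro hik
        match i, ih, hik with
        | 0, _, _ =>
          ext v
          have h1 : j 0 (fun _ => 0) = 0 := hΛ2
          rw [← hXj 0] at h1
          rw [Subsingleton.elim v fun _ => 0]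
          exact h1
        | 1, _, hik =>
          have h1 : ∀ a, iteratedFDeriv ℝ 1 X x (fun _ => b a) = 0 := by
            intro a
            have h2 : j ⟨min 1 k, Nat.lt_succ_of_le (min_le_right 1 k)⟩ (fun _ => b a) = 0 :=
              congrFun hΛ3 a
            rw [← hXj] at h2
            have h3 : ∀ q, q = 1 → iteratedFDeriv ℝ q X x (fun _ => b a) = 0 →
                iteratedFDeriv ℝ 1 X x (fun _ => b a) = 0 := by
              rintro q rfl h
              exact h
            exact h3 _ (min_eq_left hik) h2
          have h3 : (iteratedFDeriv ℝ 1 X x).toMultilinearMap = 0 := by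
            refine Module.Basis.ext_multilinear (fun _ => b) fun v => ?_
            have : (fun a : Fin 1 => b (v a)) = fun _ => b (v 0) := by
              funext a
              rw [Subsingleton.elim a 0]
            rw [this]
            exact h1 (v 0)
          ext v
          exact congrArg (fun M : MultilinearMap ℝ (fun _ : Fin 1 => E) E => M v) h3
        | i + 2, ih, hik =>
          have hsymb := isSymbol_iteratedFDeriv hV hx hJ hX hE (i := i + 1)
            fun l hl => ih l (by omega) (by omega)
          have hcomp := congrFun hΛ1 ⟨i + 2, by omega⟩
          obtain ⟨hc1, hc2⟩ := Prod.mk_eq_zero.1 hcomp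
          have h3 := hsymb.eq_zero hJ₀ hl hr hself h0 he (fun f => ?_) (fun f => ?_)
          · ext v
            exact congrArg (fun M : MultilinearMap ℝ (fun _ : Fin (i + 2) => E) E => M v) h3
          · obtain ⟨s, σ, rfl⟩ := hrep (i + 2) f
            have h4 := hsymb.symm ((Fin.cons ξ e : Fin (m + 1) → E) ∘ rep (i + 2) s) σ
            rw [Function.comp_assoc] at h4
            rw [h4]
            have h5 : Q.mkQ (j ⟨i + 2, by omega⟩
                ((Fin.cons ξ e : Fin (m + 1) → E) ∘ rep (i + 2) s)) = 0 := congrFun hc1 s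
            rw [← hXj, Submodule.mkQ_apply, Submodule.Quotient.mk_eq_zero] at h5
            exact h5
          · obtain ⟨s, σ, rfl⟩ := hrep' (i + 2) f
            have h4 := hsymb.symm (e ∘ rep' (i + 2) s) σ
            rw [Function.comp_assoc] at h4
            rw [h4]
            have h5 : j ⟨i + 2, by omega⟩ (e ∘ rep' (i + 2) s) = 0 := congrFun hc2 s
            rw [← hXj] at h5
            exact h5
    refine Subtype.ext (funext fun i => ?_)
    change j i = 0
    rw [← hXj i]
    exact key i (Nat.le_of_lt_succ i.2)
  refine (LinearMap.finrank_le_finrank_of_injective hinj).trans (le_of_eq ?_)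
  rw [Module.finrank_prod, Module.finrank_prod, Module.finrank_pi_fintype]
  simp only [Module.finrank_prod, Module.finrank_pi_fintype, hQ, hn, Finset.sum_const,
    Finset.card_univ, Sym.card_sym_eq_multichoose, Fintype.card_fin, smul_eq_mul]
  rw [Finset.sum_add_distrib, ← Finset.sum_mul, ← Finset.sum_mul, sum_multichoose, sum_multichoose]
  ring

end Formal

/-! ### Variational equation and flows of infinitesimal symmetries -/

section Flow

/-- Multiplication by a bump function. Composition operators on spaces of curves require globally
defined smooth maps, while the data are only local. -/
theorem exists_contDiff_eq_on_ball {X Y : Type} [NormedAddCommGroup X] [NormedSpace ℝ X]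
    [FiniteDimensional ℝ X] [NormedAddCommGroup Y] [NormedSpace ℝ Y] {f : X → Y} {O : Set X} {a : X}
    (hO : IsOpen O) (ha : a ∈ O) (hf : ContDiffOn ℝ ∞ f O) :
    ∃ g : X → Y, ContDiff ℝ ∞ g ∧ ∃ r > 0, Metric.ball a r ⊆ O ∧ ∀ x ∈ Metric.ball a r, g x = f x := by
  obtain ⟨r, hr, hrO⟩ := Metric.isOpen_iff.1 hO a ha
  let b : ContDiffBump a := ⟨r / 4, r / 2, by positivity, by linarith⟩
  refine ⟨fun x => b x • f x, ?_, r / 4, by positivity,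
    (Metric.ball_subset_ball (by linarith)).trans hrO, fun x hx => ?_⟩
  · rw [contDiff_iff_contDiffAt]
    intro x
    by_cases hx : x ∈ Metric.ball a r
    · exact b.contDiff.contDiffAt.smul (hf.contDiffAt (hO.mem_nhds (hrO hx)))
    · have h1 : (Metric.closedBall a (r / 2))ᶜ ∈ 𝓝 x :=
        Metric.isClosed_closedBall.isOpen_compl.mem_nhds fun h =>
          hx (Metric.closedBall_subset_ball (by linarith) h)
      refine (contDiffAt_const (c := (0 : Y))).congr_of_eventuallyEq ?_
      filter_upwards [h1] with y hy
      have : b y = 0 := b.zero_of_le_dist (not_lt.1 fun h => hy (le_of_lt h))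
      rw [this, zero_smul]
  · have : b x = 1 := b.one_of_mem_closedBall (Metric.ball_subset_closedBall hx)
    simp only [this, one_smul]

variable {Z : Type} [NormedAddCommGroup Z] [NormedSpace ℝ Z] [CompleteSpace Z]

/-- The variational equation. -/
theorem fderiv_solution {R : Z → Z} (hR : ContDiff ℝ ∞ R) {σ : Z → C(unitInterval, Z)} {O : Set Z}
    (hO : IsOpen O) (hσ : ContDiffOn ℝ ∞ σ O)
    (hsol : ∀ z ∈ O, σ z = ContinuousMap.const _ z
        + primitive Z ((⟨R, hR.continuous⟩ : C(Z, Z)).comp (σ z))) {z : Z} (hz : z ∈ O) (v : Z) :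
    fderiv ℝ σ z v = ContinuousMap.const _ v + primitive Z (pointwiseApply unitInterval Z Z
      ((⟨fderiv ℝ R, hR.continuous_fderiv (by simp)⟩ : C(Z, Z →L[ℝ] Z)).comp (σ z))
      (fderiv ℝ σ z v)) := by
  let κ : Z →L[ℝ] C(unitInterval, Z) :=
    LinearMap.mkContinuous
      { toFun := fun z => ContinuousMap.const _ z, map_add' := fun _ _ => rfl,
        map_smul' := fun _ _ => rfl } 1 (fun z => by
        rw [ContinuousMap.norm_le _ (by positivity)]
        exact fun s => (one_mul ‖z‖).ge)
  have h1 : HasFDerivAt σ (fderiv ℝ σ z) z :=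
    ((hσ.contDiffAt (hO.mem_nhds hz)).differentiableAt (by simp)).hasFDerivAt
  have h2 := κ.hasFDerivAt.add ((primitive Z).hasFDerivAt.comp z
    ((hasFDerivAt_continuousMap_comp (K := unitInterval) (hR.of_le (by simp)) (σ z)).comp z h1))
  have h3 := h1.unique (h2.congr_of_eventuallyEq (eventually_of_mem (hO.mem_nhds hz) hsol))
  exact congrArg (fun A : Z →L[ℝ] C(unitInterval, Z) => A v) h3

/-- At a stationary point the time-one map has derivative exp R′, which equals 1 + R′ because R′
squares to zero. -/
theorem fderiv_solution_of_stationary {R : Z → Z} (hR : ContDiff ℝ ∞ R)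
    {σ : Z → C(unitInterval, Z)} {O : Set Z} (hO : IsOpen O) (hσ : ContDiffOn ℝ ∞ σ O)
    (hsol : ∀ z ∈ O, σ z = ContinuousMap.const _ z
        + primitive Z ((⟨R, hR.continuous⟩ : C(Z, Z)).comp (σ z))) {z : Z} (hz : z ∈ O)
    (hσz : σ z = ContinuousMap.const _ z) (h1 : ∀ v, fderiv ℝ R z (fderiv ℝ R z v) = 0) (v : Z) :
    fderiv ℝ σ z v 1 = v + fderiv ℝ R z v := by
  have h := fderiv_solution hR hO hσ hsol hz v
  rw [hσz] at h
  have h2 : pointwiseApply unitInterval Z Z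
      ((⟨fderiv ℝ R, hR.continuous_fderiv (by simp)⟩ : C(Z, Z →L[ℝ] Z)).comp
        (ContinuousMap.const _ z)) (fderiv ℝ σ z v) = ContinuousMap.const _ (fderiv ℝ R z v) := by
    ext s
    rw [h]
    simp only [pointwiseApply_apply, ContinuousMap.comp_apply, ContinuousMap.const_apply,
      ContinuousMap.coe_mk, ContinuousMap.add_apply, map_add, map_primitive]
    have : ((fderiv ℝ R z : C(Z, Z)).comp (pointwiseApply unitInterval Z Z
      ((⟨fderiv ℝ R, hR.continuous_fderiv (by simp)⟩ : C(Z, Z →L[ℝ] Z)).comp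
        (ContinuousMap.const _ z)) (fderiv ℝ σ z v))) = 0 := by
      ext u
      simp [h1]
    rw [this, map_zero]
    simp
  rw [h2] at h
  rw [h]
  simp [primitive_const]

variable {E T : Type} [NormedAddCommGroup E] [NormedSpace ℝ E]
  [NormedAddCommGroup T] [NormedSpace ℝ T]

/-- Solutions of the variational equation of an infinitesimal symmetry are compatible with `J`. -/
theorem comm_of_variational {J : E → E →L[ℝ] E} {Y : E → E} {c a b : ℝ → E} {K : ℝ}
    (hJ : ∀ s ∈ Icc (0 : ℝ) 1, DifferentiableAt ℝ J (c s))
    (hinf : ∀ s ∈ Icc (0 : ℝ) 1, infDefect J Y (c s) = 0)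
    (hc : ∀ s ∈ Icc (0 : ℝ) 1, HasDerivWithinAt c (Y (c s)) (Icc 0 1) s)
    (ha : ∀ s ∈ Icc (0 : ℝ) 1, HasDerivWithinAt a (fderiv ℝ Y (c s) (a s)) (Icc 0 1) s)
    (hb : ∀ s ∈ Icc (0 : ℝ) 1, HasDerivWithinAt b (fderiv ℝ Y (c s) (b s)) (Icc 0 1) s)
    (h0 : J (c 0) (a 0) = b 0) (hK : ∀ s ∈ Icc (0 : ℝ) 1, ‖fderiv ℝ Y (c s)‖ ≤ K) :
    J (c 1) (a 1) = b 1 := by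
  -- Since L_Y J = 0 along the curve, `J a` satisfies the same linear equation as `b`. So does their
  -- difference, which is zero at time 0 and stays zero by Gronwall.
  let w : ℝ → E := fun s => J (c s) (a s) - b s
  have hw : ∀ s ∈ Icc (0 : ℝ) 1, HasDerivWithinAt w (fderiv ℝ Y (c s) (w s)) (Icc 0 1) s := by
    intro s hs
    have h1 := (((hJ s hs).hasFDerivAt.comp_hasDerivWithinAt s (hc s hs)).clm_apply
      (ha s hs)).sub (hb s hs)
    refine h1.congr_deriv ?_
    have h2 := congrArg (fun A : E →L[ℝ] E => A (a s)) (hinf s hs)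
    simp only [infDefect, ContinuousLinearMap.comp_apply, sub_apply, zero_apply] at h2
    simp only [w, Function.comp_apply, map_sub]
    rw [← sub_eq_zero.1 h2]
    abel
  have hw1 := eq_zero_of_abs_deriv_le_mul_abs_self_of_eq_zero_right (f := w)
    (f' := fun s => fderiv ℝ Y (c s) (w s)) (K := K) (a := 0) (b := 1)
    (fun s hs => (hw s hs).continuousWithinAt) (fun s hs => ?_) (sub_eq_zero.2 h0)
    (fun s hs => (fderiv ℝ Y (c s)).le_of_opNorm_le (hK s ⟨hs.1, hs.2.le⟩) _) 1
    (right_mem_Icc.2 zero_le_one)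
  · exact sub_eq_zero.1 hw1
  · exact (hw s ⟨hs.1, hs.2.le⟩).mono_of_mem_nhdsWithin
      (Icc_mem_nhdsGE_of_mem hs)

theorem fderiv_parametric_field {X : E → T →L[ℝ] E} (hX : ContDiff ℝ ∞ X) (z v : T × E) :
    fderiv ℝ (fun z : T × E => ((0 : T), X z.2 z.1)) z v
      = (0, fderiv ℝ X z.2 v.2 z.1 + X z.2 v.1) := by
  have h1 : HasFDerivAt (fun z : T × E => X z.2) _ z :=
    HasFDerivAt.comp z ((hX.differentiable (by simp)) z.2).hasFDerivAt hasFDerivAt_snd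
  have h2 := (hasFDerivAt_const (0 : T) z).prodMk (h1.clm_apply (hasFDerivAt_fst (p := z)))
  rw [h2.fderiv]
  simp [add_comm]

variable [CompleteSpace E] [CompleteSpace T]

/-- The time one maps of a linear family of fields, near the zero field. If the fields are
infinitesimal symmetries, then these maps are symmetries. -/
theorem exists_flow {J : E → E →L[ℝ] E} {X : E → T →L[ℝ] E} (hX : ContDiff ℝ ∞ X) {x₀ : E} {r₁ : ℝ}
    (hr₁ : 0 < r₁) (hJ : ContDiffOn ℝ ∞ J (Metric.ball x₀ r₁))
    (hinf : ∀ t, ∀ y ∈ Metric.ball x₀ r₁, infDefect J (fun y => X y t) y = 0) :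
    ∃ (Φ : T × E → E), ∃ r > 0, r ≤ r₁ ∧
      ContDiffOn ℝ ∞ Φ (Metric.ball 0 r ×ˢ Metric.ball x₀ r) ∧
      (∀ t ∈ Metric.ball (0 : T) r, ∀ y ∈ Metric.ball x₀ r, Φ (t, y) ∈ Metric.ball x₀ r₁ ∧
        fderiv ℝ (fun y => Φ (t, y)) y ∘L J y = J (Φ (t, y)) ∘L fderiv ℝ (fun y => Φ (t, y)) y) ∧
      ∀ y ∈ Metric.ball x₀ r, Φ (0, y) = y ∧ ∀ τ, fderiv ℝ Φ (0, y) (τ, 0) = X y τ := by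
  -- The parameter `t` becomes a state variable at rest. Every point (0, y) is stationary, with
  -- derivative (τ, v) ↦ (0, X y τ), whose square is zero.
  let R : T × E → T × E := fun z => (0, X z.2 z.1)
  have hR : ContDiff ℝ ∞ R :=
    contDiff_const.prodMk ((hX.comp contDiff_snd).clm_apply contDiff_fst)
  have hR' : ∀ z v, fderiv ℝ R z v = (0, fderiv ℝ X z.2 v.2 z.1 + X z.2 v.1) :=
    fderiv_parametric_field hX
  have hsq : ∀ (y : E) v, fderiv ℝ R (0, y) (fderiv ℝ R (0, y) v) = 0 := fun y v => by
    simp [hR']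
  obtain ⟨σ, O, hO, hz₀, hσ, hσ₀, hsol, huniq⟩ := exists_contDiffOn_solution (z₀ := ((0 : T), x₀)) hR
    (by simp [R]) (hsq x₀)
  have hcont : ContinuousAt σ (0, x₀) := (hσ.contDiffAt (hO.mem_nhds hz₀)).continuousAt
  have e1 : ∀ᶠ z in 𝓝 ((0 : T), x₀), σ z ∈ Metric.ball (ContinuousMap.const unitInterval ((0 : T), x₀)) r₁ := by
    refine hcont.eventually_mem (Metric.isOpen_ball.mem_nhds ?_)
    rw [hσ₀]
    exact Metric.mem_ball_self hr₁
  -- For the parameter 0 constant curves are solutions; by uniqueness they are the curves given by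
  -- `σ`.
  have e2 : ∀ᶠ z in 𝓝 ((0 : T), x₀), σ (0, z.2) = ContinuousMap.const unitInterval ((0 : T), z.2) := by
    have hc : Continuous fun z : T × E => ContinuousMap.const unitInterval ((0 : T), z.2) :=
      (ContinuousMap.continuous_const' (X := unitInterval)).comp
        (continuous_const.prodMk continuous_snd)
    have h2 := (hc.tendsto ((0 : T), x₀)).eventually huniq
    filter_upwards [h2] with z hz
    refine ((hz (0, z.2) ?_).2).symm
    have : (⟨R, hR.continuous⟩ : C(T × E, T × E)).comp
        (ContinuousMap.const unitInterval ((0 : T), z.2)) = 0 := by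
      ext s <;> simp [R]
    rw [this, map_zero, add_zero]
  obtain ⟨r, hr, hball⟩ := Metric.mem_nhds_iff.1 (inter_mem (inter_mem (hO.mem_nhds hz₀) e1) e2)
  have hball' : ∀ t ∈ Metric.ball (0 : T) (min r r₁), ∀ y ∈ Metric.ball x₀ (min r r₁),
      (t, y) ∈ O ∧ (∀ s, (σ (t, y) s).2 ∈ Metric.ball x₀ r₁) ∧
        σ (0, y) = ContinuousMap.const unitInterval ((0 : T), y) := by
    intro t ht y hy
    have h1 : (t, y) ∈ Metric.ball ((0 : T), x₀) r := by
      rw [← ball_prod_same]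
      exact ⟨Metric.ball_subset_ball (min_le_left _ _) ht,
        Metric.ball_subset_ball (min_le_left _ _) hy⟩
    obtain ⟨⟨h2, h3⟩, h4⟩ := hball h1
    refine ⟨h2, fun s => ?_, h4⟩
    have h5 := (ContinuousMap.dist_apply_le_dist s).trans_lt (Metric.mem_ball.1 h3)
    exact (le_max_right _ _).trans_lt h5
  -- The parameter component of a solution does not move.
  have hfst : ∀ z ∈ O, ∀ s, (σ z s).1 = z.1 := by
    intro z hz s
    have h1 := congrArg (fun c : C(unitInterval, T × E) => (c s).1) (hsol z hz)
    have h2 := map_primitive (ContinuousLinearMap.fst ℝ T E)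
      ((⟨R, hR.continuous⟩ : C(T × E, T × E)).comp (σ z)) s
    have h3 : (ContinuousLinearMap.fst ℝ T E : C(T × E, T)).comp
      ((⟨R, hR.continuous⟩ : C(T × E, T × E)).comp (σ z)) = 0 := by
      ext u
      simp [R]
    rw [h3, map_zero] at h2
    simp only [ContinuousMap.add_apply, ContinuousMap.const_apply, Prod.fst_add] at h1
    rw [h1]
    simpa using h2
  let ev : C(unitInterval, T × E) →L[ℝ] E :=
    ContinuousLinearMap.snd ℝ T E ∘L ContinuousMap.evalCLM ℝ 1
  have hev : ∀ c, ev c = (c 1).2 := fun c => rfl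
  have hΦ' : ∀ z ∈ O, HasFDerivAt (fun z => ev (σ z)) (ev ∘L fderiv ℝ σ z) z := fun z hz =>
    ev.hasFDerivAt.comp z ((hσ.contDiffAt (hO.mem_nhds hz)).differentiableAt (by simp)).hasFDerivAt
  refine ⟨fun z => ev (σ z), min r r₁, lt_min hr hr₁, min_le_right _ _,
    ev.contDiff.comp_contDiffOn (hσ.mono fun z hz => (hball' _ hz.1 _ hz.2).1), ?_, ?_⟩
  · intro t ht y hy
    obtain ⟨hz, hmem, -⟩ := hball' t ht y hy
    refine ⟨hmem 1, ?_⟩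
    let g : E → C(unitInterval, T × E) := fun v => fderiv ℝ σ (t, y) (0, v)
    have hg := fun v : E => fderiv_solution hR hO hσ hsol hz ((0 : T), v)
    have hd : ∀ v, fderiv ℝ (fun y => ev (σ (t, y))) y v = (g v 1).2 := fun v => by
      have h1 : HasFDerivAt (fun y => ev (σ (t, y))) _ y :=
        (hΦ' _ hz).comp y ((hasFDerivAt_const t y).prodMk (hasFDerivAt_id y))
      rw [h1.fderiv]
      rfl
    have hgfst : ∀ v s, (g v s).1 = 0 := by
      intro v s
      have h1 := congrArg (fun c : C(unitInterval, T × E) => (c s).1) (hg v)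
      simp only [ContinuousMap.add_apply, ContinuousMap.const_apply, Prod.fst_add] at h1
      rw [show (g v s).1 = _ from h1]
      refine (zero_add _).trans ((map_primitive (ContinuousLinearMap.fst ℝ T E) _ s).trans ?_)
      have h3 : ∀ q : C(unitInterval, T), q = 0 → primitive T q s = 0 := by
        rintro _ rfl
        simp
      refine h3 _ ?_
      ext u
      simp [hR']
    have hXt : ∀ s v, fderiv ℝ (fun y => X y t) (σ (t, y) s).2 v = fderiv ℝ X (σ (t, y) s).2 v t :=
      fun s v => (fderiv_clm_apply_const (hX.differentiable (by simp) _) v t).symm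
    let snd' : T × E →L[ℝ] E := ContinuousLinearMap.snd ℝ T E
    have hc : ∀ s : unitInterval, HasDerivWithinAt
        (fun u => snd' (IccExtend zero_le_one (σ (t, y)) u)) (X (σ (t, y) s).2 t)
        (Icc 0 1) s := fun s => by
      have h1 := snd'.hasFDerivAt.comp_hasDerivWithinAt (s : ℝ)
        (hasDerivWithinAt_of_eq_primitive (hsol _ hz) s)
      refine h1.congr_deriv ?_
      change X (σ (t, y) s).2 (σ (t, y) s).1 = _
      rw [hfst _ hz]
    have ha : ∀ v, ∀ s : unitInterval, HasDerivWithinAt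
        (fun u => snd' (IccExtend zero_le_one (g v) u))
        (fderiv ℝ (fun y => X y t) (σ (t, y) s).2 (g v s).2) (Icc 0 1) s := fun v s => by
      have h1 := snd'.hasFDerivAt.comp_hasDerivWithinAt (s : ℝ)
        (hasDerivWithinAt_of_eq_primitive (hg v) s)
      refine h1.congr_deriv ?_
      change (fderiv ℝ R (σ (t, y) s) (g v s)).2 = _
      rw [hR', hgfst, hfst _ hz, hXt]
      simp
    let D : C(unitInterval, E →L[ℝ] E) :=
      ⟨fun s => fderiv ℝ (fun y => X y t) (σ (t, y) s).2,
        ((hX.clm_apply contDiff_const).continuous_fderiv (by simp)).comp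
          (continuous_snd.comp (σ (t, y)).continuous)⟩
    have hext : ∀ (c : C(unitInterval, T × E)) (s : ℝ) (hs : s ∈ Icc (0 : ℝ) 1),
        snd' (IccExtend zero_le_one c s) = (c ⟨s, hs⟩).2 := fun c s hs => by
      rw [IccExtend_of_mem _ _ hs]
      rfl
    have h0 : ∀ v, (g v 0).2 = v := fun v => by
      have h1 := congrArg (fun c : C(unitInterval, T × E) => (c 0).2) (hg v)
      simpa using h1
    have h1 : (σ (t, y) 0).2 = y := by
      have h1 := congrArg (fun c : C(unitInterval, T × E) => (c 0).2) (hsol _ hz)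
      simpa using h1
    ext v
    -- `g v` and `g (J y v)` solve the variational equation with initial values v and Jv, so the
    -- relation J a = b propagates from time 0 to time 1.
    have key := comm_of_variational (J := J) (Y := fun y => X y t)
      (c := fun u => snd' (IccExtend zero_le_one (σ (t, y)) u))
      (a := fun u => snd' (IccExtend zero_le_one (g v) u))
      (b := fun u => snd' (IccExtend zero_le_one (g (J y v)) u)) (K := ‖D‖)
      (fun s hs => ?_) (fun s hs => ?_) (fun s hs => ?_) (fun s hs => ?_) (fun s hs => ?_) ?_
      (fun s hs => ?_)
    · simp only [hext _ 1 (right_mem_Icc.2 zero_le_one)] at key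
      simp only [ContinuousLinearMap.comp_apply, hd]
      exact key.symm
    · rw [hext _ s hs]
      exact (hJ.contDiffAt (Metric.isOpen_ball.mem_nhds (hmem _))).differentiableAt (by simp)
    · rw [hext _ s hs]
      exact hinf t _ (hmem _)
    · rw [hext _ s hs]
      exact hc ⟨s, hs⟩
    · rw [hext _ s hs, hext _ s hs]
      exact ha v ⟨s, hs⟩
    · rw [hext _ s hs, hext _ s hs]
      exact ha (J y v) ⟨s, hs⟩
    · simp only [hext _ 0 (left_mem_Icc.2 zero_le_one)]
      change J (σ (t, y) 0).2 (g v 0).2 = (g (J y v) 0).2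
      rw [h0, h0, h1]
    · rw [hext _ s hs]
      exact D.norm_coe_le_norm ⟨s, hs⟩
  · intro y hy
    obtain ⟨hz, -, hconst⟩ := hball' 0 (Metric.mem_ball_self (lt_min hr hr₁)) y hy
    refine ⟨by change (σ (0, y) 1).2 = y; rw [hconst]; rfl, fun τ => ?_⟩
    rw [(hΦ' _ hz).fderiv]
    have := fderiv_solution_of_stationary hR hO hσ hsol hz hconst (hsq y) (τ, 0)
    simp only [ContinuousLinearMap.comp_apply, hev, this, hR']
    simp

end Flow

/-! ### Symmetries near the identity and their first jets -/

section Rigidity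

/-- Finite intersections of the kernels satisfy the descending chain condition. A minimal one is not
reduced by intersecting with any further kernel. -/
theorem exists_finset_forall_eq_zero {S V V' : Type*} [AddCommGroup V] [Module ℝ V]
    [FiniteDimensional ℝ V] [AddCommGroup V'] [Module ℝ V'] (L : S → V →ₗ[ℝ] V') :
    ∃ s : Finset S, ∀ c, (∀ y ∈ s, L y c = 0) → ∀ y, L y c = 0 := by
  classical
  obtain ⟨-, ⟨s, rfl⟩, hs⟩ := (wellFounded_lt (α := Submodule ℝ V)).has_min
    (range fun s : Finset S => ⨅ y ∈ s, LinearMap.ker (L y)) (range_nonempty _)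
  refine ⟨s, fun c hc y => ?_⟩
  have h1 : (⨅ z ∈ insert y s, LinearMap.ker (L z)) ≤ ⨅ z ∈ s, LinearMap.ker (L z) :=
    biInf_mono fun z hz => Finset.mem_insert_of_mem hz
  have h2 := h1.lt_or_eq.resolve_left (hs _ ⟨insert y s, rfl⟩)
  have h3 : c ∈ ⨅ z ∈ insert y s, LinearMap.ker (L z) := by
    rw [h2]
    simpa using hc
  simp only [Submodule.mem_iInf] at h3
  exact h3 y (Finset.mem_insert_self y s)

/-- In finite dimension an injective derivative is bounded below. Strict differentiability makes the
error at most half of this lower bound near `a`, so distinct points have distinct images. The target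
is an arbitrary normed space. -/
theorem exists_injOn_of_hasStrictFDerivAt {V V' : Type*} [NormedAddCommGroup V] [NormedSpace ℝ V]
    [FiniteDimensional ℝ V] [NormedAddCommGroup V'] [NormedSpace ℝ V'] {f : V → V'} {a : V}
    {f' : V →L[ℝ] V'} (hf : HasStrictFDerivAt f f' a) (hf' : ∀ v, f' v = 0 → v = 0) :
    ∃ r > 0, InjOn f (Metric.ball a r) := by
  obtain ⟨K, hK, hanti⟩ := (f' : V →ₗ[ℝ] V').exists_antilipschitzWith
    (LinearMap.ker_eq_bot'.2 hf')
  have h1 := (hf.isLittleO.def (c := (1 / (2 * K) : ℝ)) (by positivity))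
  obtain ⟨r, hr, h2⟩ := Metric.eventually_nhds_iff_ball.1 h1
  refine ⟨r, hr, fun x hx y hy hxy => ?_⟩
  have h3 := h2 (x, y) (by rw [← ball_prod_same]; exact ⟨hx, hy⟩)
  simp only [hxy, sub_self, zero_sub, norm_neg] at h3
  have h4 := hanti.le_mul_dist (x - y) 0
  simp only [ContinuousLinearMap.coe_coe, map_zero, dist_zero_right] at h4
  have h5 : ‖x - y‖ ≤ 1 / 2 * ‖x - y‖ :=
    calc ‖x - y‖ ≤ K * ‖f' (x - y)‖ := h4
      _ ≤ K * (1 / (2 * K) * ‖x - y‖) := by gcongr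
      _ = 1 / 2 * ‖x - y‖ := by field_simp
  have h6 : ‖x - y‖ = 0 := le_antisymm (by linarith) (norm_nonneg _)
  exact sub_eq_zero.1 (norm_eq_zero.1 h6)

variable {E : Type} [NormedAddCommGroup E] [NormedSpace ℝ E]

/-- `f` is a smooth map from `V` to `Ω` whose differential commutes with `J`. -/
structure IsSymOn (J : E → E →L[ℝ] E) (Ω : Set E) (f : E → E) (V : Set E) : Prop where
  contDiffOn : ContDiffOn ℝ ∞ f V
  mapsTo : MapsTo f V Ω
  comm : ∀ y ∈ V, fderiv ℝ f y ∘L J y = J (f y) ∘L fderiv ℝ f y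

/-- The first jet of `f` at `x`. -/
def jet₁ (f : E → E) (x : E) : E × (E →L[ℝ] E) := (f x, fderiv ℝ f x)

variable {J : E → E →L[ℝ] E} {Ω : Set E} {x₀ : E}

theorem isSymOn_id {V : Set E} (hV : V ⊆ Ω) : IsSymOn J Ω (fun y => y) V :=
  ⟨contDiffOn_id, hV, fun y _ => by
    rw [fderiv_fun_id]
    rfl⟩

theorem IsSymOn.mono {f : E → E} {V V' : Set E} (h : IsSymOn J Ω f V) (hV : V' ⊆ V) :
    IsSymOn J Ω f V' :=
  ⟨h.contDiffOn.mono hV, h.mapsTo.mono_left hV, fun y hy => h.comm y (hV hy)⟩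

/-- `f` is `ε`-close to the identity on `V`, with its derivative. -/
def CloseToId (ε : ℝ) (f : E → E) (V : Set E) : Prop :=
  ∀ y ∈ V, ‖f y - y‖ < ε ∧ ‖fderiv ℝ f y - ContinuousLinearMap.id ℝ E‖ < ε

theorem CloseToId.mono {f : E → E} {V V' : Set E} {ε ε' : ℝ} (h : CloseToId ε f V) (hV : V' ⊆ V)
    (hε : ε ≤ ε') : CloseToId ε' f V' := fun y hy =>
  ⟨(h y (hV hy)).1.trans_le hε, (h y (hV hy)).2.trans_le hε⟩

theorem closeToId_id {V : Set E} {ε : ℝ} (hε : 0 < ε) : CloseToId ε (fun y : E => y) V :=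
  fun y _ => by simp [fderiv_fun_id, hε]

/-- Symmetries close to the identity are given by a smooth function of their first jet. -/
theorem exists_jet_extension [FiniteDimensional ℝ E] (hΩ : IsOpen Ω) (hJ : ContDiffOn ℝ ∞ J Ω)
    (hsq : ∀ y ∈ Ω, ∀ v, J y (J y v) = -v) (hx₀ : x₀ ∈ Ω)
    (hspan : Submodule.span ℝ {w | ∃ ξ η, nij J x₀ ξ η = w} = ⊤) :
    ∃ (φ : (E × (E →L[ℝ] E)) × E → E) (W : Set ((E × (E →L[ℝ] E)) × E)), ∃ ε > 0,
      IsOpen W ∧ ContDiffOn ℝ ∞ φ W ∧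
      (∀ j, (j, x₀) ∈ W → φ (j, x₀) = j.1 ∧ ∀ v, fderiv ℝ φ (j, x₀) (0, v) = j.2 v) ∧
      ∀ ρ > 0, Metric.ball x₀ ρ ⊆ Ω → ∀ f, IsSymOn J Ω f (Metric.ball x₀ ρ) → CloseToId ε f (Metric.ball x₀ ρ) →
        ∀ y ∈ Metric.ball x₀ (min ρ ε), (jet₁ f x₀, y) ∈ W ∧ f y = φ (jet₁ f x₀, y) := by
  have : CompleteSpace E := FiniteDimensional.complete ℝ E
  obtain ⟨O', F, hO', hj₀, -, hF, hFeq⟩ := exists_contDiffOn_second_deriv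
    (hΩ.prod (hΩ.prod isOpen_univ)) ⟨hx₀, hx₀, mem_univ _⟩ (contDiffOn_symEq hΩ hJ)
    (symEq_prolongation_injective hΩ hJ hsq hx₀ hspan)
  obtain ⟨F', hF', r₂, hr₂, hr₂O, hFF'⟩ := exists_contDiff_eq_on_ball hO' hj₀ hF
  let j₀ : E × E × (E →L[ℝ] E) := (x₀, x₀, ContinuousLinearMap.id ℝ E)
  -- The state is a direction v and a 1-jet (x, z, p). Along the ray with velocity v a solution of
  -- D²f = F moves its 1-jet by (v, p v, F v).
  let R : E × (E × E × (E →L[ℝ] E)) → E × (E × E × (E →L[ℝ] E)) :=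
    fun z => (0, z.1, z.2.2.2 z.1, F' z.2 z.1)
  have hR : ContDiff ℝ ∞ R :=
    contDiff_const.prodMk (contDiff_fst.prodMk
      (((contDiff_snd.comp (contDiff_snd.comp contDiff_snd)).clm_apply contDiff_fst).prodMk
        ((hF'.comp contDiff_snd).clm_apply contDiff_fst)))
  have hR' : ∀ q v, fderiv ℝ R (0, q) v = (0, v.1, q.2.2 v.1, F' q v.1) := by
    intro q v
    have e1 : HasFDerivAt (fun z : E × (E × E × (E →L[ℝ] E)) => z.2.2.2)
      (ContinuousLinearMap.snd ℝ E (E →L[ℝ] E) ∘L ContinuousLinearMap.snd ℝ E (E × (E →L[ℝ] E)) ∘L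
        ContinuousLinearMap.snd ℝ E (E × E × (E →L[ℝ] E))) (0, q) :=
      (ContinuousLinearMap.snd ℝ E (E →L[ℝ] E) ∘L ContinuousLinearMap.snd ℝ E (E × (E →L[ℝ] E)) ∘L
        ContinuousLinearMap.snd ℝ E (E × E × (E →L[ℝ] E))).hasFDerivAt
    have e0 : HasFDerivAt (fun z : E × (E × E × (E →L[ℝ] E)) => z.2)
      (ContinuousLinearMap.snd ℝ E (E × E × (E →L[ℝ] E))) (0, q) := hasFDerivAt_snd
    have e2 : HasFDerivAt (fun z : E × (E × E × (E →L[ℝ] E)) => F' z.2) _ (0, q) :=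
      HasFDerivAt.comp (g := F') (0, q) (hF'.differentiable (by simp) q).hasFDerivAt e0
    have e3 : HasFDerivAt (fun z : E × (E × E × (E →L[ℝ] E)) => z.1)
      (ContinuousLinearMap.fst ℝ E (E × E × (E →L[ℝ] E))) (0, q) := hasFDerivAt_fst
    have h : HasFDerivAt R _ (0, q) := (hasFDerivAt_const (0 : E) ((0 : E), q)).prodMk
      (e3.prodMk ((e1.clm_apply e3).prodMk (e2.clm_apply e3)))
    rw [h.fderiv]
    simp
  -- States with direction 0 are stationary. The derivative there depends only on the variation of
  -- the direction and produces none, so it squares to zero.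
  have hRsq : ∀ q v, fderiv ℝ R (0, q) (fderiv ℝ R (0, q) v) = 0 := fun q v => by
    simp [hR']
  obtain ⟨σ, O, hO, hz₀, hσ, hσ₀, hsol, huniq⟩ := exists_contDiffOn_solution (z₀ := ((0 : E), j₀)) hR
    (by simp [R]) (hRsq j₀)
  obtain ⟨ε₁, hε₁, huniq⟩ := Metric.eventually_nhds_iff_ball.1 huniq
  let ψ : (E × (E →L[ℝ] E)) × E → E × (E × E × (E →L[ℝ] E)) := fun p => (p.2 - x₀, x₀, p.1)
  have hψ : ContDiff ℝ ∞ ψ :=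
    (contDiff_snd.sub contDiff_const).prodMk (contDiff_const.prodMk contDiff_fst)
  let ev : C(unitInterval, E × (E × E × (E →L[ℝ] E))) →L[ℝ] E :=
    ContinuousLinearMap.fst ℝ E (E →L[ℝ] E) ∘L ContinuousLinearMap.snd ℝ E (E × (E →L[ℝ] E)) ∘L
      ContinuousLinearMap.snd ℝ E (E × E × (E →L[ℝ] E)) ∘L ContinuousMap.evalCLM ℝ 1
  have hev : ∀ c, ev c = (c 1).2.2.1 := fun c => rfl
  let W : Set ((E × (E →L[ℝ] E)) × E) :=
    ψ ⁻¹' O ∩ {p | p.1 ∈ Metric.ball (x₀, ContinuousLinearMap.id ℝ E) ε₁}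
  have hW : IsOpen W := (hO.preimage hψ.continuous).inter
    (Metric.isOpen_ball.preimage continuous_fst)
  -- The initial state `ψ (j, y)` is the jet `j` at `x₀` with velocity `y - x₀`, so that time 1
  -- reaches `y`. The radius is halved because the distance from f(x₀ + s(y − x₀)) to `x₀` is
  -- bounded by the sum of two distances below it.
  refine ⟨fun p => ev (σ (ψ p)), W, min ε₁ r₂ / 2, by positivity, hW,
    ev.contDiff.comp_contDiffOn (hσ.comp hψ.contDiffOn fun p hp => hp.1), ?_, ?_⟩
  · rintro j ⟨hj1, hj2⟩
    have hψj : ψ (j, x₀) = (0, x₀, j) := by simp [ψ]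
    rw [mem_preimage, hψj] at hj1
    have hc : σ (0, x₀, j) = ContinuousMap.const _ (0, x₀, j) := by
      refine ((huniq (ContinuousMap.const _ (0, x₀, j)) ?_ (0, x₀, j) ?_).2).symm
      · rw [Metric.mem_ball, ContinuousMap.dist_lt_iff hε₁]
        intro s
        have h1 : dist j (x₀, ContinuousLinearMap.id ℝ E) < ε₁ := hj2
        simpa [Prod.dist_eq, j₀, hε₁] using h1
      · have : (⟨R, hR.continuous⟩ : C(E × (E × E × (E →L[ℝ] E)), _)).comp
            (ContinuousMap.const unitInterval ((0 : E), x₀, j)) = 0 := by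
          ext s
          all_goals simp [R]
        rw [this, map_zero, add_zero]
    refine ⟨by simp only [hψj, hc, hev]; rfl, fun v => ?_⟩
    have h1 : HasFDerivAt (fun p => ev (σ (ψ p))) (ev ∘L fderiv ℝ σ (ψ (j, x₀)) ∘L fderiv ℝ ψ (j, x₀))
        (j, x₀) :=
      ev.hasFDerivAt.comp _ (HasFDerivAt.comp _
        ((hσ.contDiffAt (hO.mem_nhds (by rw [hψj]; exact hj1))).differentiableAt
          (by simp)).hasFDerivAt (hψ.differentiable (by simp) _).hasFDerivAt)
    have h2 : fderiv ℝ ψ (j, x₀) (0, v) = (v, 0, 0) := by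
      have h3 : HasFDerivAt (fun p : (E × (E →L[ℝ] E)) × E => p.1)
        (ContinuousLinearMap.fst ℝ (E × (E →L[ℝ] E)) E) (j, x₀) := hasFDerivAt_fst
      have h4 : HasFDerivAt (fun p : (E × (E →L[ℝ] E)) × E => p.2)
        (ContinuousLinearMap.snd ℝ (E × (E →L[ℝ] E)) E) (j, x₀) := hasFDerivAt_snd
      have : HasFDerivAt ψ _ (j, x₀) := (h4.sub_const x₀).prodMk
        ((hasFDerivAt_const x₀ (j, x₀)).prodMk h3)
      rw [this.fderiv]
      simp
    rw [h1.fderiv]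
    simp only [ContinuousLinearMap.comp_apply, hψj, h2, hev]
    rw [fderiv_solution_of_stationary hR hO hσ hsol hj1 hc (hRsq _), hR']
    simp
  · intro ρ hρ hρΩ f hf hfε y hy
    set ε := min ε₁ r₂ / 2 with hε
    have hyε : ‖y - x₀‖ < ε := by
      rw [← dist_eq_norm]
      exact hy.trans_le (min_le_right _ _)
    have hray : ∀ s ∈ Icc (0 : ℝ) 1, x₀ + s • (y - x₀) ∈ Metric.ball x₀ ρ := fun s hs =>
      (convex_ball x₀ ρ).add_smul_sub_mem (Metric.mem_ball_self hρ)
        (Metric.ball_subset_ball (min_le_left _ _) hy) hs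
    have hrayε : ∀ s ∈ Icc (0 : ℝ) 1, ‖x₀ + s • (y - x₀) - x₀‖ < ε := fun s hs => by
      rw [add_sub_cancel_left, norm_smul, Real.norm_of_nonneg hs.1]
      exact (mul_le_of_le_one_left (norm_nonneg _) hs.2).trans_lt hyε
    let q : ℝ → E × E × (E →L[ℝ] E) := fun s =>
      (x₀ + s • (y - x₀), f (x₀ + s • (y - x₀)), fderiv ℝ f (x₀ + s • (y - x₀)))
    have hq : ∀ s ∈ Icc (0 : ℝ) 1, q s ∈ Metric.ball j₀ (min ε₁ r₂) := by
      intro s hs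
      obtain ⟨h1, h2⟩ := hfε _ (hray s hs)
      have h3 := hrayε s hs
      have h4 : ‖f (x₀ + s • (y - x₀)) - x₀‖ < min ε₁ r₂ := by
        calc _ = ‖(f (x₀ + s • (y - x₀)) - (x₀ + s • (y - x₀))) + (x₀ + s • (y - x₀) - x₀)‖ := by
              congr 1; abel
          _ ≤ _ := norm_add_le _ _
          _ < ε + ε := add_lt_add h1 h3
          _ = _ := by rw [hε]; ring
      have h5 : ε < min ε₁ r₂ := by
        have : 0 < min ε₁ r₂ := lt_min hε₁ hr₂
        rw [hε]; linarith
      rw [Metric.mem_ball, Prod.dist_eq, Prod.dist_eq, dist_eq_norm, dist_eq_norm, dist_eq_norm]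
      exact max_lt (h3.trans h5) (max_lt h4 (h2.trans h5))
    have hfat : ∀ s ∈ Icc (0 : ℝ) 1, ContDiffAt ℝ ∞ f (x₀ + s • (y - x₀)) := fun s hs =>
      hf.contDiffOn.contDiffAt (Metric.isOpen_ball.mem_nhds (hray s hs))
    -- The 1-jet of `f` along the ray satisfies the ODE and stays near the stationary point, so
    -- uniqueness identifies it with the curve given by `σ`.
    let γ : ℝ → E × E × E × (E →L[ℝ] E) := fun s => (y - x₀, q s)
    have hγ : ∀ s ∈ Icc (0 : ℝ) 1, HasDerivAt γ (R (γ s)) s := by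
      intro s hs
      have e1 : HasDerivAt (fun s : ℝ => x₀ + s • (y - x₀)) (y - x₀) s := by
        simpa using ((hasDerivAt_id s).smul_const (y - x₀)).const_add x₀
      have e2 := ((hfat s hs).differentiableAt (by simp)).hasFDerivAt.comp_hasDerivAt s e1
      have e3 := (((hfat s hs).fderiv_right (m := ∞) (by simp)).differentiableAt
        (by simp)).hasFDerivAt.comp_hasDerivAt s e1
      have e4 := (hasDerivAt_const s (y - x₀)).prodMk (e1.prodMk (e2.prodMk e3))
      refine e4.congr_deriv ?_
      have h1 : q s ∈ Metric.ball j₀ r₂ := Metric.ball_subset_ball (min_le_right _ _) (hq s hs)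
      have h2 := hFeq f _ (hfat s hs) (hr₂O h1) (eventually_of_mem
        (Metric.isOpen_ball.mem_nhds (hray s hs)) ?_)
      · rw [h2]
        simp only [R, γ]
        rw [hFF' _ h1]
      · exact symEq_eq_zero hΩ hJ Metric.isOpen_ball hρΩ hf.contDiffOn hf.mapsTo hf.comm
    let c : C(unitInterval, E × E × E × (E →L[ℝ] E)) :=
      ⟨(Icc (0 : ℝ) 1).domRestrict γ, continuousOn_iff_continuous_domRestrict.1 fun s hs =>
        (hγ s hs).continuousAt.continuousWithinAt⟩
    have hc0 : c 0 = ψ (jet₁ f x₀, y) := by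
      change γ 0 = _
      simp [γ, q, ψ, jet₁]
    have hc := eq_primitive_of_hasDerivWithinAt (c := c)
      (g := (⟨R, hR.continuous⟩ : C(E × (E × E × (E →L[ℝ] E)), _)).comp c) fun s => by
        have h1 := (hγ s s.2).hasDerivWithinAt (s := Icc 0 1)
        refine h1.congr_of_mem (fun u hu => ?_) s.2
        rw [IccExtend_of_mem _ _ hu]
        rfl
    have hcball : c ∈ Metric.ball (ContinuousMap.const unitInterval ((0 : E), j₀)) ε₁ := by
      rw [Metric.mem_ball, ContinuousMap.dist_lt_iff hε₁]
      intro s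
      have h1 : dist (q s) j₀ < ε₁ := (hq s s.2).trans_le (min_le_left _ _)
      refine max_lt ?_ h1
      change dist (y - x₀) 0 < ε₁
      rw [dist_zero_right]
      refine hyε.trans_le ?_
      have : 0 < min ε₁ r₂ := lt_min hε₁ hr₂
      rw [hε]
      linarith [min_le_left ε₁ r₂]
    rw [hc0] at hc
    obtain ⟨h1, h2⟩ := huniq c hcball _ hc
    refine ⟨⟨h1, ?_⟩, ?_⟩
    · have h3 : dist (q 0) j₀ < ε₁ :=
        (hq 0 (left_mem_Icc.2 zero_le_one)).trans_le (min_le_left _ _)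
      have h4 : dist (q 0).2 j₀.2 < ε₁ := (le_max_right _ _).trans_lt h3
      change dist (jet₁ f x₀) (x₀, ContinuousLinearMap.id ℝ E) < ε₁
      simpa [q, jet₁] using h4
    · simp only [← h2, hev]
      change f y = (γ 1).2.2.1
      simp [γ, q]

end Rigidity

/-! ### Rigidity of symmetries near the identity. -/

section Rigidity

variable {E : Type} [NormedAddCommGroup E] [NormedSpace ℝ E]
variable {J : E → E →L[ℝ] E} {Ω : Set E} {x₀ : E}

/-- Symmetries near the identity are determined by the projection of their first jet along a
complement of the first jets of infinitesimal symmetries. -/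
theorem exists_rigidity [FiniteDimensional ℝ E] (hΩ : IsOpen Ω) (hJ : ContDiffOn ℝ ∞ J Ω)
    (hsq : ∀ y ∈ Ω, ∀ v, J y (J y v) = -v) (hx₀ : x₀ ∈ Ω)
    (hspan : Submodule.span ℝ {w | ∃ ξ η, nij J x₀ ξ η = w} = ⊤)
    {T : Type} [NormedAddCommGroup T] [NormedSpace ℝ T] (P : E × (E →L[ℝ] E) →L[ℝ] T)
    (hP : ∀ (X : E → E) (V : Set E), IsOpen V → x₀ ∈ V → V ⊆ Ω → ContDiffOn ℝ ∞ X V →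
      (∀ y ∈ V, infDefect J X y = 0) → P (jet₁ X x₀) = 0 → jet₁ X x₀ = 0) :
    ∀ ρ > 0, ∃ δ > 0, ∀ f g, IsSymOn J Ω f (Metric.ball x₀ ρ) → IsSymOn J Ω g (Metric.ball x₀ ρ) →
      CloseToId δ f (Metric.ball x₀ ρ) → CloseToId δ g (Metric.ball x₀ ρ) →
      P (jet₁ f x₀) = P (jet₁ g x₀) → f =ᶠ[𝓝 x₀] g := by
  obtain ⟨φ, W, ε, hε, hW, hφ, hφjet, hφext⟩ := exists_jet_extension hΩ hJ hsq hx₀ hspan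
  intro ρ₀ hρ₀
  obtain ⟨ρ₁, hρ₁, hρ₁Ω⟩ := Metric.isOpen_iff.1 hΩ x₀ hx₀
  -- shrink the ball
  obtain ⟨ρ, hρ, hρ0, hρΩ⟩ : ∃ ρ > 0, ρ ≤ ρ₀ ∧ Metric.ball x₀ ρ ⊆ Ω :=
    ⟨min ρ₀ ρ₁, lt_min hρ₀ hρ₁, min_le_left _ _,
      (Metric.ball_subset_ball (min_le_right _ _)).trans hρ₁Ω⟩
  let j₀ : E × (E →L[ℝ] E) := (x₀, ContinuousLinearMap.id ℝ E)
  let B := Metric.ball x₀ (min ρ ε)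
  have hB : IsOpen B := Metric.isOpen_ball
  have hx₀B : x₀ ∈ B := Metric.mem_ball_self (lt_min hρ hε)
  have hBρ : B ⊆ Metric.ball x₀ ρ := Metric.ball_subset_ball (min_le_left _ _)
  have hid : ∀ y ∈ B, (j₀, y) ∈ W ∧ φ (j₀, y) = y := by
    intro y hy
    have := hφext ρ hρ hρΩ _ (isSymOn_id hρΩ) (closeToId_id hε) y hy
    have h1 : jet₁ (fun y : E => y) x₀ = j₀ := by simp [jet₁, j₀, fderiv_fun_id]
    rw [h1] at this
    exact ⟨this.1, this.2.symm⟩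
  have hφat : ∀ p ∈ W, ContDiffAt ℝ ∞ φ p := fun p hp => hφ.contDiffAt (hW.mem_nhds hp)
  let inrE : E →L[ℝ] (E × (E →L[ℝ] E)) × E := ContinuousLinearMap.inr ℝ (E × (E →L[ℝ] E)) E
  let inlJ : (E × (E →L[ℝ] E)) →L[ℝ] (E × (E →L[ℝ] E)) × E :=
    ContinuousLinearMap.inl ℝ (E × (E →L[ℝ] E)) E
  have hsec : ∀ j y, (j, y) ∈ W → HasFDerivAt (fun y => φ (j, y)) (fderiv ℝ φ (j, y) ∘L inrE) y := by
    intro j y h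
    exact HasFDerivAt.comp (g := φ) y ((hφat _ h).differentiableAt (by simp)).hasFDerivAt
      ((hasFDerivAt_const j y).prodMk (hasFDerivAt_id y))
  -- The failure of the map φ(j, ·) to commute with `J` at `y`. It vanishes at the jets of
  -- symmetries close to the identity.
  let H : (E × (E →L[ℝ] E)) → E → E →L[ℝ] E := fun j y =>
    (fderiv ℝ φ (j, y) ∘L inrE) ∘L J y - J (φ (j, y)) ∘L (fderiv ℝ φ (j, y) ∘L inrE)
  -- The variation of φ(j, ·) at the identity jet in the direction `c`: the candidate infinitesimal
  -- symmetry with 1-jet `c`.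
  let X : E × (E →L[ℝ] E) → E → E := fun c y => fderiv ℝ φ (j₀, y) (c, 0)
  have hXdiff : ∀ c, ContDiffOn ℝ ∞ (X c) B := fun c y hy => by
    have h1 : ContDiffAt ℝ ∞ (fderiv ℝ φ) (j₀, y) := (hφat _ (hid y hy).1).fderiv_right (by simp)
    have h2 : ContDiffAt ℝ ∞ (fun y => fderiv ℝ φ (j₀, y)) y :=
      ContDiffAt.comp (g := fderiv ℝ φ) y h1 (contDiffAt_const.prodMk contDiffAt_id)
    exact (h2.clm_apply contDiffAt_const).contDiffWithinAt
  have hD2 : ∀ y ∈ B, HasFDerivAt (fderiv ℝ φ) (fderiv ℝ (fderiv ℝ φ) (j₀, y)) (j₀, y) :=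
    fun y hy => (((hφat _ (hid y hy).1).fderiv_right (m := ∞) (by simp)).differentiableAt
      (by simp)).hasFDerivAt
  have hXd : ∀ c, ∀ y ∈ B, ∀ v, fderiv ℝ (X c) y v = fderiv ℝ (fderiv ℝ φ) (j₀, y) (c, 0) (0, v) := by
    intro c y hy v
    have h1 : HasFDerivAt (fun y => fderiv ℝ φ (j₀, y)) _ y := HasFDerivAt.comp (g := fderiv ℝ φ) y
      (hD2 y hy) ((hasFDerivAt_const j₀ y).prodMk (hasFDerivAt_id y))
    have h2 := h1.clm_apply (hasFDerivAt_const ((c, 0) : (E × (E →L[ℝ] E)) × E) y)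
    rw [h2.fderiv, fderiv_fderiv_swap (hφat _ (hid y hy).1)]
    simp
  -- The linearization of `H · y` at the identity jet is the infinitesimal defect of `X c` at `y`.
  -- This uses symmetry of the mixed derivatives of φ and φ(j₀, y) = y.
  have hHd : ∀ y ∈ B, ∃ L : (E × (E →L[ℝ] E)) →L[ℝ] (E →L[ℝ] E),
      HasStrictFDerivAt (fun j => H j y) L j₀ ∧ ∀ c, L c = infDefect J (X c) y := by
    intro y hy
    have hy' := hid y hy
    have hι : ContDiffAt ℝ ∞ (fun j : E × (E →L[ℝ] E) => (j, y)) j₀ :=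
      contDiffAt_id.prodMk contDiffAt_const
    have hι' : HasFDerivAt (fun j : E × (E →L[ℝ] E) => (j, y)) inlJ j₀ :=
      (hasFDerivAt_id j₀).prodMk (hasFDerivAt_const y j₀)
    have h1 : ContDiffAt ℝ ∞ (fun j => fderiv ℝ φ (j, y)) j₀ :=
      ContDiffAt.comp (g := fderiv ℝ φ) j₀ ((hφat _ hy'.1).fderiv_right (by simp)) hι
    have h2 : ContDiffAt ℝ ∞ (fun j => φ (j, y)) j₀ :=
      ContDiffAt.comp (g := φ) j₀ (hφat _ hy'.1) hι
    have hJy : ContDiffAt ℝ ∞ J (φ (j₀, y)) := by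
      rw [hy'.2]
      exact hJ.contDiffAt (hΩ.mem_nhds (hρΩ (hBρ hy)))
    have h3 : ContDiffAt ℝ ∞ (fun j => H j y) j₀ :=
      ((h1.clm_comp contDiffAt_const).clm_comp contDiffAt_const).sub
        ((ContDiffAt.comp (g := J) (f := fun j => φ (j, y)) j₀ hJy h2).clm_comp
          (h1.clm_comp contDiffAt_const))
    refine ⟨_, h3.hasStrictFDerivAt (by simp), fun c => ?_⟩
    have e1 : HasFDerivAt (fun j => fderiv ℝ φ (j, y)) _ j₀ :=
      HasFDerivAt.comp (g := fderiv ℝ φ) j₀ (hD2 y hy) hι'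
    have e2 : HasFDerivAt (fun j => φ (j, y)) _ j₀ :=
      HasFDerivAt.comp (g := φ) j₀ ((hφat _ hy'.1).differentiableAt (by simp)).hasFDerivAt hι'
    have e3 : HasFDerivAt (fun j => J (φ (j, y))) _ j₀ :=
      HasFDerivAt.comp (g := J) j₀ (hJy.differentiableAt (by simp)).hasFDerivAt e2
    have e4 := e1.clm_comp (hasFDerivAt_const inrE j₀)
    have e5 : HasFDerivAt (fun j => H j y) _ j₀ :=
      (e4.clm_comp (hasFDerivAt_const (J y) j₀)).sub (e3.clm_comp e4)
    have hid' : ∀ v, fderiv ℝ φ (j₀, y) (0, v) = v := fun v => by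
      have h4 := hsec j₀ y hy'.1
      have h5 : (fun y => φ (j₀, y)) =ᶠ[𝓝 y] fun y => y :=
        eventually_of_mem (hB.mem_nhds hy) fun z hz => (hid z hz).2
      have h6 := (h4.congr_of_eventuallyEq h5.symm).unique (hasFDerivAt_id y)
      exact congrArg (fun A : E →L[ℝ] E => A v) h6
    rw [e5.fderiv]
    ext v
    simp only [infDefect, hXd c y hy, ContinuousLinearMap.comp_apply, sub_apply]
    simp [inrE, inlJ, hid', hy'.2, X]
    abel
  have hXjet : ∀ c, jet₁ (X c) x₀ = c := by
    intro c
    have hx₀W := (hid x₀ hx₀B).1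
    have hι' : HasFDerivAt (fun j : E × (E →L[ℝ] E) => (j, x₀)) inlJ j₀ :=
      (hasFDerivAt_id j₀).prodMk (hasFDerivAt_const x₀ j₀)
    have hev : ∀ᶠ j in 𝓝 j₀, (j, x₀) ∈ W := hι'.continuousAt.eventually_mem (hW.mem_nhds hx₀W)
    refine Prod.ext ?_ ?_
    · have e1 : HasFDerivAt (fun j => φ (j, x₀)) (fderiv ℝ φ (j₀, x₀) ∘L inlJ) j₀ :=
        HasFDerivAt.comp (g := φ) j₀ ((hφat _ hx₀W).differentiableAt (by simp)).hasFDerivAt hι'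
      have e2 := (e1.congr_of_eventuallyEq (hev.mono fun j hj => (hφjet j hj).1.symm)).unique
        (ContinuousLinearMap.fst ℝ E (E →L[ℝ] E)).hasFDerivAt
      exact congrArg (fun A : (E × (E →L[ℝ] E)) →L[ℝ] E => A c) e2
    · ext v
      have e1 : HasFDerivAt (fun j => fderiv ℝ φ (j, x₀)) (fderiv ℝ (fderiv ℝ φ) (j₀, x₀) ∘L inlJ)
          j₀ := HasFDerivAt.comp (g := fderiv ℝ φ) j₀ (hD2 x₀ hx₀B) hι'
      have e2 := e1.clm_apply (hasFDerivAt_const ((0, v) : (E × (E →L[ℝ] E)) × E) j₀)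
      have e3 : HasFDerivAt (fun j : E × (E →L[ℝ] E) => j.2 v) _ j₀ :=
        (ContinuousLinearMap.snd ℝ E (E →L[ℝ] E)).hasFDerivAt.clm_apply (hasFDerivAt_const v j₀)
      have e4 := (e2.congr_of_eventuallyEq (hev.mono fun j hj => ((hφjet j hj).2 v).symm)).unique e3
      have e5 := congrArg (fun A : (E × (E →L[ℝ] E)) →L[ℝ] E => A c) e4
      change fderiv ℝ (X c) x₀ v = c.2 v
      rw [hXd c x₀ hx₀B]
      simpa [inlJ] using e5
  choose! L hL hLX using hHd
  -- Infinitely many linear conditions on the finite dimensional space of jets, one for each `y`,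
  -- reduce to finitely many.
  obtain ⟨s, hs⟩ := exists_finset_forall_eq_zero
    (fun y : B => ((P.prod (L y) : E × (E →L[ℝ] E) →L[ℝ] T × (E →L[ℝ] E)) :
      E × (E →L[ℝ] E) →ₗ[ℝ] T × (E →L[ℝ] E)))
  have hstrict : HasStrictFDerivAt (fun j => fun y : s => (P j, H j (y : B)))
      (ContinuousLinearMap.pi fun y : s => P.prod (L (y : B))) j₀ :=
    hasStrictFDerivAt_pi.2 fun y => P.hasStrictFDerivAt.prodMk (hL _ (y : B).2)
  -- For `c` in the kernel, `X c` has zero defect throughout `B`, so it is an infinitesimal symmetry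
  -- with P of its jet zero; by `hP` its jet, which is `c`, is zero.
  obtain ⟨r, hr, hinj⟩ := exists_injOn_of_hasStrictFDerivAt hstrict fun c hc => by
    have h1 := hs c fun y hy => congrFun hc ⟨y, hy⟩
    have h2 : ∀ y ∈ B, P c = 0 ∧ L y c = 0 := fun y hy => Prod.mk_eq_zero.1 (h1 ⟨y, hy⟩)
    rw [← hXjet c]
    refine hP (X c) B hB hx₀B (hBρ.trans hρΩ) (hXdiff c) (fun y hy => ?_) ?_
    · rw [← hLX y hy]
      exact (h2 y hy).2
    · rw [hXjet]
      exact (h2 x₀ hx₀B).1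
  have key : ∀ f, IsSymOn J Ω f (Metric.ball x₀ ρ₀) → CloseToId (min ε r) f (Metric.ball x₀ ρ₀) →
      jet₁ f x₀ ∈ Metric.ball j₀ r ∧ ∀ y ∈ B, f y = φ (jet₁ f x₀, y) ∧ H (jet₁ f x₀) y = 0 := by
    intro f hf hfc
    have hsub := Metric.ball_subset_ball (x := x₀) hρ0
    have h1 := hφext ρ hρ hρΩ f (hf.mono hsub) (hfc.mono hsub (min_le_left _ _))
    refine ⟨?_, fun y hy => ⟨(h1 y hy).2, ?_⟩⟩
    · obtain ⟨h2, h3⟩ := hfc x₀ (Metric.mem_ball_self hρ₀)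
      rw [Metric.mem_ball, Prod.dist_eq, dist_eq_norm, dist_eq_norm]
      exact max_lt (h2.trans_le (min_le_right _ _)) (h3.trans_le (min_le_right _ _))
    · have h2 := ((hsec _ y (h1 y hy).1).congr_of_eventuallyEq (eventually_of_mem (hB.mem_nhds hy)
        fun z hz => (h1 z hz).2)).fderiv
      simp only [H]
      rw [← h2, ← (h1 y hy).2]
      exact sub_eq_zero.2 (hf.comm y (hsub (hBρ hy)))
  refine ⟨min ε r, lt_min hε hr, fun f g hf hg hfc hgc hfg => ?_⟩
  obtain ⟨hf1, hf2⟩ := key f hf hfc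
  obtain ⟨hg1, hg2⟩ := key g hg hgc
  have hj : jet₁ f x₀ = jet₁ g x₀ := hinj hf1 hg1 (funext fun y => by
    simp only [hfg, (hf2 _ (y : B).2).2, (hg2 _ (y : B).2).2])
  filter_upwards [hB.mem_nhds hx₀B] with y hy
  rw [(hf2 y hy).1, hj, ← (hg2 y hy).1]

end Rigidity

/-! ### First jets of infinitesimal symmetries -/

section InfJets

variable {E : Type} [NormedAddCommGroup E] [NormedSpace ℝ E]

theorem infDefect_add {J : E → E →L[ℝ] E} {X Y : E → E} {y : E} (hX : DifferentiableAt ℝ X y)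
    (hY : DifferentiableAt ℝ Y y) :
    infDefect J (fun y => X y + Y y) y = infDefect J X y + infDefect J Y y := by
  ext v
  simp [infDefect, fderiv_fun_add hX hY]
  abel

theorem infDefect_smul {J : E → E →L[ℝ] E} {X : E → E} {y : E} (hX : DifferentiableAt ℝ X y)
    (c : ℝ) : infDefect J (fun y => c • X y) y = c • infDefect J X y := by
  ext v
  simp [infDefect, fderiv_fun_const_smul hX, smul_sub]

theorem infDefect_congr {J : E → E →L[ℝ] E} {X Y : E → E} {y : E} (h : X =ᶠ[𝓝 y] Y) :
    infDefect J X y = infDefect J Y y := by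
  simp [infDefect, h.fderiv_eq, h.self_of_nhds]

/-- The first jets at `x₀` of the infinitesimal symmetries of `J` near `x₀`. -/
def infJets (J : E → E →L[ℝ] E) (x₀ : E) : Submodule ℝ (E × (E →L[ℝ] E)) where
  carrier := {j | ∃ (X : E → E) (V : Set E), IsOpen V ∧ x₀ ∈ V ∧ ContDiffOn ℝ ∞ X V ∧
    (∀ y ∈ V, infDefect J X y = 0) ∧ jet₁ X x₀ = j}
  zero_mem' := ⟨fun _ => 0, univ, isOpen_univ, mem_univ _, contDiffOn_const, fun y _ => by
    ext v
    simp [infDefect], by simp [jet₁]⟩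
  add_mem' := by
    rintro _ _ ⟨X, V, hV, hx, hX, h, rfl⟩ ⟨X', V', hV', hx', hX', h', rfl⟩
    have hd : ∀ y ∈ V, DifferentiableAt ℝ X y := fun y hy =>
      (hX.contDiffAt (hV.mem_nhds hy)).differentiableAt (by simp)
    have hd' : ∀ y ∈ V', DifferentiableAt ℝ X' y := fun y hy =>
      (hX'.contDiffAt (hV'.mem_nhds hy)).differentiableAt (by simp)
    refine ⟨fun y => X y + X' y, V ∩ V', hV.inter hV', ⟨hx, hx'⟩, (hX.mono inter_subset_left).add (hX'.mono inter_subset_right), fun y hy => ?_, ?_⟩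
    · rw [infDefect_add (hd y hy.1) (hd' y hy.2), h y hy.1, h' y hy.2, add_zero]
    · simp [jet₁, fderiv_fun_add (hd x₀ hx) (hd' x₀ hx')]
  smul_mem' := by
    rintro c _ ⟨X, V, hV, hx, hX, h, rfl⟩
    have hd : ∀ y ∈ V, DifferentiableAt ℝ X y := fun y hy =>
      (hX.contDiffAt (hV.mem_nhds hy)).differentiableAt (by simp)
    refine ⟨fun y => c • X y, V, hV, hx, contDiffOn_const.smul hX, fun y hy => ?_, ?_⟩
    · rw [infDefect_smul (hd y hy), h y hy, smul_zero]
    · simp [jet₁, fderiv_fun_const_smul (hd x₀ hx)]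

/-- Jets of infinitesimal symmetries vanishing at `x₀` solve the symbol equations, so
`finrank_jets_lt` applies. N is nonzero because its values span a space of positive dimension. -/
theorem finrank_infJets_lt {J : E → E →L[ℝ] E} {Ω : Set E} {x₀ : E} (hΩ : IsOpen Ω)
    (hJ : ContDiffOn ℝ ∞ J Ω) (hsq : ∀ y ∈ Ω, ∀ v, J y (J y v) = -v) (hx₀ : x₀ ∈ Ω)
    (hspan : Submodule.span ℝ {w | ∃ ξ η, nij J x₀ ξ η = w} = ⊤) [FiniteDimensional ℝ E] {n : ℕ}
    (hn : Module.finrank ℝ E = 2 * n) (hn0 : 0 < n) :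
    Module.finrank ℝ (infJets J x₀) < 2 * (n ^ 2 + n) := by
  have hN : nij J x₀ ≠ 0 := by
    intro h0
    have h1 : Submodule.span ℝ {w | ∃ ξ η, nij J x₀ ξ η = w} ≤ ⊥ := by
      rw [Submodule.span_le]
      rintro _ ⟨ξ, η, rfl⟩
      simp [h0]
    rw [hspan] at h1
    have h2 := Submodule.finrank_mono h1
    rw [finrank_top, finrank_bot] at h2
    omega
  have key : ∀ A, (0, A) ∈ infJets J x₀ →
      fderiv ℝ (symEq J) (x₀, x₀, ContinuousLinearMap.id ℝ E) (0, 0, A) = 0 := by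
    rintro A ⟨X, V, hV, hx, hX, h, hA⟩
    have h1 := fderiv_symEq_eq_zero hΩ hJ (hV.inter hΩ) inter_subset_right
      (hX.mono inter_subset_left) (fun y hy => h y hy.1) x₀ ⟨hx, hx₀⟩
    obtain ⟨h2, h3⟩ := Prod.mk_inj.1 hA
    rwa [h2, h3] at h1
  refine finrank_jets_lt (hsq x₀ hx₀) hn hN _ (fun A hA v => ?_) (fun A hA ξ η => ?_)
  · have h1 := congrArg (fun B : (E →L[ℝ] E) × (E →L[ℝ] E →L[ℝ] E) => B.1 v) (key A hA)
    simp only [fderiv_symEq_fst hΩ hJ hx₀] at h1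
    simp at h1
    exact sub_eq_zero.1 h1
  · have h1 := congrArg (fun B : (E →L[ℝ] E) × (E →L[ℝ] E →L[ℝ] E) => B.2 ξ η) (key A hA)
    simp only [fderiv_symEq_snd hΩ hJ hx₀] at h1
    simp at h1
    rw [sub_sub] at h1
    exact sub_eq_zero.1 h1

/-- A linear family of fields realizing all jets of infinitesimal symmetries. -/
theorem exists_symmetry_frame [FiniteDimensional ℝ E] (J : E → E →L[ℝ] E) {Ω : Set E} {x₀ : E}
    (hΩ : IsOpen Ω) (hx₀ : x₀ ∈ Ω) {d : ℕ} (hd : Module.finrank ℝ (infJets J x₀) = d) :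
    ∃ (X : E → EuclideanSpace ℝ (Fin d) →L[ℝ] E) (P : E × (E →L[ℝ] E) →L[ℝ] EuclideanSpace ℝ (Fin d)),
      ∃ r > 0, Metric.ball x₀ r ⊆ Ω ∧ ContDiff ℝ ∞ X ∧
        (∀ t, ∀ y ∈ Metric.ball x₀ r, infDefect J (fun y => X y t) y = 0) ∧
        (∀ t, P (jet₁ (fun y => X y t) x₀) = t) ∧ ∀ j ∈ infJets J x₀, P j = 0 → j = 0 := by
  let b : Module.Basis (Fin d) ℝ (infJets J x₀) := Module.finBasisOfFinrankEq ℝ _ hd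
  have hb : ∀ i, ∃ (X : E → E), ∃ r > 0, Metric.ball x₀ r ⊆ Ω ∧ ContDiff ℝ ∞ X ∧
      (∀ y ∈ Metric.ball x₀ r, infDefect J X y = 0) ∧ jet₁ X x₀ = b i := by
    intro i
    obtain ⟨X, V, hV, hx, hX, h, hj⟩ := (b i).2
    obtain ⟨X', hX', r, hr, hrV, hXX'⟩ := exists_contDiff_eq_on_ball (hV.inter hΩ) ⟨hx, hx₀⟩
      (hX.mono inter_subset_left)
    have he : ∀ y ∈ Metric.ball x₀ r, X' =ᶠ[𝓝 y] X := fun y hy =>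
      eventually_of_mem (Metric.isOpen_ball.mem_nhds hy) hXX'
    refine ⟨X', r, hr, hrV.trans inter_subset_right, hX', fun y hy => ?_, ?_⟩
    · rw [infDefect_congr (he y hy), h y (hrV hy).1]
    · rw [← hj]
      have := he x₀ (Metric.mem_ball_self hr)
      simp [jet₁, this.fderiv_eq, this.self_of_nhds]
  choose X r hr hrΩ hX hinf hjet using hb
  let Y : E → EuclideanSpace ℝ (Fin d) →L[ℝ] E := fun y =>
    ∑ i, (EuclideanSpace.proj i : EuclideanSpace ℝ (Fin d) →L[ℝ] ℝ).smulRight (X i y)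
  have hYapply : ∀ t y, Y y t = ∑ i, t i • X i y := fun t y => by simp [Y]
  have hY : ContDiff ℝ ∞ Y := ContDiff.sum fun i _ =>
    ((ContinuousLinearMap.smulRightL ℝ (EuclideanSpace ℝ (Fin d)) E
      (EuclideanSpace.proj i)).contDiff).comp (hX i)
  have hdX : ∀ i y, DifferentiableAt ℝ (X i) y := fun i y => (hX i).differentiable (by simp) y
  have hYd : ∀ t y, fderiv ℝ (fun y => Y y t) y = ∑ i, t i • fderiv ℝ (X i) y := fun t y => by
    simp only [hYapply]
    exact (HasFDerivAt.fun_sum fun i _ => (hdX i y).hasFDerivAt.const_smul (t i)).fderiv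
  let ι : EuclideanSpace ℝ (Fin d) →ₗ[ℝ] E × (E →L[ℝ] E) :=
    (infJets J x₀).subtype ∘ₗ (Fintype.linearCombination ℝ b) ∘ₗ
      (EuclideanSpace.equiv (Fin d) ℝ : EuclideanSpace ℝ (Fin d) →ₗ[ℝ] (Fin d → ℝ))
  have hι : ∀ t, ι t = ∑ i, t i • (b i : E × (E →L[ℝ] E)) := fun t => by
    simp [ι, Fintype.linearCombination_apply]
  have hιinj : LinearMap.ker ι = ⊥ := by
    rw [LinearMap.ker_eq_bot']
    intro t ht
    have h1 : ∑ i, t i • b i = 0 := Subtype.ext (by simpa [hι] using ht)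
    ext i
    exact Fintype.linearIndependent_iff.1 b.linearIndependent _ h1 i
  -- `P` is prescribed only on the jets of infinitesimal symmetries; any linear extension, that is,
  -- any choice of complement, serves.
  obtain ⟨P, hP⟩ := ι.exists_leftInverse_of_injective hιinj
  have hYjet : ∀ t, jet₁ (fun y => Y y t) x₀ = ι t := fun t => by
    rw [hι]
    have h1 : ∀ i, (b i : E × (E →L[ℝ] E)) = (X i x₀, fderiv ℝ (X i) x₀) := fun i => (hjet i).symm
    simp only [h1, jet₁, hYapply t x₀, hYd]
    ext1 <;> simp [Prod.fst_sum, Prod.snd_sum]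
  obtain ⟨r', hr', hr'b⟩ : ∃ r' > 0, Metric.ball x₀ r' ⊆ Ω ∧ ∀ i, r' ≤ r i := by
    obtain ⟨r₀, hr₀, hr₀Ω⟩ := Metric.isOpen_iff.1 hΩ x₀ hx₀
    have h1 : ∀ᶠ q in 𝓝[>] (0 : ℝ), ∀ i, q ≤ r i :=
      eventually_all.2 fun i => mem_nhdsWithin_of_mem_nhds (Iic_mem_nhds (hr i))
    have h2 : ∀ᶠ q in 𝓝[>] (0 : ℝ), q ≤ r₀ := mem_nhdsWithin_of_mem_nhds (Iic_mem_nhds hr₀)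
    obtain ⟨q, ⟨h3, h4⟩, h5⟩ := ((h1.and h2).and self_mem_nhdsWithin).exists
    exact ⟨q, h5, (Metric.ball_subset_ball h4).trans hr₀Ω, h3⟩
  refine ⟨Y, P.toContinuousLinearMap, r', hr', hr'b.1, hY, fun t y hy => ?_, fun t => ?_,
    fun j hj hPj => ?_⟩
  · have h1 : ∀ i, infDefect J (X i) y = 0 := fun i =>
      hinf i y (Metric.ball_subset_ball (hr'b.2 i) hy)
    ext v
    have h2 : ∀ i, fderiv ℝ (X i) y (J y v) - J y (fderiv ℝ (X i) y v) - fderiv ℝ J y (X i y) v = 0 :=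
      fun i => congrArg (fun A : E →L[ℝ] E => A v) (h1 i)
    have h3 : ∑ i, t i • (fderiv ℝ (X i) y (J y v) - J y (fderiv ℝ (X i) y v)
        - fderiv ℝ J y (X i y) v) = 0 := Finset.sum_eq_zero fun i _ => by rw [h2, smul_zero]
    simp only [infDefect, hYd, hYapply t y]
    simp only [smul_sub, Finset.sum_sub_distrib] at h3
    simpa [map_sum, sum_apply] using h3
  · rw [hYjet]
    exact LinearMap.congr_fun hP t
  · obtain ⟨t, rfl⟩ : ∃ t, ι t = j := by
      refine ⟨(EuclideanSpace.equiv (Fin d) ℝ).symm (b.equivFun ⟨j, hj⟩), ?_⟩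
      have h1 := b.sum_equivFun ⟨j, hj⟩
      rw [hι]
      refine Eq.trans ?_ (congrArg Subtype.val h1)
      rw [Submodule.coe_sum]
      rfl
    have h1 : P (ι t) = t := LinearMap.congr_fun hP t
    have h2 : t = 0 := h1.symm.trans hPj
    rw [h2, map_zero]

/-! ### Maps close to the identity -/

/-- On the convex ball f − id is Lipschitz with constant 1/2, so `f` is a homeomorphism of the whole
ball onto an open set. The inverse function theorem would not give this prescribed domain, which
must be the same for all members of a family. -/
theorem exists_openPartialHomeomorph_of_closeToId [FiniteDimensional ℝ E] {f : E → E} {x₀ : E} {r : ℝ}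
    (hf : ContDiffOn ℝ ∞ f (Metric.ball x₀ r)) (hc : CloseToId (1 / 2) f (Metric.ball x₀ r)) :
    ∃ e : OpenPartialHomeomorph E E, e.source = Metric.ball x₀ r ∧ (e : E → E) = f ∧
      ContDiffOn ℝ ∞ e.symm e.target := by
  have : CompleteSpace E := FiniteDimensional.complete ℝ E
  have hd : ∀ y ∈ Metric.ball x₀ r, ContDiffAt ℝ ∞ f y := fun y hy =>
    hf.contDiffAt (Metric.isOpen_ball.mem_nhds hy)
  have h1 : ApproximatesLinearOn f ((ContinuousLinearEquiv.refl ℝ E : E ≃L[ℝ] E) : E →L[ℝ] E)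
      (Metric.ball x₀ r) (1 / 2) := by
    rw [ApproximatesLinearOn.approximatesLinearOn_iff_lipschitzOnWith]
    refine (convex_ball x₀ r).lipschitzOnWith_of_nnnorm_hasFDerivWithin_le (𝕜 := ℝ)
      (f' := fun y => fderiv ℝ f y - ContinuousLinearMap.id ℝ E) (fun y hy => ?_) (fun y hy => ?_)
    · exact (((hd y hy).differentiableAt (by simp)).hasFDerivAt.sub
        (ContinuousLinearMap.id ℝ E).hasFDerivAt).hasFDerivWithinAt
    · have := (hc y hy).2.le
      rw [← NNReal.coe_le_coe]
      simpa using this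
  have h2 : Subsingleton E ∨ (1 / 2 : NNReal) < ‖((ContinuousLinearEquiv.refl ℝ E).symm : E →L[ℝ] E)‖₊⁻¹ := by
    rcases subsingleton_or_nontrivial E with h | h
    · exact Or.inl h
    · right
      have : ‖((ContinuousLinearEquiv.refl ℝ E).symm : E →L[ℝ] E)‖₊ = 1 := by
        rw [← NNReal.coe_inj]
        simp
      rw [this, ← NNReal.coe_lt_coe]
      norm_num
  refine ⟨h1.toOpenPartialHomeomorph f _ h2 Metric.isOpen_ball, rfl, rfl, fun z hz => ?_⟩
  set e := h1.toOpenPartialHomeomorph f _ h2 Metric.isOpen_ball with he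
  have hy : e.symm z ∈ Metric.ball x₀ r := e.map_target hz
  have hinj : Function.Injective (fderiv ℝ f (e.symm z) : E →ₗ[ℝ] E) := by
    rw [← LinearMap.ker_eq_bot, LinearMap.ker_eq_bot']
    intro v hv
    have h3 := (fderiv ℝ f (e.symm z) - ContinuousLinearMap.id ℝ E).le_of_opNorm_le
      (hc _ hy).2.le v
    have hv' : fderiv ℝ f (e.symm z) v = 0 := hv
    simp only [sub_apply, hv', ContinuousLinearMap.id_apply, zero_sub, norm_neg] at h3
    exact norm_eq_zero.1 (le_antisymm (by linarith) (norm_nonneg v))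
  let A : E ≃L[ℝ] E := (LinearEquiv.ofInjectiveEndo _ hinj).toContinuousLinearEquiv
  have hA : HasFDerivAt f (A : E →L[ℝ] E) (e.symm z) := by
    have h3 : (A : E →L[ℝ] E) = fderiv ℝ f (e.symm z) := by
      ext v
      rfl
    rw [h3]
    exact ((hd _ hy).differentiableAt (by simp)).hasFDerivAt
  exact (e.contDiffAt_symm hz hA (hd _ hy)).contDiffWithinAt

/-- A smooth family of maps starting at the identity is close to the identity. -/
theorem eventually_closeToId [FiniteDimensional ℝ E] {S : Type} [NormedAddCommGroup S]
    [NormedSpace ℝ S] {Ψ : S × E → E} {N : Set S} {x₀ : E} {r ρ δ : ℝ} (hN : IsOpen N)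
    (h0 : (0 : S) ∈ N)
    (hΨ : ContDiffOn ℝ ∞ Ψ (N ×ˢ Metric.ball x₀ r)) (hid : ∀ y ∈ Metric.ball x₀ r, Ψ (0, y) = y)
    (hρ : ρ < r) (hδ : 0 < δ) :
    ∀ᶠ t in 𝓝 (0 : S), CloseToId δ (fun y => Ψ (t, y)) (Metric.closedBall x₀ ρ) := by
  have : ProperSpace E := FiniteDimensional.proper ℝ E
  refine (isCompact_closedBall x₀ ρ).eventually_forall_of_forall_eventually fun y hy => ?_
  have hyr : y ∈ Metric.ball x₀ r := Metric.closedBall_subset_ball hρ hy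
  have hO : IsOpen (N ×ˢ Metric.ball x₀ r) := hN.prod Metric.isOpen_ball
  have hd : ∀ p ∈ N ×ˢ Metric.ball x₀ r, HasFDerivAt (fun y => Ψ (p.1, y))
      (fderiv ℝ Ψ p ∘L ContinuousLinearMap.inr ℝ S E) p.2 := fun p hp =>
    HasFDerivAt.comp (g := Ψ) p.2 ((hΨ.contDiffAt (hO.mem_nhds hp)).differentiableAt
      (by simp)).hasFDerivAt ((hasFDerivAt_const p.1 p.2).prodMk (hasFDerivAt_id p.2))
  have hp : ((0 : S), y) ∈ N ×ˢ Metric.ball x₀ r := ⟨h0, hyr⟩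
  have h1 : fderiv ℝ Ψ (0, y) ∘L ContinuousLinearMap.inr ℝ S E = ContinuousLinearMap.id ℝ E :=
    (hd _ hp).unique ((hasFDerivAt_id y).congr_of_eventuallyEq
      (eventually_of_mem (Metric.isOpen_ball.mem_nhds hyr) hid))
  have hΨat := hΨ.contDiffAt (hO.mem_nhds hp)
  have c1 : ContinuousAt (fun p : S × E => ‖Ψ p - p.2‖) (0, y) :=
    (hΨat.continuousAt.sub continuousAt_snd).norm
  have c2 : ContinuousAt (fun p : S × E =>
      ‖fderiv ℝ Ψ p ∘L ContinuousLinearMap.inr ℝ S E - ContinuousLinearMap.id ℝ E‖) (0, y) :=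
    ((((hΨat.fderiv_right (m := ∞) (by simp)).clm_comp contDiffAt_const).sub
      contDiffAt_const).continuousAt).norm
  have e1 := c1.eventually_lt (continuousAt_const (y := δ)) (by simpa [hid y hyr] using hδ)
  have e2 := c2.eventually_lt (continuousAt_const (y := δ)) (by simpa [h1] using hδ)
  filter_upwards [e1, e2, hO.mem_nhds hp] with p h2 h3 h4
  refine ⟨h2, ?_⟩
  rw [(hd p h4).fderiv]
  exact h3

end InfJets

/-! ### The local Lie group of symmetries in a chart -/

section LocalLie

variable {E : Type} [NormedAddCommGroup E] [NormedSpace ℝ E] {J : E → E →L[ℝ] E} {Ω : Set E}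

theorem IsSymOn.comp {f g : E → E} {V V' : Set E} (hg : IsSymOn J Ω g V') (hf : IsSymOn J Ω f V)
    (hV : IsOpen V) (hV' : IsOpen V') (h : MapsTo f V V') : IsSymOn J Ω (fun y => g (f y)) V := by
  refine ⟨hg.contDiffOn.comp hf.contDiffOn h, fun y hy => hg.mapsTo (h hy), fun y hy => ?_⟩
  have h1 : HasFDerivAt f _ y :=
    ((hf.contDiffOn.contDiffAt (hV.mem_nhds hy)).differentiableAt (by simp)).hasFDerivAt
  have h2 : HasFDerivAt g _ (f y) :=
    ((hg.contDiffOn.contDiffAt (hV'.mem_nhds (h hy))).differentiableAt (by simp)).hasFDerivAt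
  have h3 : HasFDerivAt (fun y => g (f y)) _ y := h2.comp y h1
  rw [h3.fderiv, ContinuousLinearMap.comp_assoc, hf.comm y hy, ← ContinuousLinearMap.comp_assoc,
    hg.comm _ (h hy), ContinuousLinearMap.comp_assoc]

theorem jet₁_congr {f g : E → E} {x : E} (h : f =ᶠ[𝓝 x] g) : jet₁ f x = jet₁ g x := by
  simp [jet₁, h.fderiv_eq, h.self_of_nhds]

theorem jet₁_id (x : E) : jet₁ (fun y : E => y) x = (x, ContinuousLinearMap.id ℝ E) := by
  simp [jet₁, fderiv_fun_id]

variable {S : Type} [NormedAddCommGroup S] [NormedSpace ℝ S] {Ψ : S × E → E} {N : Set S} {x₀ : E}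
  {r : ℝ}

theorem hasFDerivAt_section (hN : IsOpen N) (hΨ : ContDiffOn ℝ ∞ Ψ (N ×ˢ Metric.ball x₀ r)) {t : S}
    (ht : t ∈ N) {y : E} (hy : y ∈ Metric.ball x₀ r) :
    HasFDerivAt (fun y => Ψ (t, y)) (fderiv ℝ Ψ (t, y) ∘L ContinuousLinearMap.inr ℝ S E) y :=
  HasFDerivAt.comp (g := Ψ) y ((hΨ.contDiffAt ((hN.prod Metric.isOpen_ball).mem_nhds
    ⟨ht, hy⟩)).differentiableAt (by simp)).hasFDerivAt
    ((hasFDerivAt_const t y).prodMk (hasFDerivAt_id y))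

theorem contDiffOn_jet₁ (hr : 0 < r) (hN : IsOpen N)
    (hΨ : ContDiffOn ℝ ∞ Ψ (N ×ˢ Metric.ball x₀ r)) :
    ContDiffOn ℝ ∞ (fun t => jet₁ (fun y => Ψ (t, y)) x₀) N := by
  have hx₀ : x₀ ∈ Metric.ball x₀ r := Metric.mem_ball_self hr
  have hO : IsOpen (N ×ˢ Metric.ball x₀ r) := hN.prod Metric.isOpen_ball
  have h1 : ContDiffOn ℝ ∞ (fun t : S => (t, x₀)) N := (contDiff_id.prodMk contDiff_const).contDiffOn
  have hm : MapsTo (fun t : S => (t, x₀)) N (N ×ˢ Metric.ball x₀ r) := fun t ht => ⟨ht, hx₀⟩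
  have h2 : ContDiffOn ℝ ∞ (fun t => (Ψ (t, x₀),
      fderiv ℝ Ψ (t, x₀) ∘L ContinuousLinearMap.inr ℝ S E)) N :=
    (hΨ.comp h1 hm).prodMk
      (((hΨ.fderiv_of_isOpen hO (m := ∞) (by simp)).comp h1 hm).clm_comp contDiffOn_const)
  refine h2.congr fun t ht => ?_
  rw [jet₁, (hasFDerivAt_section hN hΨ ht hx₀).fderiv]

/-- Symmetry of the mixed second derivatives of `Ψ`: the parameter derivative of the 1-jet is the
1-jet of the parameter derivative. -/
theorem hasFDerivAt_jet₁ (hr : 0 < r) (hN : IsOpen N)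
    (hΨ : ContDiffOn ℝ ∞ Ψ (N ×ˢ Metric.ball x₀ r)) {t : S} (ht : t ∈ N) (τ : S) :
    fderiv ℝ (fun t => jet₁ (fun y => Ψ (t, y)) x₀) t τ
      = jet₁ (fun y => fderiv ℝ Ψ (t, y) (τ, 0)) x₀ := by
  have hx₀ : x₀ ∈ Metric.ball x₀ r := Metric.mem_ball_self hr
  have hO : IsOpen (N ×ˢ Metric.ball x₀ r) := hN.prod Metric.isOpen_ball
  have hat : ContDiffAt ℝ ∞ Ψ (t, x₀) := hΨ.contDiffAt (hO.mem_nhds ⟨ht, hx₀⟩)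
  have hι : HasFDerivAt (fun t : S => (t, x₀)) (ContinuousLinearMap.inl ℝ S E) t :=
    (hasFDerivAt_id t).prodMk (hasFDerivAt_const x₀ t)
  have hι' : HasFDerivAt (fun y : E => (t, y)) (ContinuousLinearMap.inr ℝ S E) x₀ :=
    (hasFDerivAt_const t x₀).prodMk (hasFDerivAt_id x₀)
  have h2 : HasFDerivAt (fderiv ℝ Ψ) (fderiv ℝ (fderiv ℝ Ψ) (t, x₀)) (t, x₀) :=
    ((hat.fderiv_right (m := ∞) (by simp)).differentiableAt (by simp)).hasFDerivAt
  have e1 : HasFDerivAt (fun t => Ψ (t, x₀)) _ t :=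
    HasFDerivAt.comp (g := Ψ) t (hat.differentiableAt (by simp)).hasFDerivAt hι
  have e2 : HasFDerivAt (fun t => fderiv ℝ Ψ (t, x₀)) _ t :=
    HasFDerivAt.comp (g := fderiv ℝ Ψ) t h2 hι
  have e3 := e1.prodMk (e2.clm_comp (hasFDerivAt_const (ContinuousLinearMap.inr ℝ S E) t))
  have e4 := e3.congr_of_eventuallyEq (f₁ := fun t => jet₁ (fun y => Ψ (t, y)) x₀)
    (eventually_of_mem (hN.mem_nhds ht) fun s hs => by
      simp only [jet₁, (hasFDerivAt_section hN hΨ hs hx₀).fderiv])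
  have e5 : HasFDerivAt (fun y => fderiv ℝ Ψ (t, y)) _ x₀ :=
    HasFDerivAt.comp (g := fderiv ℝ Ψ) x₀ h2 hι'
  have e6 := e5.clm_apply (hasFDerivAt_const ((τ, 0) : S × E) x₀)
  rw [e4.fderiv, jet₁, e6.fderiv]
  refine Prod.ext ?_ ?_
  · simp
  · ext v
    simp [fderiv_fderiv_swap hat (0, v)]

/-- The map from t to the projected jet of Φ_t is a local diffeomorphism at 0. A symmetry `f` near
the identity therefore has the same projected jet as exactly one Φ_t, and rigidity makes their germs
equal. Applied to composites, this t defines the multiplication. -/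
theorem exists_local_lie [FiniteDimensional ℝ E] (hΩ : IsOpen Ω) (hJ : ContDiffOn ℝ ∞ J Ω)
    (hsq : ∀ y ∈ Ω, ∀ v, J y (J y v) = -v) (hx₀ : x₀ ∈ Ω)
    (hspan : Submodule.span ℝ {w | ∃ ξ η, nij J x₀ ξ η = w} = ⊤) {d : ℕ}
    (hd : Module.finrank ℝ (infJets J x₀) = d) :
    ∃ (Φ : EuclideanSpace ℝ (Fin d) × E → E) (B B₀ : Set (EuclideanSpace ℝ (Fin d)))
      (m : EuclideanSpace ℝ (Fin d) × EuclideanSpace ℝ (Fin d) → EuclideanSpace ℝ (Fin d)),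
      ∃ ρ > 0, Metric.ball x₀ ρ ⊆ Ω ∧ IsOpen B ∧ IsOpen B₀ ∧ 0 ∈ B₀ ∧ B₀ ⊆ B ∧
      ContDiffOn ℝ ∞ Φ (B ×ˢ Metric.ball x₀ ρ) ∧ (∀ y ∈ Metric.ball x₀ ρ, Φ (0, y) = y) ∧
      (∀ t ∈ B, IsSymOn J Ω (fun y => Φ (t, y)) (Metric.ball x₀ ρ) ∧
        ∃ e : OpenPartialHomeomorph E E, e.source = Metric.ball x₀ ρ ∧
          (e : E → E) = (fun y => Φ (t, y)) ∧ ContDiffOn ℝ ∞ e.symm e.target) ∧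
      (∀ s ∈ B, ∀ t ∈ B, (fun y => Φ (s, y)) =ᶠ[𝓝 x₀] (fun y => Φ (t, y)) → s = t) ∧
      ContDiffOn ℝ ∞ m (B₀ ×ˢ B₀) ∧
      (∀ s ∈ B₀, ∀ t ∈ B₀, m (s, t) ∈ B ∧ Φ (t, x₀) ∈ Metric.ball x₀ ρ ∧
        (fun y => Φ (s, Φ (t, y))) =ᶠ[𝓝 x₀] fun y => Φ (m (s, t), y)) ∧
      ∀ ρ' > 0, ∃ ε > 0, ∀ f, IsSymOn J Ω f (Metric.ball x₀ ρ') →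
        CloseToId ε f (Metric.ball x₀ ρ') → ∃ t ∈ B, f =ᶠ[𝓝 x₀] fun y => Φ (t, y) := by
  have : CompleteSpace E := FiniteDimensional.complete ℝ E
  obtain ⟨X, P, r₁, hr₁, hr₁Ω, hX, hinf, hPX, hPinj⟩ := exists_symmetry_frame J hΩ hx₀ hd
  obtain ⟨Φ, r, hr, hrr₁, hΦ, hΦsym, hΦ0⟩ := exists_flow hX hr₁ (hJ.mono hr₁Ω) hinf
  have hrig := exists_rigidity hΩ hJ hsq hx₀ hspan P fun X V hV hx _ hX h h0 =>
    hPinj _ ⟨X, V, hV, hx, hX, h, rfl⟩ h0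
  have hsymOn : ∀ t ∈ Metric.ball (0 : EuclideanSpace ℝ (Fin d)) r,
      IsSymOn J Ω (fun y => Φ (t, y)) (Metric.ball x₀ r) := fun t ht =>
    ⟨hΦ.comp (contDiff_const.prodMk contDiff_id).contDiffOn fun y hy => ⟨ht, hy⟩,
      fun y hy => hr₁Ω (hΦsym t ht y hy).1, fun y hy => (hΦsym t ht y hy).2⟩
  have hN : IsOpen (Metric.ball (0 : EuclideanSpace ℝ (Fin d)) r) := Metric.isOpen_ball
  have h0N : (0 : EuclideanSpace ℝ (Fin d)) ∈ Metric.ball (0 : EuclideanSpace ℝ (Fin d)) r :=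
    Metric.mem_ball_self hr
  let j₀ : E × (E →L[ℝ] E) := (x₀, ContinuousLinearMap.id ℝ E)
  -- the coordinates of a jet
  let κ : E × (E →L[ℝ] E) → EuclideanSpace ℝ (Fin d) := fun j => P (j - j₀)
  have hκ : ContDiff ℝ ∞ κ := P.contDiff.comp (contDiff_id.sub contDiff_const)
  have hκ0 : κ j₀ = 0 := by simp [κ]
  have hκP : ∀ j j', κ j = κ j' → P j = P j' := fun j j' h => by
    simpa [κ, map_sub] using h
  let τ : EuclideanSpace ℝ (Fin d) → EuclideanSpace ℝ (Fin d) :=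
    fun t => κ (jet₁ (fun y => Φ (t, y)) x₀)
  have hτ : ContDiffOn ℝ ∞ τ (Metric.ball 0 r) := hκ.comp_contDiffOn (contDiffOn_jet₁ hr hN hΦ)
  have hjet0 : jet₁ (fun y => Φ (0, y)) x₀ = j₀ := by
    exact (jet₁_congr (eventually_of_mem (Metric.ball_mem_nhds x₀ hr)
      fun y hy => (hΦ0 y hy).1)).trans (jet₁_id x₀)
  have hτ0 : τ 0 = 0 := by
    simp only [τ, hjet0, hκ0]
  -- The derivative of Φ_t at t = 0 in the direction t is the field X t, and `P` of its jet is t.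
  have hτ' : HasFDerivAt τ ((ContinuousLinearEquiv.refl ℝ (EuclideanSpace ℝ (Fin d)) :
      EuclideanSpace ℝ (Fin d) ≃L[ℝ] EuclideanSpace ℝ (Fin d)) :
      EuclideanSpace ℝ (Fin d) →L[ℝ] EuclideanSpace ℝ (Fin d)) 0 := by
    have h1 := (((contDiffOn_jet₁ hr hN hΦ).contDiffAt (hN.mem_nhds h0N)).differentiableAt
      (by simp)).hasFDerivAt
    have h2 : HasFDerivAt τ _ 0 := P.hasFDerivAt.comp 0 (h1.sub_const j₀)
    refine h2.congr_fderiv ?_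
    ext1 t
    rw [ContinuousLinearMap.comp_apply, hasFDerivAt_jet₁ hr hN hΦ h0N]
    have h3 : jet₁ (fun y => fderiv ℝ Φ (0, y) (t, 0)) x₀ = jet₁ (fun y => X y t) x₀ :=
      jet₁_congr (eventually_of_mem (Metric.ball_mem_nhds x₀ hr) fun y hy => (hΦ0 y hy).2 t)
    rw [h3, hPX]
    rfl
  obtain ⟨e, he, h0e, hesub, hesymm⟩ := exists_openPartialHomeomorph_contDiffOn_symm
    Metric.isOpen_ball h0N hτ hτ'
  have he0 : e 0 = 0 := by rw [he, hτ0]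
  have h0t : (0 : EuclideanSpace ℝ (Fin d)) ∈ e.target := he0 ▸ e.map_source h0e
  have hes0 : e.symm 0 = 0 := by
    conv_lhs => rw [← he0]
    exact e.left_inv h0e
  have hclose : ∀ δ > 0, ∀ᶠ t in 𝓝 (0 : EuclideanSpace ℝ (Fin d)),
      CloseToId δ (fun y => Φ (t, y)) (Metric.closedBall x₀ (r / 2)) := fun δ hδ =>
    eventually_closeToId hN h0N hΦ (fun y hy => (hΦ0 y hy).1) (by linarith) hδ
  -- The source of `e` makes t recoverable from the germ of Φ_t; closeness 1/2 makes Φ_t a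
  -- diffeomorphism of the ball of radius `r / 2` onto an open set.
  obtain ⟨B, hBsub, hBo, h0B⟩ := mem_nhds_iff.1
    (inter_mem (e.open_source.mem_nhds h0e) (hclose (1 / 2) (by norm_num)))
  have hBr : B ⊆ Metric.ball 0 r := fun t ht => hesub (hBsub ht).1
  have hbb : Metric.ball x₀ (r / 2) ⊆ Metric.ball x₀ r := Metric.ball_subset_ball (by linarith)
  -- The parameter of `f` is read off from its projected jet. By continuity it is near 0 when `f` is
  -- near the identity, so rigidity applies to `f` and the corresponding Φ_t on a common ball.
  have hexh : ∀ ρ' > 0, ∃ ε > 0, ∀ f, IsSymOn J Ω f (Metric.ball x₀ ρ') →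
      CloseToId ε f (Metric.ball x₀ ρ') → κ (jet₁ f x₀) ∈ e.target ∧
        e.symm (κ (jet₁ f x₀)) ∈ B ∧ f =ᶠ[𝓝 x₀] fun y => Φ (e.symm (κ (jet₁ f x₀)), y) := by
    intro ρ' hρ'
    obtain ⟨δ, hδ, hrig⟩ := hrig (min ρ' (r / 2)) (lt_min hρ' (by linarith))
    have c1 : ContinuousAt (fun j => e.symm (κ j)) j₀ := by
      refine ContinuousAt.comp (g := e.symm) ?_ hκ.continuous.continuousAt
      rw [hκ0]
      exact e.symm.continuousAt h0t
    have c2 : ∀ᶠ t in 𝓝 (e.symm (κ j₀)), t ∈ B ∧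
        CloseToId δ (fun y => Φ (t, y)) (Metric.closedBall x₀ (r / 2)) := by
      rw [hκ0, hes0]
      exact (hBo.eventually_mem h0B).and (hclose δ hδ)
    have c3 : ∀ᶠ j in 𝓝 j₀, κ j ∈ e.target :=
      hκ.continuous.continuousAt.eventually_mem (e.open_target.mem_nhds (by rw [hκ0]; exact h0t))
    obtain ⟨ε₁, hε₁, h1⟩ := Metric.eventually_nhds_iff_ball.1 (c3.and (c1.eventually c2))
    refine ⟨min δ ε₁, lt_min hδ hε₁, fun f hf hfc => ?_⟩
    have hj : jet₁ f x₀ ∈ Metric.ball j₀ ε₁ := by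
      obtain ⟨h2, h3⟩ := hfc x₀ (Metric.mem_ball_self hρ')
      rw [Metric.mem_ball, Prod.dist_eq, dist_eq_norm, dist_eq_norm]
      exact max_lt (h2.trans_le (min_le_right _ _)) (h3.trans_le (min_le_right _ _))
    obtain ⟨h2, h3, h4⟩ := h1 _ hj
    refine ⟨h2, h3, hrig f _ (hf.mono (Metric.ball_subset_ball (min_le_left _ _)))
      ((hsymOn _ (hBr h3)).mono ((Metric.ball_subset_ball (min_le_right _ _)).trans hbb))
      (hfc.mono (Metric.ball_subset_ball (min_le_left _ _)) (min_le_left _ _))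
      (h4.mono ((Metric.ball_subset_ball (min_le_right _ _)).trans Metric.ball_subset_closedBall)
        le_rfl) (hκP _ _ ?_)⟩
    have h5 := e.right_inv h2
    rw [he] at h5
    exact h5.symm
  -- composition
  obtain ⟨B₁, hB₁sub, hB₁o, h0B₁⟩ := mem_nhds_iff.1
    (inter_mem (hBo.mem_nhds h0B) (hclose (r / 4) (by linarith)))
  -- A displacement below `r / 4` maps the ball of radius `r / 4` into that of radius `r / 2`, where
  -- the outer map is available.
  have hmaps : ∀ t ∈ B₁, MapsTo (fun y => Φ (t, y)) (Metric.ball x₀ (r / 4))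
      (Metric.ball x₀ (r / 2)) := by
    intro t ht y hy
    have h1 := ((hB₁sub ht).2 y (Metric.ball_subset_closedBall
      (Metric.ball_subset_ball (by linarith) hy))).1
    rw [Metric.mem_ball] at hy ⊢
    rw [← dist_eq_norm] at h1
    calc dist (Φ (t, y)) x₀ ≤ dist (Φ (t, y)) y + dist y x₀ := dist_triangle _ _ _
      _ < r / 4 + r / 4 := add_lt_add h1 hy
      _ = r / 2 := by ring
  let Ψ : (EuclideanSpace ℝ (Fin d) × EuclideanSpace ℝ (Fin d)) × E → E :=
    fun p => Φ (p.1.1, Φ (p.1.2, p.2))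
  have hB₁r : B₁ ⊆ Metric.ball 0 r := fun t ht => hBr (hB₁sub ht).1
  have hbb' : Metric.ball x₀ (r / 4) ⊆ Metric.ball x₀ r := Metric.ball_subset_ball (by linarith)
  have hΨ : ContDiffOn ℝ ∞ Ψ ((B₁ ×ˢ B₁) ×ˢ Metric.ball x₀ (r / 4)) := by
    have h1 : ContDiffOn ℝ ∞ (fun p : (EuclideanSpace ℝ (Fin d) × EuclideanSpace ℝ (Fin d)) × E =>
        Φ (p.1.2, p.2)) ((B₁ ×ˢ B₁) ×ˢ Metric.ball x₀ (r / 4)) :=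
      hΦ.comp ((contDiff_snd.comp contDiff_fst).prodMk contDiff_snd).contDiffOn
        fun p hp => ⟨hB₁r hp.1.2, hbb' hp.2⟩
    exact hΦ.comp ((contDiff_fst.comp contDiff_fst).contDiffOn.prodMk h1)
      fun p hp => ⟨hB₁r hp.1.1, hbb (hmaps _ hp.1.2 hp.2)⟩
  -- The composite lives on the ball of radius `r / 4`; uniform closeness to the identity needs a
  -- smaller closed ball, hence `r / 8`.
  obtain ⟨ε, hε, hexh8⟩ := hexh (r / 8) (by linarith)
  have hΨc : ∀ᶠ p in 𝓝 (0 : EuclideanSpace ℝ (Fin d) × EuclideanSpace ℝ (Fin d)),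
      CloseToId ε (fun y => Ψ (p, y)) (Metric.closedBall x₀ (r / 8)) :=
    eventually_closeToId (hB₁o.prod hB₁o) ⟨h0B₁, h0B₁⟩ hΨ (fun y hy => by
      change Φ (0, Φ (0, y)) = y
      rw [(hΦ0 y (hbb' hy)).1, (hΦ0 y (hbb' hy)).1]) (by linarith) hε
  obtain ⟨u, v, hu, h0u, hv, h0v, huv⟩ := mem_nhds_prod_iff'.1 hΨc
  have hΨsym : ∀ s ∈ B₁, ∀ t ∈ B₁, IsSymOn J Ω (fun y => Ψ ((s, t), y)) (Metric.ball x₀ (r / 8)) :=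
    fun s hs t ht => (((hsymOn s (hB₁r hs)).mono hbb).comp ((hsymOn t (hB₁r ht)).mono hbb')
      Metric.isOpen_ball Metric.isOpen_ball (hmaps t ht)).mono (Metric.ball_subset_ball (by linarith))
  have hm : ∀ s ∈ B₁ ∩ u ∩ v, ∀ t ∈ B₁ ∩ u ∩ v, _ := fun s hs t ht =>
    hexh8 (fun y => Ψ ((s, t), y)) (hΨsym s hs.1.1 t ht.1.1)
      (CloseToId.mono (huv ⟨hs.1.2, ht.2⟩) Metric.ball_subset_closedBall le_rfl)
  refine ⟨Φ, B, B₁ ∩ u ∩ v, fun p => e.symm (κ (jet₁ (fun y => Ψ (p, y)) x₀)), r / 2, by linarith,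
    hbb.trans ((Metric.ball_subset_ball hrr₁).trans hr₁Ω), hBo, (hB₁o.inter hu).inter hv,
    ⟨⟨h0B₁, h0u⟩, h0v⟩, fun t ht => (hB₁sub ht.1.1).1, hΦ.mono (prod_mono hBr hbb),
    fun y hy => (hΦ0 y (hbb hy)).1, ?_, ?_, ?_, ?_, ?_⟩
  · intro t ht
    have h1 := (hsymOn t (hBr ht)).mono hbb
    refine ⟨h1, exists_openPartialHomeomorph_of_closeToId h1.contDiffOn
      (CloseToId.mono (hBsub ht).2 Metric.ball_subset_closedBall le_rfl)⟩
  · intro s hs t ht hst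
    have h1 : τ s = τ t := by simp only [τ, jet₁_congr hst]
    rw [← he] at h1
    exact e.injOn (hBsub hs).1 (hBsub ht).1 h1
  · refine hesymm.comp (hκ.comp_contDiffOn ((contDiffOn_jet₁ (by linarith) (hB₁o.prod hB₁o)
      hΨ).mono (prod_mono (fun t ht => ht.1.1) fun t ht => ht.1.1))) fun p hp => ?_
    exact (hm p.1 hp.1 p.2 hp.2).1
  · intro s hs t ht
    obtain ⟨-, h2, h3⟩ := hm s hs t ht
    exact ⟨h2, hmaps t ht.1.1 (Metric.mem_ball_self (by linarith)), h3⟩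
  · intro ρ' hρ'
    obtain ⟨ε, hε, h1⟩ := hexh ρ' hρ'
    exact ⟨ε, hε, fun f hf hfc => ⟨_, (h1 f hf hfc).2⟩⟩

end LocalLie

/-! ### Almost complex structures in charts -/

section Chart

variable {n : ℕ} {M : Type*} [TopologicalSpace M]
  [ChartedSpace (EuclideanSpace ℝ (Fin (2 * n))) M] [IsManifold (𝓡 (2 * n)) ∞ M]
  {x : M} {y : EuclideanSpace ℝ (Fin (2 * n))}

omit [IsManifold (𝓡 (2 * n)) ∞ M] in
theorem symm_mem_source (hy : y ∈ (extChartAt (𝓡 (2 * n)) x).target) :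
    (extChartAt (𝓡 (2 * n)) x).symm y ∈ (extChartAt (𝓡 (2 * n)) x).source :=
  (extChartAt (𝓡 (2 * n)) x).map_target hy

theorem contMDiffAt_chart_symm (hy : y ∈ (extChartAt (𝓡 (2 * n)) x).target) :
    ContMDiffAt 𝓘(ℝ, EuclideanSpace ℝ (Fin (2 * n))) (𝓡 (2 * n)) ∞
      (extChartAt (𝓡 (2 * n)) x).symm y :=
  (contMDiffOn_extChartAt_symm x).contMDiffAt ((isOpen_extChartAt_target x).mem_nhds hy)

theorem isInvertible_mfderiv_chart_symm (hy : y ∈ (extChartAt (𝓡 (2 * n)) x).target) :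
    (mfderiv 𝓘(ℝ, EuclideanSpace ℝ (Fin (2 * n))) (𝓡 (2 * n))
      (extChartAt (𝓡 (2 * n)) x).symm y).IsInvertible := by
  have h : IsManifold (𝓡 (2 * n)) 1 M := IsManifold.of_le (n := ∞) (by simp)
  have := isInvertible_mfderivWithin_extChartAt_symm (I := 𝓡 (2 * n)) (x := x) hy
  rwa [ModelWithCorners.range_eq_univ, mfderivWithin_univ] at this

theorem mfderiv_chart_mfderiv_symm (hy : y ∈ (extChartAt (𝓡 (2 * n)) x).target)
    (v : EuclideanSpace ℝ (Fin (2 * n))) :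
    mfderiv (𝓡 (2 * n)) 𝓘(ℝ, EuclideanSpace ℝ (Fin (2 * n))) (extChartAt (𝓡 (2 * n)) x)
      ((extChartAt (𝓡 (2 * n)) x).symm y)
      (mfderiv 𝓘(ℝ, EuclideanSpace ℝ (Fin (2 * n))) (𝓡 (2 * n))
        (extChartAt (𝓡 (2 * n)) x).symm y v) = v := by
  have h : IsManifold (𝓡 (2 * n)) 1 M := IsManifold.of_le (n := ∞) (by simp)
  have := mfderiv_extChartAt_comp_mfderivWithin_extChartAt_symm (I := 𝓡 (2 * n)) (x := x) hy
  rw [ModelWithCorners.range_eq_univ, mfderivWithin_univ] at this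
  exact congrArg (fun A : EuclideanSpace ℝ (Fin (2 * n)) →L[ℝ] EuclideanSpace ℝ (Fin (2 * n)) =>
    A v) this

theorem mfderiv_symm_mfderiv_chart (hy : y ∈ (extChartAt (𝓡 (2 * n)) x).target)
    (v : TangentSpace (𝓡 (2 * n)) ((extChartAt (𝓡 (2 * n)) x).symm y)) :
    mfderiv 𝓘(ℝ, EuclideanSpace ℝ (Fin (2 * n))) (𝓡 (2 * n)) (extChartAt (𝓡 (2 * n)) x).symm y
      (mfderiv (𝓡 (2 * n)) 𝓘(ℝ, EuclideanSpace ℝ (Fin (2 * n))) (extChartAt (𝓡 (2 * n)) x)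
        ((extChartAt (𝓡 (2 * n)) x).symm y) v) = v := by
  have h : IsManifold (𝓡 (2 * n)) 1 M := IsManifold.of_le (n := ∞) (by simp)
  have := mfderivWithin_extChartAt_symm_comp_mfderiv_extChartAt (I := 𝓡 (2 * n)) (x := x) hy
  rw [ModelWithCorners.range_eq_univ, mfderivWithin_univ] at this
  exact congrArg (fun A : EuclideanSpace ℝ (Fin (2 * n)) →L[ℝ] EuclideanSpace ℝ (Fin (2 * n)) =>
    A v) this

theorem inChart_eq (X : VField n M) (hy : y ∈ (extChartAt (𝓡 (2 * n)) x).target) :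
    X.inChart x y = mfderiv (𝓡 (2 * n)) 𝓘(ℝ, EuclideanSpace ℝ (Fin (2 * n)))
      (extChartAt (𝓡 (2 * n)) x) ((extChartAt (𝓡 (2 * n)) x).symm y)
      (X ((extChartAt (𝓡 (2 * n)) x).symm y)) := by
  change (mfderiv 𝓘(ℝ, EuclideanSpace ℝ (Fin (2 * n))) (𝓡 (2 * n))
    (extChartAt (𝓡 (2 * n)) x).symm y).inverse _ = _
  exact (isInvertible_mfderiv_chart_symm hy).inverse_apply_eq.2 (mfderiv_symm_mfderiv_chart hy _).symm

theorem mfderiv_symm_inChart (X : VField n M) (hy : y ∈ (extChartAt (𝓡 (2 * n)) x).target) :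
    mfderiv 𝓘(ℝ, EuclideanSpace ℝ (Fin (2 * n))) (𝓡 (2 * n)) (extChartAt (𝓡 (2 * n)) x).symm y
      (X.inChart x y) = X ((extChartAt (𝓡 (2 * n)) x).symm y) := by
  rw [inChart_eq X hy]
  exact mfderiv_symm_mfderiv_chart hy _

theorem contDiffAt_inChart {X : VField n M} (hy : y ∈ (extChartAt (𝓡 (2 * n)) x).target)
    (hX : ContMDiffAt (𝓡 (2 * n)) (𝓡 (2 * n)).tangent ∞
      (fun p => (⟨p, X p⟩ : TangentBundle (𝓡 (2 * n)) M)) ((extChartAt (𝓡 (2 * n)) x).symm y)) :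
    ContDiffAt ℝ ∞ (X.inChart x) y :=
  contMDiffAt_vectorSpace_iff_contDiffAt.1 (hX.mpullback_vectorField_preimage
    (contMDiffAt_chart_symm hy) (isInvertible_mfderiv_chart_symm hy) (by simp))

/-- The field with constant components `v` in the chart around `x`. -/
def chartField (x : M) (v : EuclideanSpace ℝ (Fin (2 * n))) : VField n M :=
  mpullback (𝓡 (2 * n)) 𝓘(ℝ, EuclideanSpace ℝ (Fin (2 * n))) (extChartAt (𝓡 (2 * n)) x) fun _ => v

theorem contMDiffAt_chartField (v : EuclideanSpace ℝ (Fin (2 * n))) {p : M}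
    (hp : p ∈ (extChartAt (𝓡 (2 * n)) x).source) :
    ContMDiffAt (𝓡 (2 * n)) (𝓡 (2 * n)).tangent ∞
      (fun p => (⟨p, chartField x v p⟩ : TangentBundle (𝓡 (2 * n)) M)) p := by
  have h : IsManifold (𝓡 (2 * n)) 1 M := IsManifold.of_le (n := ∞) (by simp)
  refine ContMDiffAt.mpullback_vectorField_preimage (n := ∞) ?_
    (contMDiffAt_extChartAt' (by rwa [← extChartAt_source (𝓡 (2 * n))]))
    (isInvertible_mfderiv_extChartAt hp) (by simp)
  exact contMDiffAt_vectorSpace_iff_contDiffAt.2 contDiffAt_const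

theorem inChart_chartField (v : EuclideanSpace ℝ (Fin (2 * n)))
    (hy : y ∈ (extChartAt (𝓡 (2 * n)) x).target) : (chartField x v).inChart x y = v := by
  have h : IsManifold (𝓡 (2 * n)) 1 M := IsManifold.of_le (n := ∞) (by simp)
  rw [inChart_eq _ hy]
  change mfderiv (𝓡 (2 * n)) 𝓘(ℝ, EuclideanSpace ℝ (Fin (2 * n))) (extChartAt (𝓡 (2 * n)) x)
    ((extChartAt (𝓡 (2 * n)) x).symm y) ((mfderiv (𝓡 (2 * n))
      𝓘(ℝ, EuclideanSpace ℝ (Fin (2 * n))) (extChartAt (𝓡 (2 * n)) x)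
      ((extChartAt (𝓡 (2 * n)) x).symm y)).inverse v) = v
  exact (isInvertible_mfderiv_extChartAt (symm_mem_source hy)).self_apply_inverse v

namespace AlmostComplexStructure

variable (J : AlmostComplexStructure n M)

/-- The almost complex structure in the chart around `x`. -/
def inChart (x : M) (y : EuclideanSpace ℝ (Fin (2 * n))) :
    EuclideanSpace ℝ (Fin (2 * n)) →L[ℝ] EuclideanSpace ℝ (Fin (2 * n)) :=
  (mfderiv (𝓡 (2 * n)) 𝓘(ℝ, EuclideanSpace ℝ (Fin (2 * n))) (extChartAt (𝓡 (2 * n)) x)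
      ((extChartAt (𝓡 (2 * n)) x).symm y)).comp
    ((J.toFun ((extChartAt (𝓡 (2 * n)) x).symm y)).comp
      (mfderiv 𝓘(ℝ, EuclideanSpace ℝ (Fin (2 * n))) (𝓡 (2 * n)) (extChartAt (𝓡 (2 * n)) x).symm y))

theorem inChart_apply (v : EuclideanSpace ℝ (Fin (2 * n))) :
    J.inChart x y v = mfderiv (𝓡 (2 * n)) 𝓘(ℝ, EuclideanSpace ℝ (Fin (2 * n)))
      (extChartAt (𝓡 (2 * n)) x) ((extChartAt (𝓡 (2 * n)) x).symm y)
      (J.toFun ((extChartAt (𝓡 (2 * n)) x).symm y)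
        (mfderiv 𝓘(ℝ, EuclideanSpace ℝ (Fin (2 * n))) (𝓡 (2 * n))
          (extChartAt (𝓡 (2 * n)) x).symm y v)) := rfl

theorem mfderiv_symm_inChart_apply (hy : y ∈ (extChartAt (𝓡 (2 * n)) x).target)
    (v : EuclideanSpace ℝ (Fin (2 * n))) :
    mfderiv 𝓘(ℝ, EuclideanSpace ℝ (Fin (2 * n))) (𝓡 (2 * n)) (extChartAt (𝓡 (2 * n)) x).symm y
      (J.inChart x y v) = J.toFun ((extChartAt (𝓡 (2 * n)) x).symm y)
        (mfderiv 𝓘(ℝ, EuclideanSpace ℝ (Fin (2 * n))) (𝓡 (2 * n))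
          (extChartAt (𝓡 (2 * n)) x).symm y v) := by
  rw [inChart_apply]
  exact mfderiv_symm_mfderiv_chart hy _

theorem inChart_sq (hy : y ∈ (extChartAt (𝓡 (2 * n)) x).target)
    (v : EuclideanSpace ℝ (Fin (2 * n))) : J.inChart x y (J.inChart x y v) = -v := by
  rw [inChart_apply, mfderiv_symm_inChart_apply J hy, J.sq_eq_neg, map_neg]
  exact congrArg _ (mfderiv_chart_mfderiv_symm hy v)

theorem app_inChart (X : VField n M) (hy : y ∈ (extChartAt (𝓡 (2 * n)) x).target) :
    (J.app X).inChart x y = J.inChart x y (X.inChart x y) := by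
  rw [inChart_eq _ hy, inChart_apply, mfderiv_symm_inChart X hy]
  rfl

theorem contMDiffAt_app {X : VField n M} {p : M} (hX : ContMDiffAt (𝓡 (2 * n)) (𝓡 (2 * n)).tangent ∞
      (fun p => (⟨p, X p⟩ : TangentBundle (𝓡 (2 * n)) M)) p) :
    ContMDiffAt (𝓡 (2 * n)) (𝓡 (2 * n)).tangent ∞
      (fun p => (⟨p, J.app X p⟩ : TangentBundle (𝓡 (2 * n)) M)) p :=
  ContMDiffAt.clm_bundle_apply (J.smooth p) hX

/-- In finite dimension an operator-valued map is smooth when its value on each fixed vector is;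
these values are the chart components of `J` applied to smooth fields. -/
theorem contDiffOn_inChart (x : M) :
    ContDiffOn ℝ ∞ (J.inChart x) (extChartAt (𝓡 (2 * n)) x).target := by
  rw [contDiffOn_clm_apply]
  intro v
  have h1 : ContDiffOn ℝ ∞ ((J.app (chartField x v)).inChart x) (extChartAt (𝓡 (2 * n)) x).target :=
    fun y hy => (contDiffAt_inChart hy (J.contMDiffAt_app
      (contMDiffAt_chartField v (symm_mem_source hy)))).contDiffWithinAt
  refine h1.congr fun y hy => ?_
  rw [app_inChart J _ hy, inChart_chartField v hy]

end AlmostComplexStructure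

theorem mlieBracket_inChart {X Y : VField n M} (hy : y ∈ (extChartAt (𝓡 (2 * n)) x).target)
    (hX : ContMDiffAt (𝓡 (2 * n)) (𝓡 (2 * n)).tangent ∞
      (fun p => (⟨p, X p⟩ : TangentBundle (𝓡 (2 * n)) M)) ((extChartAt (𝓡 (2 * n)) x).symm y))
    (hY : ContMDiffAt (𝓡 (2 * n)) (𝓡 (2 * n)).tangent ∞
      (fun p => (⟨p, Y p⟩ : TangentBundle (𝓡 (2 * n)) M)) ((extChartAt (𝓡 (2 * n)) x).symm y)) :
    VField.inChart (mlieBracket (𝓡 (2 * n)) X Y) x y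
      = fderiv ℝ (Y.inChart x) y (X.inChart x y) - fderiv ℝ (X.inChart x) y (Y.inChart x y) := by
  have h : IsManifold (𝓡 (2 * n)) (minSmoothness ℝ 2) M := by
    rw [minSmoothness_of_isRCLikeNormedField]
    exact IsManifold.of_le (n := ∞) (WithTop.coe_le_coe.2 (le_top (a := (2 : ℕ∞))))
  have h1 := mpullback_mlieBracket (n := ∞) (hX.mdifferentiableAt (by simp))
    (hY.mdifferentiableAt (by simp)) (contMDiffAt_chart_symm hy) (by
      rw [minSmoothness_of_isRCLikeNormedField]
      exact WithTop.coe_le_coe.2 (le_top (a := (2 : ℕ∞))))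
  refine h1.trans ?_
  rw [← mlieBracketWithin_univ, mlieBracketWithin_eq_lieBracketWithin]
  have key : lieBracketWithin ℝ (X.inChart x) (Y.inChart x) univ y
      = fderiv ℝ (Y.inChart x) y (X.inChart x y) - fderiv ℝ (X.inChart x) y (Y.inChart x y) := by
    simp [lieBracketWithin]
  exact key

end Chart

/-! ### The Lie derivative and the Nijenhuis tensor in charts. -/

section Chart

variable {n : ℕ} {M : Type*} [TopologicalSpace M]
  [ChartedSpace (EuclideanSpace ℝ (Fin (2 * n))) M] [IsManifold (𝓡 (2 * n)) ∞ M]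
  {x : M} {y : EuclideanSpace ℝ (Fin (2 * n))}

theorem inChart_sub (X Y : VField n M) (hy : y ∈ (extChartAt (𝓡 (2 * n)) x).target) :
    (X - Y).inChart x y = X.inChart x y - Y.inChart x y := by
  rw [inChart_eq _ hy, inChart_eq _ hy, inChart_eq _ hy]
  exact map_sub _ _ _

theorem inChart_add (X Y : VField n M) (hy : y ∈ (extChartAt (𝓡 (2 * n)) x).target) :
    (X + Y).inChart x y = X.inChart x y + Y.inChart x y := by
  rw [inChart_eq _ hy, inChart_eq _ hy, inChart_eq _ hy]
  exact map_add _ _ _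

theorem inChart_smul (c : ℝ) (X : VField n M) (hy : y ∈ (extChartAt (𝓡 (2 * n)) x).target) :
    (c • X).inChart x y = c • X.inChart x y := by
  rw [inChart_eq _ hy, inChart_eq _ hy]
  exact (mfderiv (𝓡 (2 * n)) 𝓘(ℝ, EuclideanSpace ℝ (Fin (2 * n))) (extChartAt (𝓡 (2 * n)) x)
    ((extChartAt (𝓡 (2 * n)) x).symm y)).map_smul c _

theorem inChart_eq_zero_iff (X : VField n M) (hy : y ∈ (extChartAt (𝓡 (2 * n)) x).target) :
    X.inChart x y = 0 ↔ X ((extChartAt (𝓡 (2 * n)) x).symm y) = 0 := by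
  constructor
  · intro h
    rw [← mfderiv_symm_inChart X hy, h]
    exact map_zero _
  · intro h
    rw [inChart_eq X hy, h]
    exact map_zero _

/-- Every vector is the value of the components of a global field that is constant in the chart
around `x` near a given point. -/
theorem exists_smooth_eventually_inChart_eq [T2Space M] (v : EuclideanSpace ℝ (Fin (2 * n)))
    (hy : y ∈ (extChartAt (𝓡 (2 * n)) x).target) :
    ∃ Y : VField n M, Y.Smooth ∧ ∀ᶠ y' in 𝓝 y, Y.inChart x y' = v := by
  set p := (extChartAt (𝓡 (2 * n)) x).symm y with hp
  have hps : p ∈ (extChartAt (𝓡 (2 * n)) x).source := symm_mem_source hy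
  obtain ⟨f, -, hf⟩ := (SmoothBumpFunction.nhds_basis_tsupport (I := 𝓡 (2 * n)) p).mem_iff.1
    ((isOpen_extChartAt_source (I := 𝓡 (2 * n)) x).mem_nhds hps)
  refine ⟨(f : M → ℝ) • chartField x v, ?_, ?_⟩
  · have := ContMDiffOn.smul_section_of_tsupport (I := 𝓡 (2 * n)) (n := ∞)
      (V := (TangentSpace (𝓡 (2 * n)) : M → Type _)) (F := EuclideanSpace ℝ (Fin (2 * n)))
      (ψ := (f : M → ℝ)) (s := chartField x v) (u := (extChartAt (𝓡 (2 * n)) x).source)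
      f.contMDiff.contMDiffOn (isOpen_extChartAt_source (I := 𝓡 (2 * n)) x) hf
      (fun q hq => (contMDiffAt_chartField v hq).contMDiffWithinAt)
    exact this.contMDiffOn
  · have h1 := ((continuousAt_extChartAt_symm'' hy).tendsto.eventually f.eventuallyEq_one)
    filter_upwards [h1, (isOpen_extChartAt_target x).mem_nhds hy] with y' h2 h3
    refine Eq.trans ?_ (inChart_chartField v h3)
    rw [inChart_eq _ h3, inChart_eq _ h3]
    congr 1
    change f ((extChartAt (𝓡 (2 * n)) x).symm y') •
      chartField x v ((extChartAt (𝓡 (2 * n)) x).symm y') = _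
    rw [h2]
    exact one_smul ℝ _

theorem smooth_contMDiffAt {X : VField n M} (hX : X.Smooth) (p : M) :
    ContMDiffAt (𝓡 (2 * n)) (𝓡 (2 * n)).tangent ∞
      (fun p => (⟨p, X p⟩ : TangentBundle (𝓡 (2 * n)) M)) p :=
  ContMDiffOn.contMDiffAt hX univ_mem

namespace AlmostComplexStructure

variable (J : AlmostComplexStructure n M)

theorem contDiffAt_inChart (hy : y ∈ (extChartAt (𝓡 (2 * n)) x).target) :
    ContDiffAt ℝ ∞ (J.inChart x) y :=
  (J.contDiffOn_inChart x).contDiffAt ((isOpen_extChartAt_target x).mem_nhds hy)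

theorem fderiv_app_inChart {X : VField n M} (hy : y ∈ (extChartAt (𝓡 (2 * n)) x).target)
    (hX : ContMDiffAt (𝓡 (2 * n)) (𝓡 (2 * n)).tangent ∞
      (fun p => (⟨p, X p⟩ : TangentBundle (𝓡 (2 * n)) M)) ((extChartAt (𝓡 (2 * n)) x).symm y))
    (v : EuclideanSpace ℝ (Fin (2 * n))) :
    fderiv ℝ ((J.app X).inChart x) y v
      = fderiv ℝ (J.inChart x) y v (X.inChart x y)
        + J.inChart x y (fderiv ℝ (X.inChart x) y v) := by
  have h1 : (J.app X).inChart x =ᶠ[𝓝 y] fun y => J.inChart x y (X.inChart x y) := by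
    filter_upwards [(isOpen_extChartAt_target x).mem_nhds hy] with y' h
    exact J.app_inChart X h
  rw [h1.fderiv_eq, fderiv_clm_apply ((J.contDiffAt_inChart hy).differentiableAt (by simp))
    ((AlmostComplex.contDiffAt_inChart hy hX).differentiableAt (by simp))]
  simp [add_comm]

theorem lieDeriv_inChart {X Y : VField n M} (hy : y ∈ (extChartAt (𝓡 (2 * n)) x).target)
    (hX : ContMDiffAt (𝓡 (2 * n)) (𝓡 (2 * n)).tangent ∞
      (fun p => (⟨p, X p⟩ : TangentBundle (𝓡 (2 * n)) M)) ((extChartAt (𝓡 (2 * n)) x).symm y))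
    (hY : ContMDiffAt (𝓡 (2 * n)) (𝓡 (2 * n)).tangent ∞
      (fun p => (⟨p, Y p⟩ : TangentBundle (𝓡 (2 * n)) M)) ((extChartAt (𝓡 (2 * n)) x).symm y)) :
    (J.lieDeriv X Y).inChart x y = -infDefect (J.inChart x) (X.inChart x) y (Y.inChart x y) := by
  rw [lieDeriv, inChart_sub _ _ hy, J.app_inChart _ hy, mlieBracket_inChart hy hX hY,
    mlieBracket_inChart hy hX (J.contMDiffAt_app hY), J.fderiv_app_inChart hy hY,
    J.app_inChart _ hy]
  simp only [infDefect, map_sub, ContinuousLinearMap.comp_apply, sub_apply]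
  abel

theorem nijenhuis_inChart {X Y : VField n M} (hy : y ∈ (extChartAt (𝓡 (2 * n)) x).target)
    (hX : ContMDiffAt (𝓡 (2 * n)) (𝓡 (2 * n)).tangent ∞
      (fun p => (⟨p, X p⟩ : TangentBundle (𝓡 (2 * n)) M)) ((extChartAt (𝓡 (2 * n)) x).symm y))
    (hY : ContMDiffAt (𝓡 (2 * n)) (𝓡 (2 * n)).tangent ∞
      (fun p => (⟨p, Y p⟩ : TangentBundle (𝓡 (2 * n)) M)) ((extChartAt (𝓡 (2 * n)) x).symm y)) :
    (J.nijenhuis X Y).inChart x y = nij (J.inChart x) y (X.inChart x y) (Y.inChart x y) := by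
  have hX' := J.contMDiffAt_app hX
  have hY' := J.contMDiffAt_app hY
  rw [nijenhuis, inChart_sub _ _ hy, inChart_sub _ _ hy, inChart_sub _ _ hy, J.app_inChart _ hy,
    J.app_inChart _ hy, mlieBracket_inChart hy hX hY, mlieBracket_inChart hy hX hY',
    mlieBracket_inChart hy hX' hY, mlieBracket_inChart hy hX' hY', J.fderiv_app_inChart hy hY,
    J.fderiv_app_inChart hy hX, J.fderiv_app_inChart hy hY, J.fderiv_app_inChart hy hX,
    J.app_inChart _ hy, J.app_inChart _ hy, nij_apply]
  simp only [map_sub, map_add, J.inChart_sq hy]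
  abel

/-- The hypothesis tests only global smooth fields. Bump functions extend each vector to such a
field, so nothing is lost. -/
theorem infDefect_eq_zero_of_lieDeriv [T2Space M] {X : VField n M}
    (hy : y ∈ (extChartAt (𝓡 (2 * n)) x).target)
    (hX : ContMDiffAt (𝓡 (2 * n)) (𝓡 (2 * n)).tangent ∞
      (fun p => (⟨p, X p⟩ : TangentBundle (𝓡 (2 * n)) M)) ((extChartAt (𝓡 (2 * n)) x).symm y))
    (h : ∀ Y : VField n M, Y.Smooth → J.lieDeriv X Y ((extChartAt (𝓡 (2 * n)) x).symm y) = 0) :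
    infDefect (J.inChart x) (X.inChart x) y = 0 := by
  ext1 v
  obtain ⟨Y, hY, hYv⟩ := exists_smooth_eventually_inChart_eq v hy
  have h1 := J.lieDeriv_inChart hy hX (smooth_contMDiffAt hY _)
  rw [(inChart_eq_zero_iff _ hy).2 (h Y hY), hYv.self_of_nhds] at h1
  simpa using h1.symm

theorem contDiffAt_infDefect {X : VField n M} (hy : y ∈ (extChartAt (𝓡 (2 * n)) x).target)
    (hX : ContDiffAt ℝ ∞ (X.inChart x) y) :
    ContDiffAt ℝ ∞ (infDefect (J.inChart x) (X.inChart x)) y := by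
  have hJ := J.contDiffAt_inChart hy
  exact (((hX.fderiv_right (m := ∞) (by simp)).clm_comp hJ).sub
    (hJ.clm_comp (hX.fderiv_right (m := ∞) (by simp)))).sub
    ((hJ.fderiv_right (m := ∞) (by simp)).clm_apply hX)

/-- Testing L_X J on a global field with constant components `w` near `x` turns the jets of (L_X J)Y
into the derivatives of the operator-valued defect, evaluated at `w`. -/
theorem isFlatAt_infDefect [T2Space M] {X : VField n M} (h : J.IsFormalSymmetryAt X x) :
    IsFlatAt (infDefect (J.inChart x) (X.inChart x)) (extChartAt (𝓡 (2 * n)) x x) := by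
  have hx : extChartAt (𝓡 (2 * n)) x x ∈ (extChartAt (𝓡 (2 * n)) x).target :=
    mem_extChartAt_target x
  have hD := J.contDiffAt_infDefect hx
    (AlmostComplex.contDiffAt_inChart hx (smooth_contMDiffAt h.1 _))
  refine ⟨hD, fun m => ?_⟩
  ext v w : 2
  obtain ⟨Y, hY, hYw⟩ := exists_smooth_eventually_inChart_eq w hx
  have h1 : (J.lieDeriv X Y).inChart x =ᶠ[𝓝 (extChartAt (𝓡 (2 * n)) x x)]
      fun y => (-infDefect (J.inChart x) (X.inChart x) y) w := by
    filter_upwards [hYw, (isOpen_extChartAt_target x).mem_nhds hx] with y h2 h3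
    rw [J.lieDeriv_inChart h3 (smooth_contMDiffAt h.1 _) (smooth_contMDiffAt hY _), h2]
    rfl
  have h2 := congrFun (h.2 Y hY m) (Fin.last m)
  have h3 : iteratedFDeriv ℝ m ((J.lieDeriv X Y).inChart x) (extChartAt (𝓡 (2 * n)) x x) = 0 := h2
  rw [(h1.iteratedFDeriv ℝ m).eq_of_nhds] at h3
  have h4 := iteratedFDeriv_apply_const hD.neg w m v
  have h5 : iteratedFDeriv ℝ m (fun y => -infDefect (J.inChart x) (X.inChart x) y)
    (extChartAt (𝓡 (2 * n)) x x) = -iteratedFDeriv ℝ m (infDefect (J.inChart x) (X.inChart x))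
    (extChartAt (𝓡 (2 * n)) x x) := iteratedFDeriv_neg_apply
  rw [h3, h5] at h4
  simpa using h4.symm

theorem nij_inChart_ne_zero (h : J.NijenhuisNeZeroAt x) :
    nij (J.inChart x) (extChartAt (𝓡 (2 * n)) x x) ≠ 0 := by
  obtain ⟨X, Y, hX, hY, hne⟩ := h
  intro h0
  have hx : extChartAt (𝓡 (2 * n)) x x ∈ (extChartAt (𝓡 (2 * n)) x).target :=
    mem_extChartAt_target x
  have h1 := J.nijenhuis_inChart hx (smooth_contMDiffAt hX _) (smooth_contMDiffAt hY _)
  rw [h0] at h1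
  have h2 := (inChart_eq_zero_iff _ hx).1 (h1.trans rfl)
  rw [extChartAt_to_inv] at h2
  exact hne h2

theorem span_nij_inChart (h : J.nijenhuisImage x = ⊤) :
    Submodule.span ℝ {w | ∃ ξ η, nij (J.inChart x) (extChartAt (𝓡 (2 * n)) x x) ξ η = w} = ⊤ := by
  have hx : extChartAt (𝓡 (2 * n)) x x ∈ (extChartAt (𝓡 (2 * n)) x).target :=
    mem_extChartAt_target x
  set A : TangentSpace (𝓡 (2 * n)) x →L[ℝ] EuclideanSpace ℝ (Fin (2 * n)) :=
    mfderiv (𝓡 (2 * n)) 𝓘(ℝ, EuclideanSpace ℝ (Fin (2 * n))) (extChartAt (𝓡 (2 * n)) x) x with hA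
  have hsurj : Function.Surjective A := by
    have := isInvertible_mfderiv_extChartAt (I := 𝓡 (2 * n)) (mem_extChartAt_source (I := 𝓡 (2 * n)) x)
    exact this.bijective.surjective
  have hval : ∀ X Y : VField n M, X.Smooth → Y.Smooth → A (J.nijenhuis X Y x)
      = nij (J.inChart x) (extChartAt (𝓡 (2 * n)) x x) (X.inChart x (extChartAt (𝓡 (2 * n)) x x))
        (Y.inChart x (extChartAt (𝓡 (2 * n)) x x)) := by
    intro X Y hX hY
    rw [← J.nijenhuis_inChart hx (smooth_contMDiffAt hX _) (smooth_contMDiffAt hY _),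
      inChart_eq _ hx, extChartAt_to_inv]
    rfl
  rw [eq_top_iff]
  rintro w -
  obtain ⟨v, rfl⟩ := hsurj w
  have hv : v ∈ J.nijenhuisImage x := by rw [h]; trivial
  induction hv using Submodule.span_induction with
  | mem v hv =>
    obtain ⟨X, Y, hX, hY, rfl⟩ := hv
    rw [hval X Y hX hY]
    exact Submodule.subset_span ⟨_, _, rfl⟩
  | zero => rw [map_zero]; exact Submodule.zero_mem _
  | add a b _ _ ha hb => rw [map_add]; exact Submodule.add_mem _ ha hb
  | smul c a _ ha => rw [map_smul]; exact Submodule.smul_mem _ c ha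

end AlmostComplexStructure

end Chart

/-! ### Unique continuation and counting on the manifold. -/

section Chart

variable {n : ℕ} {M : Type*} [TopologicalSpace M]
  [ChartedSpace (EuclideanSpace ℝ (Fin (2 * n))) M] [IsManifold (𝓡 (2 * n)) ∞ M]
  {x : M} {y : EuclideanSpace ℝ (Fin (2 * n))}

theorem eventually_inChart_eq_zero_iff (X : VField n M) (x : M) :
    (∀ᶠ y in 𝓝 (extChartAt (𝓡 (2 * n)) x x), X.inChart x y = 0) ↔ ∀ᶠ p in 𝓝 x, X p = 0 := by
  have hx : extChartAt (𝓡 (2 * n)) x x ∈ (extChartAt (𝓡 (2 * n)) x).target :=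
    mem_extChartAt_target x
  constructor
  · intro h
    filter_upwards [(continuousAt_extChartAt (I := 𝓡 (2 * n)) x).tendsto.eventually h,
      (isOpen_extChartAt_source (I := 𝓡 (2 * n)) x).mem_nhds (mem_extChartAt_source x)] with p h1 h2
    rwa [inChart_eq_zero_iff X ((extChartAt (𝓡 (2 * n)) x).map_source h2),
      (extChartAt (𝓡 (2 * n)) x).left_inv h2] at h1
  · intro h
    have h1 := continuousAt_extChartAt_symm (I := 𝓡 (2 * n)) x
    rw [ContinuousAt, extChartAt_to_inv] at h1
    filter_upwards [h1.eventually h, (isOpen_extChartAt_target x).mem_nhds hx] with y h2 h3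
    exact (inChart_eq_zero_iff X h3).2 h2

namespace AlmostComplexStructure

variable (J : AlmostComplexStructure n M)

theorem contDiffOn_inChart_of_smoothOn {X : VField n M} {U : Set M} (hU : IsOpen U)
    (hX : X.SmoothOn U) (x : M) :
    ContDiffOn ℝ ∞ (X.inChart x) ((extChartAt (𝓡 (2 * n)) x).target ∩
      (extChartAt (𝓡 (2 * n)) x).symm ⁻¹' U) := fun _ hy =>
  (AlmostComplex.contDiffAt_inChart hy.1 (hX.contMDiffAt (hU.mem_nhds hy.2))).contDiffWithinAt

omit [IsManifold (𝓡 (2 * n)) ∞ M] in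
theorem isOpen_target_inter_preimage {U : Set M} (hU : IsOpen U) (x : M) :
    IsOpen ((extChartAt (𝓡 (2 * n)) x).target ∩ (extChartAt (𝓡 (2 * n)) x).symm ⁻¹' U) :=
  (continuousOn_extChartAt_symm x).isOpen_inter_preimage (isOpen_extChartAt_target x) hU

omit [IsManifold (𝓡 (2 * n)) ∞ M] in
theorem mem_target_inter_preimage {U : Set M} {x : M} (hx : x ∈ U) :
    extChartAt (𝓡 (2 * n)) x x ∈
      (extChartAt (𝓡 (2 * n)) x).target ∩ (extChartAt (𝓡 (2 * n)) x).symm ⁻¹' U :=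
  ⟨mem_extChartAt_target x, by rwa [mem_preimage, extChartAt_to_inv]⟩

section InfSym

variable [T2Space M] {U : Set M} {hU : IsOpen U}

theorem infDefect_eq_zero_of_mem_infSym {X : VField n M} (hX : X ∈ J.infSym U hU) (x : M) :
    ∀ y ∈ (extChartAt (𝓡 (2 * n)) x).target ∩ (extChartAt (𝓡 (2 * n)) x).symm ⁻¹' U,
      infDefect (J.inChart x) (X.inChart x) y = 0 := fun _ hy =>
  J.infDefect_eq_zero_of_lieDeriv hy.1 (hX.1.contMDiffAt (hU.mem_nhds hy.2))
    fun Y hY => hX.2.2 Y hY _ hy.2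

theorem eventually_eq_zero_of_jet₁ {X : VField n M} (hX : X ∈ J.infSym U hU) (hx : x ∈ U)
    (hN : J.nijenhuisImage x = ⊤)
    (h : jet₁ (X.inChart x) (extChartAt (𝓡 (2 * n)) x x) = 0) : ∀ᶠ p in 𝓝 x, X p = 0 := by
  rw [← eventually_inChart_eq_zero_iff]
  exact exists_infinitesimal_uniqueness (isOpen_extChartAt_target x) (J.contDiffOn_inChart x)
    (fun y hy => J.inChart_sq hy) (mem_extChartAt_target x) (J.span_nij_inChart hN)
    (isOpen_target_inter_preimage hU x) (mem_target_inter_preimage hx)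
    (contDiffOn_inChart_of_smoothOn hU hX.1 x) (J.infDefect_eq_zero_of_mem_infSym hX x)
    (congrArg Prod.fst h) (congrArg Prod.snd h)

theorem continuousAt_jet₁ {E : Type} [NormedAddCommGroup E] [NormedSpace ℝ E] {f : E → E} {y : E}
    (hf : ContDiffAt ℝ ∞ f y) : ContinuousAt (jet₁ f) y :=
  hf.continuousAt.prodMk (hf.fderiv_right (m := ∞) (by simp)).continuousAt

/-- Unique continuation: the set of points near which `X` vanishes is open. At a limit point of it
in `U` the 1-jet vanishes by continuity, so the limit point belongs to it, and connectedness of `U`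
concludes. -/
theorem eq_zero_of_jet₁ (hUc : IsPreconnected U) (hN : J.NijenhuisOnto) {X : VField n M}
    (hX : X ∈ J.infSym U hU) (hx : x ∈ U)
    (h : jet₁ (X.inChart x) (extChartAt (𝓡 (2 * n)) x x) = 0) : X = 0 := by
  have hsub : U ⊆ {p | ∀ᶠ q in 𝓝 p, X q = 0} := by
    refine hUc.subset_of_closure_inter_subset isOpen_setOfPred_eventually_nhds
      ⟨x, hx, J.eventually_eq_zero_of_jet₁ hX hx (hN x) h⟩ ?_
    rintro p ⟨hp, hpU⟩
    refine J.eventually_eq_zero_of_jet₁ hX hpU (hN p) ?_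
    have hfreq : ∃ᶠ y in 𝓝 (extChartAt (𝓡 (2 * n)) p p), jet₁ (X.inChart p) y = 0 := by
      refine (continuousAt_extChartAt (I := 𝓡 (2 * n)) p).tendsto.frequently ?_
      refine ((mem_closure_iff_frequently.1 hp).and_eventually ((isOpen_extChartAt_source
        (I := 𝓡 (2 * n)) p).mem_nhds (mem_extChartAt_source p))).mono ?_
      rintro q ⟨hq, hqs⟩
      have hqt := (extChartAt (𝓡 (2 * n)) p).map_source hqs
      have h1 := (continuousAt_extChartAt_symm'' (I := 𝓡 (2 * n)) hqt).tendsto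
      rw [(extChartAt (𝓡 (2 * n)) p).left_inv hqs] at h1
      have h2 : X.inChart p =ᶠ[𝓝 (extChartAt (𝓡 (2 * n)) p q)] fun _ => 0 := by
        filter_upwards [h1.eventually hq, (isOpen_extChartAt_target p).mem_nhds hqt] with y h3 h4
        exact (inChart_eq_zero_iff X h4).2 h3
      rw [jet₁_congr h2]
      simp [jet₁]
    exact isClosed_singleton.mem_of_frequently_of_tendsto hfreq
      (continuousAt_jet₁ ((contDiffOn_inChart_of_smoothOn hU hX.1 p).contDiffAt
        ((isOpen_target_inter_preimage hU p).mem_nhds (mem_target_inter_preimage hpU)))).tendsto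
  funext p
  by_cases hp : p ∈ U
  · exact (hsub hp).self_of_nhds
  · exact hX.2.1 p hp

/-- The first jet at `x` of an infinitesimal symmetry, in the chart around `x`. -/
def infSymJet (hU : IsOpen U) (hx : x ∈ U) :
    J.infSym U hU →ₗ[ℝ] infJets (J.inChart x) (extChartAt (𝓡 (2 * n)) x x) where
  toFun X := ⟨jet₁ (X.1.inChart x) (extChartAt (𝓡 (2 * n)) x x), X.1.inChart x, _,
    isOpen_target_inter_preimage hU x, mem_target_inter_preimage hx,
    contDiffOn_inChart_of_smoothOn hU X.2.1 x, J.infDefect_eq_zero_of_mem_infSym X.2 x, rfl⟩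
  map_add' X Y := by
    have hd : ∀ X : J.infSym U hU, DifferentiableAt ℝ (X.1.inChart x)
        (extChartAt (𝓡 (2 * n)) x x) := fun X =>
      ((contDiffOn_inChart_of_smoothOn hU X.2.1 x).contDiffAt ((isOpen_target_inter_preimage
        hU x).mem_nhds (mem_target_inter_preimage hx))).differentiableAt (by simp)
    have h : (X.1 + Y.1).inChart x =ᶠ[𝓝 (extChartAt (𝓡 (2 * n)) x x)]
        X.1.inChart x + Y.1.inChart x :=
      eventually_of_mem ((isOpen_extChartAt_target x).mem_nhds (mem_extChartAt_target x))
        fun y hy => inChart_add _ _ hy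
    exact Subtype.ext ((jet₁_congr h).trans (Prod.ext rfl (fderiv_add (hd X) (hd Y))))
  map_smul' c X := by
    have hd : DifferentiableAt ℝ (X.1.inChart x) (extChartAt (𝓡 (2 * n)) x x) :=
      ((contDiffOn_inChart_of_smoothOn hU X.2.1 x).contDiffAt ((isOpen_target_inter_preimage
        hU x).mem_nhds (mem_target_inter_preimage hx))).differentiableAt (by simp)
    have h : (c • X.1).inChart x =ᶠ[𝓝 (extChartAt (𝓡 (2 * n)) x x)] c • X.1.inChart x :=
      eventually_of_mem ((isOpen_extChartAt_target x).mem_nhds (mem_extChartAt_target x))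
        fun y hy => inChart_smul _ _ hy
    exact Subtype.ext ((jet₁_congr h).trans (Prod.ext rfl (fderiv_const_smul hd c)))

theorem finrank_infSym_lt (hn : 0 < n) (hN : J.NijenhuisOnto) (hU : IsOpen U)
    (hUc : IsConnected U) : FiniteDimensional ℝ (J.infSym U hU) ∧
      Module.finrank ℝ (J.infSym U hU) < 2 * (n ^ 2 + n) := by
  obtain ⟨x, hx⟩ := hUc.nonempty
  have hinj : Function.Injective (J.infSymJet hU hx) := by
    rw [injective_iff_map_eq_zero]
    intro X hX
    exact Subtype.ext (J.eq_zero_of_jet₁ hUc.isPreconnected hN X.2 hx (congrArg Subtype.val hX))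
  refine ⟨FiniteDimensional.of_injective _ hinj, (LinearMap.finrank_le_finrank_of_injective
    hinj).trans_lt ?_⟩
  exact finrank_infJets_lt (isOpen_extChartAt_target x) (J.contDiffOn_inChart x)
    (fun y hy => J.inChart_sq hy) (mem_extChartAt_target x) (J.span_nij_inChart (hN x))
    (by simp) hn

end InfSym

/-! ### Formal symmetries -/

/-- The fields with flat defect form a linear space, so taking the span adds no new jets. The
argument runs with fields in the chart, where sums and multiples are immediate. -/
theorem exists_chart_field_of_mem_formalSymJets [T2Space M] {k : ℕ}
    {j : (i : Fin (k + 1)) → ContinuousMultilinearMap ℝ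
      (fun _ : Fin (i : ℕ) => EuclideanSpace ℝ (Fin (2 * n))) (EuclideanSpace ℝ (Fin (2 * n)))}
    (hj : j ∈ J.formalSymJets x k) :
    ∃ X : EuclideanSpace ℝ (Fin (2 * n)) → EuclideanSpace ℝ (Fin (2 * n)),
      ContDiffOn ℝ ∞ X (extChartAt (𝓡 (2 * n)) x).target ∧
      IsFlatAt (infDefect (J.inChart x) X) (extChartAt (𝓡 (2 * n)) x x) ∧
      ∀ i : Fin (k + 1), iteratedFDeriv ℝ i X (extChartAt (𝓡 (2 * n)) x x) = j i := by
  have hx : extChartAt (𝓡 (2 * n)) x x ∈ (extChartAt (𝓡 (2 * n)) x).target :=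
    mem_extChartAt_target x
  have hnhds := (isOpen_extChartAt_target (I := 𝓡 (2 * n)) x).mem_nhds hx
  induction hj using Submodule.span_induction with
  | mem j hj =>
    obtain ⟨X, hX, rfl⟩ := hj
    exact ⟨X.inChart x, fun y hy => (AlmostComplex.contDiffAt_inChart hy
      (smooth_contMDiffAt hX.1 _)).contDiffWithinAt, J.isFlatAt_infDefect hX, fun i => rfl⟩
  | zero =>
    refine ⟨fun _ => 0, contDiffOn_const, ?_, fun i => congrFun iteratedFDeriv_fun_zero _⟩
    have h0 : infDefect (J.inChart x) (fun _ => 0) = fun _ => 0 := by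
      funext y
      ext1 v
      simp [infDefect]
    rw [h0]
    exact ⟨contDiffAt_const, fun m => congrFun iteratedFDeriv_fun_zero _⟩
  | add j j' _ _ h h' =>
    obtain ⟨X, hX, hf, hXj⟩ := h
    obtain ⟨X', hX', hf', hXj'⟩ := h'
    refine ⟨fun y => X y + X' y, hX.add hX', (hf.add hf').congr ?_, fun i => ?_⟩
    · filter_upwards [(isOpen_extChartAt_target (I := 𝓡 (2 * n)) x).mem_nhds hx] with y hy
      have hy' := (isOpen_extChartAt_target (I := 𝓡 (2 * n)) x).mem_nhds hy
      exact (infDefect_add ((hX.contDiffAt hy').differentiableAt (by simp))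
        ((hX'.contDiffAt hy').differentiableAt (by simp)))
    · have := iteratedFDeriv_add_apply (𝕜 := ℝ) (i := (i : ℕ))
        ((hX.contDiffAt hnhds).of_le (m := ((i : ℕ) : ℕ∞ω)) (by exact_mod_cast le_top))
        ((hX'.contDiffAt hnhds).of_le (m := ((i : ℕ) : ℕ∞ω)) (by exact_mod_cast le_top))
      exact this.trans (by rw [hXj, hXj', Pi.add_apply])
  | smul c j _ h =>
    obtain ⟨X, hX, hf, hXj⟩ := h
    refine ⟨fun y => c • X y, hX.const_smul c, (hf.clm_apply (B := fun _ => c • ContinuousLinearMap.id ℝ _) contDiffAt_const).congr ?_, fun i => ?_⟩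
    · filter_upwards [(isOpen_extChartAt_target (I := 𝓡 (2 * n)) x).mem_nhds hx] with y hy
      have hy' := (isOpen_extChartAt_target (I := 𝓡 (2 * n)) x).mem_nhds hy
      exact infDefect_smul ((hX.contDiffAt hy').differentiableAt (by simp)) c
    · have := iteratedFDeriv_const_smul_apply (𝕜 := ℝ) (i := (i : ℕ)) (a := c)
        ((hX.contDiffAt hnhds).of_le (m := ((i : ℕ) : ℕ∞ω)) (by exact_mod_cast le_top))
      exact this.trans (by rw [hXj, Pi.smul_apply])

theorem dependsOnAtMost_formalDim [T2Space M] (hn : 1 < n) (hN : J.NijenhuisNeZeroAt x) :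
    DependsOnAtMost (J.formalDim x) (n - 1) (n - 1) := by
  obtain ⟨m, rfl⟩ : ∃ m, n = m + 2 := ⟨n - 2, by omega⟩
  have hp : m + 2 - 1 = m + 1 := by omega
  rw [hp]
  -- Here m = n − 2. The second multichoose term is bounded by (k + m)^m, of degree m < n − 1; the
  -- constant accounts for the jets of order 0 and 1.
  refine ⟨Polynomial.C (2 * (m + 2 : ℝ)) * (Polynomial.X + Polynomial.C (m : ℝ)) ^ m
    + Polynomial.C (2 * (m + 2 : ℝ) + 2 * (m + 2) * (2 * (m + 2))), ?_, fun k => ?_⟩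
  · refine lt_of_le_of_lt (b := (m : WithBot ℕ)) ?_ (by exact_mod_cast Nat.lt_succ_self m)
    refine (Polynomial.degree_add_le _ _).trans (max_le ?_ ?_)
    · refine (Polynomial.degree_mul_le _ _).trans ((add_le_add Polynomial.degree_C_le
        (Polynomial.degree_pow_le _ _)).trans ?_)
      rw [Polynomial.degree_X_add_C]
      simp
    · exact Polynomial.degree_C_le.trans (by exact_mod_cast Nat.zero_le m)
  · have h := finrank_formal_jets_le (m := m) (by simp) (isOpen_extChartAt_target x)
      (mem_extChartAt_target x) (J.contDiffOn_inChart x) (fun y hy => J.inChart_sq hy)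
      (J.nij_inChart_ne_zero hN) k (J.formalSymJets x k)
      (fun j hj => J.exists_chart_field_of_mem_formalSymJets hj)
    have h1 : Nat.multichoose (m + 2) k = (k + (m + 1)).choose (m + 1) := by
      rw [Nat.multichoose_eq, show m + 2 + k - 1 = k + (m + 1) by omega, Nat.choose_symm_add]
    have h2 : Nat.multichoose (m + 1) k ≤ (k + m) ^ m := by
      rw [Nat.multichoose_eq, show m + 1 + k - 1 = k + m by omega, Nat.choose_symm_add]
      exact Nat.choose_le_pow _ _
    have h3 : J.formalDim x k ≤ 2 * (m + 1) * (k + (m + 1)).choose (m + 1)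
        + 2 * (m + 2) * (k + m) ^ m + (2 * (m + 2) + 2 * (m + 2) * (2 * (m + 2))) := by
      refine h.trans ?_
      rw [h1]
      gcongr
    have h4 : (J.formalDim x k : ℝ) ≤ _ := Nat.cast_le.2 h3
    refine h4.trans (le_of_eq ?_)
    simp
    ring

end AlmostComplexStructure

end Chart

/-! ### Transport of symmetries between the manifold and a chart. -/

section Chart

variable {n : ℕ} {M : Type*} [TopologicalSpace M]
  [ChartedSpace (EuclideanSpace ℝ (Fin (2 * n))) M]

theorem isOpen_source_inter_preimage_chart (x : M) {W : Set (EuclideanSpace ℝ (Fin (2 * n)))}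
    (hW : IsOpen W) :
    IsOpen ((extChartAt (𝓡 (2 * n)) x).source ∩ extChartAt (𝓡 (2 * n)) x ⁻¹' W) :=
  (continuousOn_extChartAt x).isOpen_inter_preimage (isOpen_extChartAt_source x) hW

/-- Transport of a local homeomorphism of the model space by the chart around `x`. -/
def chartConj (x : M) (e : OpenPartialHomeomorph (EuclideanSpace ℝ (Fin (2 * n)))
    (EuclideanSpace ℝ (Fin (2 * n)))) : OpenPartialHomeomorph M M :=
  (chartAt (EuclideanSpace ℝ (Fin (2 * n))) x ≫ₕ e) ≫ₕ
    (chartAt (EuclideanSpace ℝ (Fin (2 * n))) x).symm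

theorem chartConj_apply (x : M) (e : OpenPartialHomeomorph (EuclideanSpace ℝ (Fin (2 * n)))
    (EuclideanSpace ℝ (Fin (2 * n)))) (p : M) :
    chartConj x e p = (extChartAt (𝓡 (2 * n)) x).symm (e (extChartAt (𝓡 (2 * n)) x p)) := rfl

theorem chartConj_symm (x : M) (e : OpenPartialHomeomorph (EuclideanSpace ℝ (Fin (2 * n)))
    (EuclideanSpace ℝ (Fin (2 * n)))) : (chartConj x e).symm = chartConj x e.symm := by
  simp [chartConj, OpenPartialHomeomorph.trans_symm_eq_symm_trans_symm,
    OpenPartialHomeomorph.trans_assoc]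

theorem chartConj_source (x : M) (e : OpenPartialHomeomorph (EuclideanSpace ℝ (Fin (2 * n)))
    (EuclideanSpace ℝ (Fin (2 * n)))) :
    (chartConj x e).source = (extChartAt (𝓡 (2 * n)) x).source ∩ extChartAt (𝓡 (2 * n)) x ⁻¹'
      (e.source ∩ e ⁻¹' (extChartAt (𝓡 (2 * n)) x).target) := by
  ext p
  simp [chartConj, and_assoc]

variable [IsManifold (𝓡 (2 * n)) ∞ M] {x : M} {y : EuclideanSpace ℝ (Fin (2 * n))}

namespace AlmostComplexStructure

variable (J : AlmostComplexStructure n M)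

theorem mfderiv_chart_toFun (hy : y ∈ (extChartAt (𝓡 (2 * n)) x).target)
    (v : TangentSpace (𝓡 (2 * n)) ((extChartAt (𝓡 (2 * n)) x).symm y)) :
    mfderiv (𝓡 (2 * n)) 𝓘(ℝ, EuclideanSpace ℝ (Fin (2 * n))) (extChartAt (𝓡 (2 * n)) x)
      ((extChartAt (𝓡 (2 * n)) x).symm y) (J.toFun ((extChartAt (𝓡 (2 * n)) x).symm y) v)
    = J.inChart x y (mfderiv (𝓡 (2 * n)) 𝓘(ℝ, EuclideanSpace ℝ (Fin (2 * n)))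
      (extChartAt (𝓡 (2 * n)) x) ((extChartAt (𝓡 (2 * n)) x).symm y) v) := by
  exact congrArg (fun w => mfderiv (𝓡 (2 * n)) 𝓘(ℝ, EuclideanSpace ℝ (Fin (2 * n)))
    (extChartAt (𝓡 (2 * n)) x) ((extChartAt (𝓡 (2 * n)) x).symm y)
    (J.toFun ((extChartAt (𝓡 (2 * n)) x).symm y) w)) (mfderiv_symm_mfderiv_chart hy v).symm

theorem mdifferentiableAt_chart {p : M} (hp : p ∈ (extChartAt (𝓡 (2 * n)) x).source) :
    MDifferentiableAt (𝓡 (2 * n)) 𝓘(ℝ, EuclideanSpace ℝ (Fin (2 * n)))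
      (extChartAt (𝓡 (2 * n)) x) p :=
  (contMDiffAt_extChartAt' (n := ∞) (by rwa [← extChartAt_source (𝓡 (2 * n))])).mdifferentiableAt
    (by simp)

theorem symPregroupoid_of_isSymOn {f : EuclideanSpace ℝ (Fin (2 * n)) →
      EuclideanSpace ℝ (Fin (2 * n))} {W : Set (EuclideanSpace ℝ (Fin (2 * n)))} (hW : IsOpen W)
    (hf : IsSymOn (J.inChart x) (extChartAt (𝓡 (2 * n)) x).target f W) :
    J.symPregroupoid.property
      (fun p => (extChartAt (𝓡 (2 * n)) x).symm (f (extChartAt (𝓡 (2 * n)) x p)))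
      ((extChartAt (𝓡 (2 * n)) x).source ∩ extChartAt (𝓡 (2 * n)) x ⁻¹' W) := by
  refine ⟨?_, ?_⟩
  · refine (contMDiffOn_extChartAt_symm x).comp (hf.contDiffOn.contMDiffOn.comp
      ((contMDiffOn_extChartAt (n := ∞)).mono ?_) inter_subset_right) fun p hp => hf.mapsTo hp.2
    rw [← extChartAt_source (𝓡 (2 * n))]
    exact inter_subset_left
  · rintro p ⟨hp, hpW⟩ v
    obtain ⟨y, hy, rfl⟩ : ∃ y ∈ (extChartAt (𝓡 (2 * n)) x).target,
        (extChartAt (𝓡 (2 * n)) x).symm y = p :=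
      ⟨_, (extChartAt (𝓡 (2 * n)) x).map_source hp, (extChartAt (𝓡 (2 * n)) x).left_inv hp⟩
    have hyy : extChartAt (𝓡 (2 * n)) x ((extChartAt (𝓡 (2 * n)) x).symm y) = y :=
      (extChartAt (𝓡 (2 * n)) x).right_inv hy
    have hyW : y ∈ W := by rwa [mem_preimage, hyy] at hpW
    have hfy := hf.mapsTo hyW
    have hd : DifferentiableAt ℝ f y :=
      (hf.contDiffOn.contDiffAt (hW.mem_nhds hyW)).differentiableAt (by simp)
    have h1 : HasMFDerivAt (𝓡 (2 * n)) (𝓡 (2 * n))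
        (fun p => (extChartAt (𝓡 (2 * n)) x).symm (f (extChartAt (𝓡 (2 * n)) x p)))
        ((extChartAt (𝓡 (2 * n)) x).symm y)
        ((mfderiv 𝓘(ℝ, EuclideanSpace ℝ (Fin (2 * n))) (𝓡 (2 * n))
          (extChartAt (𝓡 (2 * n)) x).symm (f y)).comp ((fderiv ℝ f y).comp
          (mfderiv (𝓡 (2 * n)) 𝓘(ℝ, EuclideanSpace ℝ (Fin (2 * n))) (extChartAt (𝓡 (2 * n)) x)
            ((extChartAt (𝓡 (2 * n)) x).symm y)))) := by
      have a1 := (mdifferentiableAt_chart hp).hasMFDerivAt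
      have a2 : HasMFDerivAt 𝓘(ℝ, EuclideanSpace ℝ (Fin (2 * n)))
          𝓘(ℝ, EuclideanSpace ℝ (Fin (2 * n))) f
          (extChartAt (𝓡 (2 * n)) x ((extChartAt (𝓡 (2 * n)) x).symm y)) (fderiv ℝ f y) := by
        rw [hyy]
        exact hd.hasFDerivAt.hasMFDerivAt
      have a3 : HasMFDerivAt 𝓘(ℝ, EuclideanSpace ℝ (Fin (2 * n))) (𝓡 (2 * n))
          (extChartAt (𝓡 (2 * n)) x).symm
          ((f ∘ extChartAt (𝓡 (2 * n)) x) ((extChartAt (𝓡 (2 * n)) x).symm y))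
          (mfderiv 𝓘(ℝ, EuclideanSpace ℝ (Fin (2 * n))) (𝓡 (2 * n))
          (extChartAt (𝓡 (2 * n)) x).symm (f y)) := by
        rw [Function.comp_apply, hyy]
        exact ((contMDiffAt_chart_symm hfy).mdifferentiableAt (by simp)).hasMFDerivAt
      exact a3.comp _ (a2.comp _ a1)
    rw [h1.mfderiv]
    refine (congrArg (fun w => mfderiv 𝓘(ℝ, EuclideanSpace ℝ (Fin (2 * n))) (𝓡 (2 * n))
          (extChartAt (𝓡 (2 * n)) x).symm (f y) (fderiv ℝ f y w))
          (J.mfderiv_chart_toFun hy v)).trans ?_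
    refine (congrArg (mfderiv 𝓘(ℝ, EuclideanSpace ℝ (Fin (2 * n))) (𝓡 (2 * n))
          (extChartAt (𝓡 (2 * n)) x).symm (f y))
          (DFunLike.congr_fun (hf.comm y hyW) _)).trans ?_
    refine (J.mfderiv_symm_inChart_apply hfy _).trans ?_
    change _ = J.toFun ((extChartAt (𝓡 (2 * n)) x).symm
      (f (extChartAt (𝓡 (2 * n)) x ((extChartAt (𝓡 (2 * n)) x).symm y)))) _
    rw [hyy]
    rfl

theorem exists_hasFDerivAt_chart_comp {g : M → M} (hy : y ∈ (extChartAt (𝓡 (2 * n)) x).target)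
    (hg : MDifferentiableAt (𝓡 (2 * n)) (𝓡 (2 * n)) g ((extChartAt (𝓡 (2 * n)) x).symm y))
    (hgs : g ((extChartAt (𝓡 (2 * n)) x).symm y) ∈ (extChartAt (𝓡 (2 * n)) x).source) :
    ∃ A : EuclideanSpace ℝ (Fin (2 * n)) →L[ℝ] EuclideanSpace ℝ (Fin (2 * n)),
      HasFDerivAt (fun y => extChartAt (𝓡 (2 * n)) x (g ((extChartAt (𝓡 (2 * n)) x).symm y))) A y ∧
      ∀ v, A v = mfderiv (𝓡 (2 * n)) 𝓘(ℝ, EuclideanSpace ℝ (Fin (2 * n)))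
        (extChartAt (𝓡 (2 * n)) x) (g ((extChartAt (𝓡 (2 * n)) x).symm y))
        (mfderiv (𝓡 (2 * n)) (𝓡 (2 * n)) g ((extChartAt (𝓡 (2 * n)) x).symm y)
        (mfderiv 𝓘(ℝ, EuclideanSpace ℝ (Fin (2 * n))) (𝓡 (2 * n))
          (extChartAt (𝓡 (2 * n)) x).symm y v)) := by
  have a1 := ((contMDiffAt_chart_symm hy).mdifferentiableAt (by simp)).hasMFDerivAt
  exact ⟨_, ((mdifferentiableAt_chart hgs).hasMFDerivAt.comp y
    (hg.hasMFDerivAt.comp y a1)).hasFDerivAt, fun v => rfl⟩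

theorem isSymOn_of_symPregroupoid {g : M → M} {V : Set M} (hV : IsOpen V)
    (hg : J.symPregroupoid.property g V) {W : Set (EuclideanSpace ℝ (Fin (2 * n)))}
    (hW : W ⊆ (extChartAt (𝓡 (2 * n)) x).target ∩ (extChartAt (𝓡 (2 * n)) x).symm ⁻¹' V)
    (hgW : ∀ y ∈ W, g ((extChartAt (𝓡 (2 * n)) x).symm y) ∈ (extChartAt (𝓡 (2 * n)) x).source) :
    IsSymOn (J.inChart x) (extChartAt (𝓡 (2 * n)) x).target
      (fun y => extChartAt (𝓡 (2 * n)) x (g ((extChartAt (𝓡 (2 * n)) x).symm y))) W := by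
  have hgat : ∀ p ∈ V, ContMDiffAt (𝓡 (2 * n)) (𝓡 (2 * n)) ∞ g p := fun p hp =>
    hg.1.contMDiffAt (hV.mem_nhds hp)
  refine ⟨fun y hy => ?_, fun y hy => (extChartAt (𝓡 (2 * n)) x).map_source (hgW y hy),
    fun y hy => ?_⟩
  · have h1 := (hgat _ (hW hy).2).comp y (contMDiffAt_chart_symm (hW hy).1)
    have h2 : ContMDiffAt (𝓡 (2 * n)) 𝓘(ℝ, EuclideanSpace ℝ (Fin (2 * n))) ∞
        (extChartAt (𝓡 (2 * n)) x) ((g ∘ (extChartAt (𝓡 (2 * n)) x).symm) y) :=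
      contMDiffAt_extChartAt' (by rw [← extChartAt_source (𝓡 (2 * n))]; exact hgW y hy)
    exact (contMDiffAt_iff_contDiffAt.1 (h2.comp y h1)).contDiffWithinAt
  · have hy' := (hW hy).1
    have hgy : (extChartAt (𝓡 (2 * n)) x).symm (extChartAt (𝓡 (2 * n)) x
      (g ((extChartAt (𝓡 (2 * n)) x).symm y))) = g ((extChartAt (𝓡 (2 * n)) x).symm y) :=
      (extChartAt (𝓡 (2 * n)) x).left_inv (hgW y hy)
    obtain ⟨A, h1, hA⟩ := exists_hasFDerivAt_chart_comp hy' ((hgat _ (hW hy).2).mdifferentiableAt (by simp)) (hgW y hy)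
    rw [h1.fderiv]
    ext1 v
    rw [ContinuousLinearMap.comp_apply, ContinuousLinearMap.comp_apply, hA, hA]
    have e1 := J.mfderiv_symm_inChart_apply hy' v
    have e2 := hg.2 _ (hW hy).2 (mfderiv 𝓘(ℝ, EuclideanSpace ℝ (Fin (2 * n))) (𝓡 (2 * n))
          (extChartAt (𝓡 (2 * n)) x).symm y v)
    have e3 := J.mfderiv_chart_toFun (x := x)
      ((extChartAt (𝓡 (2 * n)) x).map_source (hgW y hy))
    rw [hgy] at e3
    exact (congrArg (fun w => mfderiv (𝓡 (2 * n)) 𝓘(ℝ, EuclideanSpace ℝ (Fin (2 * n)))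
      (extChartAt (𝓡 (2 * n)) x) (g ((extChartAt (𝓡 (2 * n)) x).symm y))
      (mfderiv (𝓡 (2 * n)) (𝓡 (2 * n)) g ((extChartAt (𝓡 (2 * n)) x).symm y) w)) e1).trans
      ((congrArg (mfderiv (𝓡 (2 * n)) 𝓘(ℝ, EuclideanSpace ℝ (Fin (2 * n)))
      (extChartAt (𝓡 (2 * n)) x) (g ((extChartAt (𝓡 (2 * n)) x).symm y))) e2).trans (e3 _))

end AlmostComplexStructure

end Chart

/-! ### Inverses of symmetries and membership in the pseudogroup. -/

section IsSymOn

variable {E : Type} [NormedAddCommGroup E] [NormedSpace ℝ E] {J : E → E →L[ℝ] E} {Ω : Set E}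

/-- The differential of the inverse is the inverse differential; multiply the commutation relation
by it on both sides. -/
theorem IsSymOn.symm {e : OpenPartialHomeomorph E E} (he : IsSymOn J Ω e e.source)
    (hs : e.source ⊆ Ω) (hsymm : ContDiffOn ℝ ∞ e.symm e.target) :
    IsSymOn J Ω e.symm e.target := by
  refine ⟨hsymm, fun z hz => hs (e.map_target hz), fun z hz => ?_⟩
  have hy : e.symm z ∈ e.source := e.map_target hz
  have hd : HasFDerivAt e (fderiv ℝ e (e.symm z)) (e.symm z) :=
    ((he.contDiffOn.contDiffAt (e.open_source.mem_nhds hy)).differentiableAt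
      (by simp)).hasFDerivAt
  have hd' : HasFDerivAt e.symm (fderiv ℝ e.symm z) z :=
    ((hsymm.contDiffAt (e.open_target.mem_nhds hz)).differentiableAt (by simp)).hasFDerivAt
  have h1 : fderiv ℝ e (e.symm z) ∘L fderiv ℝ e.symm z = ContinuousLinearMap.id ℝ E :=
    (hd.comp z hd').unique ((hasFDerivAt_id z).congr_of_eventuallyEq
      (eventually_of_mem (e.open_target.mem_nhds hz) fun w hw => e.right_inv hw))
  have h2 : fderiv ℝ e.symm z ∘L fderiv ℝ e (e.symm z) = ContinuousLinearMap.id ℝ E := by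
    have hd'' : HasFDerivAt e.symm (fderiv ℝ e.symm z) (e (e.symm z)) := by
      rwa [e.right_inv hz]
    exact (hd''.comp (e.symm z) hd).unique ((hasFDerivAt_id (e.symm z)).congr_of_eventuallyEq
      (eventually_of_mem (e.open_source.mem_nhds hy) fun w hw => e.left_inv hw))
  have h3 := he.comm _ hy
  rw [e.right_inv hz] at h3
  calc fderiv ℝ e.symm z ∘L J z
      = fderiv ℝ e.symm z ∘L (J z ∘L fderiv ℝ e (e.symm z)) ∘L fderiv ℝ e.symm z := by
        rw [ContinuousLinearMap.comp_assoc, h1, ContinuousLinearMap.comp_id]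
    _ = (fderiv ℝ e.symm z ∘L fderiv ℝ e (e.symm z)) ∘L J (e.symm z) ∘L fderiv ℝ e.symm z := by
        rw [← h3]
        rfl
    _ = J (e.symm z) ∘L fderiv ℝ e.symm z := by rw [h2, ContinuousLinearMap.id_comp]

end IsSymOn

section Chart

variable {n : ℕ} {M : Type*} [TopologicalSpace M]
  [ChartedSpace (EuclideanSpace ℝ (Fin (2 * n))) M] [IsManifold (𝓡 (2 * n)) ∞ M] {x : M}

theorem AlmostComplexStructure.chartConj_mem_symPseudogroup (J : AlmostComplexStructure n M)
    {e : OpenPartialHomeomorph (EuclideanSpace ℝ (Fin (2 * n))) (EuclideanSpace ℝ (Fin (2 * n)))}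
    (he : IsSymOn (J.inChart x) (extChartAt (𝓡 (2 * n)) x).target e e.source)
    (hs : e.source ⊆ (extChartAt (𝓡 (2 * n)) x).target)
    (hsymm : ContDiffOn ℝ ∞ e.symm e.target) : chartConj x e ∈ J.symPseudogroup := by
  have key : ∀ e : OpenPartialHomeomorph (EuclideanSpace ℝ (Fin (2 * n)))
      (EuclideanSpace ℝ (Fin (2 * n))),
      IsSymOn (J.inChart x) (extChartAt (𝓡 (2 * n)) x).target e e.source →
      J.symPregroupoid.property (chartConj x e) (chartConj x e).source := by
    intro e he
    rw [chartConj_source]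
    exact J.symPregroupoid_of_isSymOn
      (e.isOpen_inter_preimage (isOpen_extChartAt_target (I := 𝓡 (2 * n)) x))
      (he.mono inter_subset_left)
  refine mem_groupoid_of_pregroupoid.2 ⟨key e he, ?_⟩
  have h := key e.symm (he.symm hs hsymm)
  rwa [← chartConj_symm] at h

end Chart

/-- In finite dimension the operator norm is controlled by the values on a basis, so pointwise
convergence gives convergence in norm. -/
theorem tendsto_norm_sub_id {E : Type*} [NormedAddCommGroup E] [NormedSpace ℝ E]
    [FiniteDimensional ℝ E] {α : Type*} {l : Filter α} {A : α → E →L[ℝ] E}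
    (hA : ∀ w, Tendsto (fun a => A a w) l (𝓝 w)) :
    Tendsto (fun a => ‖A a - ContinuousLinearMap.id ℝ E‖) l (𝓝 0) := by
  let b := Module.finBasis ℝ E
  obtain ⟨C, hC, hCb⟩ := b.exists_opNorm_le (F := E)
  have h1 : Tendsto (fun a => C * ∑ i, ‖A a (b i) - b i‖) l (𝓝 0) := by
    have h2 : Tendsto (fun a => C * ∑ i, ‖A a (b i) - b i‖) l (𝓝 (C * ∑ i, ‖b i - b i‖)) :=
      (tendsto_finsetSum _ fun i _ => ((hA (b i)).sub_const (b i)).norm).const_mul C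
    simpa using h2
  refine squeeze_zero (fun a => norm_nonneg _) (fun a => ?_) h1
  exact hCb (Finset.sum_nonneg fun i _ => norm_nonneg _) fun i =>
    Finset.single_le_sum (f := fun i => ‖A a (b i) - b i‖) (fun i _ => norm_nonneg _)
      (Finset.mem_univ i)

/-! ### Convergence of tangent maps read in a chart. -/

section Chart

variable {n : ℕ} {M : Type*} [TopologicalSpace M]
  [ChartedSpace (EuclideanSpace ℝ (Fin (2 * n))) M] [IsManifold (𝓡 (2 * n)) ∞ M]
  {x : M} {y : EuclideanSpace ℝ (Fin (2 * n))}

/-- Reading tangent vectors in the chart around `x` is continuous. -/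
theorem tendsto_mfderiv_chart {α : Type*} {l : Filter α} {f : α → TangentBundle (𝓡 (2 * n)) M}
    {v : TangentBundle (𝓡 (2 * n)) M} (hf : Tendsto f l (𝓝 v))
    (hv : v.proj ∈ (extChartAt (𝓡 (2 * n)) x).source) :
    Tendsto (fun a => (mfderiv (𝓡 (2 * n)) 𝓘(ℝ, EuclideanSpace ℝ (Fin (2 * n)))
        (extChartAt (𝓡 (2 * n)) x) (f a).proj (f a).2 : EuclideanSpace ℝ (Fin (2 * n)))) l
      (𝓝 (mfderiv (𝓡 (2 * n)) 𝓘(ℝ, EuclideanSpace ℝ (Fin (2 * n)))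
        (extChartAt (𝓡 (2 * n)) x) v.proj v.2 : EuclideanSpace ℝ (Fin (2 * n)))) := by
  have h : IsManifold (𝓡 (2 * n)) 1 M := IsManifold.of_le (n := ∞) (by simp)
  set T := trivializationAt (EuclideanSpace ℝ (Fin (2 * n)))
    (TangentSpace (𝓡 (2 * n)) : M → Type _) x with hT
  have key : ∀ w : TangentBundle (𝓡 (2 * n)) M, w.proj ∈ (extChartAt (𝓡 (2 * n)) x).source →
      (mfderiv (𝓡 (2 * n)) 𝓘(ℝ, EuclideanSpace ℝ (Fin (2 * n)))
        (extChartAt (𝓡 (2 * n)) x) w.proj w.2 : EuclideanSpace ℝ (Fin (2 * n))) = (T w).2 := by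
    intro w hw
    have hw' : w.proj ∈ (chartAt (EuclideanSpace ℝ (Fin (2 * n))) x).source := by
      rwa [← extChartAt_source (𝓡 (2 * n))]
    have h1 := TangentBundle.continuousLinearMapAt_trivializationAt (I := 𝓡 (2 * n)) hw'
    have h2 := Trivialization.continuousLinearMapAt_apply_of_mem (R := ℝ) T (b := w.proj)
      (by simpa [hT] using hw') w.2
    refine Eq.trans ?_ h2
    exact congrArg (fun A : EuclideanSpace ℝ (Fin (2 * n)) →L[ℝ] EuclideanSpace ℝ (Fin (2 * n)) =>
      A w.2) h1.symm
  have hsrc : v ∈ T.source := by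
    rw [T.mem_source]
    simpa [hT] using hv
  have h1 : Tendsto (fun a => (T (f a)).2) l (𝓝 (T v).2) :=
    (continuous_snd.tendsto _).comp ((T.toOpenPartialHomeomorph.continuousAt hsrc).tendsto.comp hf)
  rw [key v hv]
  refine h1.congr' ?_
  have h2 : Tendsto (fun a => (f a).proj) l (𝓝 v.proj) :=
    (FiberBundle.continuous_proj (EuclideanSpace ℝ (Fin (2 * n)))
      (TangentSpace (𝓡 (2 * n)) : M → Type _)).continuousAt.tendsto.comp hf
  filter_upwards [h2.eventually ((isOpen_extChartAt_source (I := 𝓡 (2 * n)) x).mem_nhds hv)] with a ha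
  exact (key _ ha).symm

section ContinuousConvergence

variable {e : ℕ → M → M} {V : Set M}

/-- The field with constant components `w` lifts chart points continuously to tangent vectors, so
the continuous convergence hypothesis can be pulled back to the chart. -/
theorem tendsto_tangentMap_chartField
    (hlim : ∀ v : TangentBundle (𝓡 (2 * n)) M, v.proj ∈ V →
      Tendsto (fun p : ℕ × TangentBundle (𝓡 (2 * n)) M =>
        tangentMap (𝓡 (2 * n)) (𝓡 (2 * n)) (e p.1) p.2) (atTop ×ˢ 𝓝 v) (𝓝 v))
    (hy : y ∈ (extChartAt (𝓡 (2 * n)) x).target ∩ (extChartAt (𝓡 (2 * n)) x).symm ⁻¹' V)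
    (w : EuclideanSpace ℝ (Fin (2 * n))) :
    Tendsto (fun p : ℕ × EuclideanSpace ℝ (Fin (2 * n)) =>
      tangentMap (𝓡 (2 * n)) (𝓡 (2 * n)) (e p.1)
        (⟨(extChartAt (𝓡 (2 * n)) x).symm p.2,
          chartField x w ((extChartAt (𝓡 (2 * n)) x).symm p.2)⟩ : TangentBundle (𝓡 (2 * n)) M))
      (atTop ×ˢ 𝓝 y) (𝓝 (⟨(extChartAt (𝓡 (2 * n)) x).symm y,
          chartField x w ((extChartAt (𝓡 (2 * n)) x).symm y)⟩ : TangentBundle (𝓡 (2 * n)) M)) :=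
  (hlim (⟨(extChartAt (𝓡 (2 * n)) x).symm y,
      chartField x w ((extChartAt (𝓡 (2 * n)) x).symm y)⟩ : TangentBundle (𝓡 (2 * n)) M)
      hy.2).comp (tendsto_id.prodMap
    ((contMDiffAt_chartField w (symm_mem_source hy.1)).continuousAt.comp
      (contMDiffAt_chart_symm hy.1).continuousAt).tendsto)

theorem tendsto_of_tendsto_tangentMap
    (hlim : ∀ v : TangentBundle (𝓡 (2 * n)) M, v.proj ∈ V →
      Tendsto (fun p : ℕ × TangentBundle (𝓡 (2 * n)) M =>
        tangentMap (𝓡 (2 * n)) (𝓡 (2 * n)) (e p.1) p.2) (atTop ×ˢ 𝓝 v) (𝓝 v))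
    (hy : y ∈ (extChartAt (𝓡 (2 * n)) x).target ∩ (extChartAt (𝓡 (2 * n)) x).symm ⁻¹' V) :
    Tendsto (fun p : ℕ × EuclideanSpace ℝ (Fin (2 * n)) =>
      e p.1 ((extChartAt (𝓡 (2 * n)) x).symm p.2)) (atTop ×ˢ 𝓝 y)
      (𝓝 ((extChartAt (𝓡 (2 * n)) x).symm y)) :=
  (FiberBundle.continuous_proj (EuclideanSpace ℝ (Fin (2 * n)))
    (TangentSpace (𝓡 (2 * n)) : M → Type _)).continuousAt.tendsto.comp
    (tendsto_tangentMap_chartField hlim hy 0)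

/-- Read in the chart, the tangent map applied to the field with constant components `w` is the
derivative of the chart expression applied to `w`. -/
theorem tendsto_fderiv_of_tendsto_tangentMap (hV : IsOpen V)
    (he : ∀ k, ContMDiffOn (𝓡 (2 * n)) (𝓡 (2 * n)) ∞ (e k) V)
    (hlim : ∀ v : TangentBundle (𝓡 (2 * n)) M, v.proj ∈ V →
      Tendsto (fun p : ℕ × TangentBundle (𝓡 (2 * n)) M =>
        tangentMap (𝓡 (2 * n)) (𝓡 (2 * n)) (e p.1) p.2) (atTop ×ˢ 𝓝 v) (𝓝 v))
    (hy : y ∈ (extChartAt (𝓡 (2 * n)) x).target ∩ (extChartAt (𝓡 (2 * n)) x).symm ⁻¹' V)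
    (w : EuclideanSpace ℝ (Fin (2 * n))) :
    Tendsto (fun p : ℕ × EuclideanSpace ℝ (Fin (2 * n)) => fderiv ℝ (fun y =>
        extChartAt (𝓡 (2 * n)) x (e p.1 ((extChartAt (𝓡 (2 * n)) x).symm y))) p.2 w)
      (atTop ×ˢ 𝓝 y) (𝓝 w) := by
  have hys := symm_mem_source hy.1
  have hsrc := (tendsto_of_tendsto_tangentMap hlim hy).eventually
    ((isOpen_extChartAt_source (I := 𝓡 (2 * n)) x).mem_nhds hys)
  have hsnd : Tendsto (fun p : ℕ × EuclideanSpace ℝ (Fin (2 * n)) => p.2) (atTop ×ˢ 𝓝 y) (𝓝 y) :=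
    tendsto_snd
  have hmem := hsnd.eventually
    ((AlmostComplexStructure.isOpen_target_inter_preimage hV x).mem_nhds hy)
  have h1 := tendsto_mfderiv_chart (tendsto_tangentMap_chartField hlim hy w) hys
  have h2 : mfderiv (𝓡 (2 * n)) 𝓘(ℝ, EuclideanSpace ℝ (Fin (2 * n)))
      (extChartAt (𝓡 (2 * n)) x) ((extChartAt (𝓡 (2 * n)) x).symm y)
      (chartField x w ((extChartAt (𝓡 (2 * n)) x).symm y)) = w := by
    rw [← inChart_eq _ hy.1, inChart_chartField w hy.1]
  have h3 : Tendsto _ (atTop ×ˢ 𝓝 y) (𝓝 w) := h1.trans (le_of_eq (congrArg 𝓝 h2))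
  refine h3.congr' ?_
  filter_upwards [hsrc, hmem] with p hp hpm
  obtain ⟨A, hA, hAv⟩ := AlmostComplexStructure.exists_hasFDerivAt_chart_comp hpm.1
    (((he p.1).contMDiffAt (hV.mem_nhds hpm.2)).mdifferentiableAt (by simp)) hp
  rw [hA.fderiv, hAv]
  have h4 := mfderiv_symm_inChart (chartField x w) hpm.1
  rw [inChart_chartField w hpm.1] at h4
  exact congrArg (fun w => mfderiv (𝓡 (2 * n)) 𝓘(ℝ, EuclideanSpace ℝ (Fin (2 * n)))
      (extChartAt (𝓡 (2 * n)) x) (e p.1 ((extChartAt (𝓡 (2 * n)) x).symm p.2))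
      (mfderiv (𝓡 (2 * n)) (𝓡 (2 * n)) (e p.1) ((extChartAt (𝓡 (2 * n)) x).symm p.2) w)) h4.symm

/-- Continuous convergence of tangent maps to the identity, in a chart. -/
theorem eventually_closeToId_of_tendsto_tangentMap (hV : IsOpen V)
    (he : ∀ k, ContMDiffOn (𝓡 (2 * n)) (𝓡 (2 * n)) ∞ (e k) V)
    (hlim : ∀ v : TangentBundle (𝓡 (2 * n)) M, v.proj ∈ V →
      Tendsto (fun p : ℕ × TangentBundle (𝓡 (2 * n)) M =>
        tangentMap (𝓡 (2 * n)) (𝓡 (2 * n)) (e p.1) p.2) (atTop ×ˢ 𝓝 v) (𝓝 v))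
    (hy : y ∈ (extChartAt (𝓡 (2 * n)) x).target ∩ (extChartAt (𝓡 (2 * n)) x).symm ⁻¹' V)
    {ε : ℝ} (hε : 0 < ε) :
    ∀ᶠ p in (atTop : Filter ℕ) ×ˢ 𝓝 y,
      e p.1 ((extChartAt (𝓡 (2 * n)) x).symm p.2) ∈ (extChartAt (𝓡 (2 * n)) x).source ∧
      ‖extChartAt (𝓡 (2 * n)) x (e p.1 ((extChartAt (𝓡 (2 * n)) x).symm p.2)) - p.2‖ < ε ∧
      ‖fderiv ℝ (fun y => extChartAt (𝓡 (2 * n)) x (e p.1 ((extChartAt (𝓡 (2 * n)) x).symm y))) p.2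
        - ContinuousLinearMap.id ℝ _‖ < ε := by
  have hys := symm_mem_source hy.1
  have hyy : extChartAt (𝓡 (2 * n)) x ((extChartAt (𝓡 (2 * n)) x).symm y) = y :=
    (extChartAt (𝓡 (2 * n)) x).right_inv hy.1
  have hproj := tendsto_of_tendsto_tangentMap hlim hy
  have hsnd : Tendsto (fun p : ℕ × EuclideanSpace ℝ (Fin (2 * n)) => p.2) (atTop ×ˢ 𝓝 y) (𝓝 y) :=
    tendsto_snd
  have hsrc := hproj.eventually ((isOpen_extChartAt_source (I := 𝓡 (2 * n)) x).mem_nhds hys)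
  have hval : Tendsto (fun p : ℕ × EuclideanSpace ℝ (Fin (2 * n)) =>
      ‖extChartAt (𝓡 (2 * n)) x (e p.1 ((extChartAt (𝓡 (2 * n)) x).symm p.2)) - p.2‖)
      (atTop ×ˢ 𝓝 y) (𝓝 0) := by
    have h1 := ((continuousAt_extChartAt' (I := 𝓡 (2 * n)) hys).tendsto.comp hproj).sub hsnd
    rw [hyy, sub_self] at h1
    rw [← norm_zero (E := EuclideanSpace ℝ (Fin (2 * n)))]
    exact h1.norm
  have hder := tendsto_norm_sub_id (tendsto_fderiv_of_tendsto_tangentMap hV he hlim hy)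
  filter_upwards [hsrc, hval.eventually_lt_const hε, hder.eventually_lt_const hε] with p h1 h2 h3
  exact ⟨h1, h2, h3⟩

end ContinuousConvergence

/-- The local group of the chart is conjugated by the chart. Only exhaustion needs more: convergence
of tangent maps must be turned into uniform C¹ closeness on a ball. -/
theorem AlmostComplexStructure.isLocalLieGroupAt [T2Space M] (J : AlmostComplexStructure n M)
    (hN : J.nijenhuisImage x = ⊤) {d : ℕ}
    (hd : Module.finrank ℝ (infJets (J.inChart x) (extChartAt (𝓡 (2 * n)) x x)) = d) :
    IsLocalLieGroupAt (n := n) J.symPseudogroup d x := by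
  obtain ⟨Φ, B, B₀, m, ρ, hρ, hρΩ, hB, hB₀, h0, hBB, hΦ, hΦ0, hΦe, hinj, hm, hmul, hex⟩ :=
    exists_local_lie (isOpen_extChartAt_target x) (J.contDiffOn_inChart x)
    (fun y hy => J.inChart_sq hy) (mem_extChartAt_target x) (J.span_nij_inChart hN) hd
  set φ := extChartAt (𝓡 (2 * n)) x with hφ
  have hx : φ x ∈ φ.target := mem_extChartAt_target x
  have hxs : x ∈ φ.source := mem_extChartAt_source x
  have hφc : Tendsto φ (𝓝 x) (𝓝 (φ x)) := continuousAt_extChartAt x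
  have hψc : Tendsto φ.symm (𝓝 (φ x)) (𝓝 x) := by
    have := continuousAt_extChartAt_symm (I := 𝓡 (2 * n)) x
    rwa [ContinuousAt, extChartAt_to_inv] at this
  have hΦΩ : ∀ t ∈ B, ∀ y ∈ Metric.ball (φ x) ρ, Φ (t, y) ∈ φ.target := fun t ht y hy =>
    (hΦe t ht).1.mapsTo hy
  have hball : ∀ᶠ y in 𝓝 (φ x), y ∈ Metric.ball (φ x) ρ := Metric.ball_mem_nhds _ hρ
  have hsrc : ∀ᶠ p in 𝓝 x, p ∈ φ.source :=
    (isOpen_extChartAt_source (I := 𝓡 (2 * n)) x).mem_nhds hxs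
  refine ⟨φ.source ∩ φ ⁻¹' Metric.ball (φ x) ρ, B, B₀, fun t p => φ.symm (Φ (t, φ p)), m,
    isOpen_source_inter_preimage_chart x Metric.isOpen_ball, ⟨hxs, Metric.mem_ball_self hρ⟩,
    hB, hB₀, h0, hBB, ?_, ?_, ?_, ?_, hm, ?_, ?_⟩
  · have h1 : ContMDiffOn ((𝓡 d).prod (𝓡 (2 * n)))
        𝓘(ℝ, EuclideanSpace ℝ (Fin d) × EuclideanSpace ℝ (Fin (2 * n))) ∞
        (fun p : EuclideanSpace ℝ (Fin d) × M => (p.1, φ p.2))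
        (B ×ˢ (φ.source ∩ φ ⁻¹' Metric.ball (φ x) ρ)) := by
      refine ContMDiffOn.prodMk_space contMDiffOn_fst ?_
      refine (contMDiffOn_extChartAt (x := x) (n := ∞)).comp contMDiffOn_snd fun p hp => ?_
      rw [← extChartAt_source (𝓡 (2 * n))]
      exact hp.2.1
    exact (contMDiffOn_extChartAt_symm x).comp (hΦ.contMDiffOn.comp h1
      fun p hp => ⟨hp.1, hp.2.2⟩) fun p hp => hΦΩ _ hp.1 _ hp.2.2
  · rintro p ⟨hp, hpb⟩
    simp only [hΦ0 _ hpb]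
    exact φ.left_inv hp
  · intro t ht
    obtain ⟨hsym, e, hes, hef, hesymm⟩ := hΦe t ht
    have hmaps : ∀ y ∈ Metric.ball (φ x) ρ, e y ∈ φ.target := fun y hy => by
      rw [hef]
      exact hsym.mapsTo hy
    refine ⟨chartConj x e, J.chartConj_mem_symPseudogroup ?_ (hes ▸ hρΩ) hesymm, ?_, ?_⟩
    · rw [hes, hef]
      exact hsym
    · rw [chartConj_source, hes]
      ext p
      exact ⟨fun h => ⟨h.1, h.2.1⟩, fun h => ⟨h.1, h.2, hmaps _ h.2⟩⟩
    · intro p _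
      rw [chartConj_apply, hef]
  · intro s hs t ht hst
    refine hinj s hs t ht ?_
    filter_upwards [hψc.eventually hst, hball,
      (isOpen_extChartAt_target (I := 𝓡 (2 * n)) x).mem_nhds hx] with y h1 h2 h3
    rw [φ.right_inv h3] at h1
    exact φ.symm.injOn (hΦΩ s hs y h2) (hΦΩ t ht y h2) h1
  · intro s hs t ht
    obtain ⟨h1, h2, h3⟩ := hmul s hs t ht
    have ht' := hΦΩ t (hBB ht)
    refine ⟨h1, ⟨φ.map_target (hρΩ h2), ?_⟩, ?_⟩
    · simp only [mem_preimage]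
      rwa [φ.right_inv (hρΩ h2)]
    · filter_upwards [hφc.eventually h3, hφc.eventually hball] with p h4 h5
      rw [φ.right_inv (ht' _ h5), h4]
  · intro V hV hxV e he hlim
    have hO := AlmostComplexStructure.isOpen_target_inter_preimage (n := n) hV x
    obtain ⟨r, hr, hrV⟩ := Metric.nhds_basis_closedBall.mem_iff.1
      (hO.mem_nhds (AlmostComplexStructure.mem_target_inter_preimage hxV))
    obtain ⟨ε, hε, hεf⟩ := hex r hr
    have hprop : ∀ k, J.symPregroupoid.property (e k) (e k).source := fun k =>
      (mem_groupoid_of_pregroupoid.1 (he k).1).1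
    -- Closeness holds jointly for large indices and nearby points; compactness of the closed ball
    -- makes the index uniform.
    have hunif : ∀ᶠ k in atTop, ∀ y ∈ Metric.closedBall (φ x) r,
        e k (φ.symm y) ∈ φ.source ∧ ‖φ (e k (φ.symm y)) - y‖ < ε ∧
        ‖fderiv ℝ (fun y => φ (e k (φ.symm y))) y - ContinuousLinearMap.id ℝ _‖ < ε := by
      have hK : IsCompact (Metric.closedBall (φ x) r) := isCompact_closedBall _ _
      have h1 := hK.mem_prod_nhdsSet_of_forall fun y hy =>
        eventually_closeToId_of_tendsto_tangentMap (x := x) hV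
          (fun k => (hprop k).1.mono (he k).2) hlim (hrV hy) hε
      exact (Eventually.curry h1).mono fun k h => h.self_of_nhdsSet
    filter_upwards [hunif] with k hk
    have hsub := Metric.ball_subset_closedBall (x := φ x) (ε := r)
    obtain ⟨t, ht, hft⟩ := hεf (fun y => φ (e k (φ.symm y)))
      (J.isSymOn_of_symPregroupoid (e k).open_source (hprop k)
        (fun y hy => ⟨(hrV (hsub hy)).1, (he k).2 (hrV (hsub hy)).2⟩) fun y hy => (hk y (hsub hy)).1)
      (fun y hy => (hk y (hsub hy)).2)
    refine ⟨t, ht, ?_⟩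
    filter_upwards [hφc.eventually hft, hφc.eventually (Metric.ball_mem_nhds _ hr), hsrc]
      with p h1 h2 h3
    have h4 := (hk _ (hsub h2)).1
    rw [φ.left_inv h3] at h1 h4
    rw [← h1, φ.left_inv h4]

end Chart

end AlmostComplex

end

/-! ### The main theorem. -/

open AlmostComplex in
theorem theorem1 {n : ℕ} (hn : 1 < n) {M : Type*} [TopologicalSpace M] [T2Space M]
    [SecondCountableTopology M] [ConnectedSpace M]
    [ChartedSpace (EuclideanSpace ℝ (Fin (2 * n))) M] [IsManifold (𝓡 (2 * n)) ∞ M]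
    (J : AlmostComplexStructure n M) :
    (2 < n → J.NijenhuisOnto →
      (∀ (U : Set M) (hU : IsOpen U), IsConnected U →
        FiniteDimensional ℝ (J.infSym U hU) ∧
          Module.finrank ℝ (J.infSym U hU) < 2 * (n ^ 2 + n)) ∧
      (∀ x : M, ∃ d : ℕ, d < 2 * (n ^ 2 + n) ∧ IsLocalLieGroupAt (n := n) J.symPseudogroup d x)) ∧
    (∀ x : M, J.NijenhuisNeZeroAt x → DependsOnAtMost (J.formalDim x) (n - 1) (n - 1)) := by
  -- The dimension of the local group at `x` is that of the space of 1-jets at `x` of germs of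
  -- infinitesimal symmetries.
  refine ⟨fun _ hN => ⟨fun U hU hUc => J.finrank_infSym_lt (by omega) hN hU hUc, fun x =>
    ⟨_, ?_, J.isLocalLieGroupAt (hN x) rfl⟩⟩, fun x hx => J.dependsOnAtMost_formalDim hn hx⟩
  exact finrank_infJets_lt (isOpen_extChartAt_target x) (J.contDiffOn_inChart x)
    (fun y hy => J.inChart_sq hy) (mem_extChartAt_target x) (J.span_nij_inChart (hN x))
    (by simp) (by omega)
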